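/- All graphs are simple and finite, and $H$ always has at least one vertex. Let $\mathbb K$ be any field. For a graph $G$ let $\mathrm{cl}(G)$ be its clique complex, and let $\widetilde H_i(\,\cdot\,;\mathbb K)$ denote reduced simplicial homology with coefficients in $\mathbb K$. For a graph $H$ and an integer $n\ge 0$ put $$b_H(n)=\max_G\ \sum_{i\ge -1}\dim_{\mathbb K}\widetilde H_i(\mathrm{cl}(G);\mathbb K),$$ where $G$ runs over all graphs on at most $n$ vertices that contain no induced copy of $H$. Write $K_{i_1,\dots,i_m}$ for the complete multipartite graph with parts of sizes $i_1,\dots,i_m$, and $K_{5,5,\dots}$ for the complete multipartite graph with countably infinitely many parts, all of size $5$. Let $\Gamma_4\approx 1.2434$ be the unique root in $[1,2]$ of $x^8-x^3-x^2-x-1=0$. **Theorem.** For every field $\mathbb K$ the following hold. For every graph $H$ the limit $c_H=\lim_{n\to\infty} b_H(n)^{1/n}$ exists. Moreover: (i) If $H$ is not an induced subgraph of $K_{5,5,\dots}$, then $c_H=4^{1/5}$. (ii) There are real numbers $c'_1,\dots,c'_5$ such that $c_H=c'_{i_1}$ whenever $H\cong K_{i_1,\dots,i_m}$ with $m\ge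 1$ and $5\ge i_1\ge\dots\ge i_m\ge 1$. They satisfy $$c'_5=3^{1/4},\qquad c'_4=2^{1/3},\qquad c'_3\in[8^{1/14},\Gamma_4],\qquad c'_2=c'_1=1.$$ Consequently, as $H$ ranges over all graphs, $c_H$ takes exactly five different values. -/

import Mathlib

open Filter Topology

universe u v

noncomputable section

namespace CliqueBetti

open SimpleGraph

section Homology

variable {V : Type*} [LinearOrder V] [Fintype V]

/-- The faces with exactly `j` vertices (dimension `j - 1`) of the clique complex of `G`:
the cliques of size `j`. For `j = 0` this is the empty face only. -/
abbrev Face (G : SimpleGraph V) (j : ℕ) : Type _ := {s : Finset V // G.IsNClique j s}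

/-- The face obtained by deleting a vertex `v`. -/
def Face.delete {G : SimpleGraph V} {j : ℕ} (s : Face G (j + 1)) (v : s.1) : Face G j :=
  ⟨s.1.erase v, by simpa using s.2.erase_of_mem v.2⟩

instance (G : SimpleGraph V) (j : ℕ) : Fintype (Face G j) := Fintype.ofFinite _

variable (K : Type*) [Field K] (G : SimpleGraph V)

/-- The simplicial chains of dimension `j - 1` with coefficients in `K`. -/
abbrev Chain (j : ℕ) : Type _ := Face G j → K

/-- The simplicial boundary map of the augmented chain complex, with the signs given by the order
of the vertices: `∂ [v₀, …, v_j] = ∑ i, (-1) ^ i [v₀, …, v̂ᵢ, …, v_j]` for `v₀ < ⋯ < v_j`.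
For `j = 0` it is the augmentation. -/
def boundary (j : ℕ) : Chain K G (j + 1) →ₗ[K] Chain K G j :=
  Fintype.linearCombination K fun s : Face G (j + 1) =>
    ∑ v : s.1, Pi.single (s.delete v) ((-1 : K) ^ (s.1.filter (· < v.1)).card)

theorem boundary_boundary (j : ℕ) (x : Chain K G (j + 2)) :
    boundary K G j (boundary K G (j + 1) x) = 0 := by
  suffices h : boundary K G j ∘ₗ boundary K G (j + 1) = 0 by
    simpa using LinearMap.congr_fun h x
  refine LinearMap.pi_ext' fun s => LinearMap.ext fun a => ?_
  have hb : ∀ (i : ℕ) (s : Face G (i + 1)) (a : K), boundary K G i (Pi.single s a) =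
      a • ∑ v : s.1, Pi.single (s.delete v) ((-1 : K) ^ (s.1.filter (· < v.1)).card) := by
    intro i s a
    simp [boundary, Fintype.linearCombination_apply_single]
  show boundary K G j (boundary K G (j + 1) (Pi.single s a)) = 0
  · clear x
    suffices h : ∑ p : (Σ v : s.1, (s.delete v).1),
        Pi.single (M := fun _ => K) ((s.delete p.1).delete p.2)
          ((-1 : K) ^ (s.1.filter (· < p.1.1)).card *
            (-1 : K) ^ ((s.1.erase p.1).filter (· < p.2.1)).card) = 0 by
      rw [Fintype.sum_sigma] at h
      simp only [hb, map_smul, map_sum]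
      rw [← smul_zero a, ← h]
      congr 1
      refine Finset.sum_congr rfl fun v _ => ?_
      rw [Finset.smul_sum]
      refine Finset.sum_congr rfl fun w _ => ?_
      rw [← Pi.single_smul, smul_eq_mul]
      rfl
    refine Finset.sum_involution
      (fun p _ => ⟨⟨p.2.1, Finset.mem_of_mem_erase p.2.2⟩,
        ⟨p.1.1, Finset.mem_erase.2 ⟨(Finset.ne_of_mem_erase p.2.2).symm, p.1.2⟩⟩⟩)
      ?_ ?_ (by simp) (by simp)
    · rintro ⟨⟨v, hv⟩, ⟨w, hw⟩⟩ _
      have hw' : w ∈ s.1 := Finset.mem_of_mem_erase hw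
      have hne : w ≠ v := Finset.ne_of_mem_erase hw
      have hf : ∀ a b : V, a ∈ s.1 → a < b →
          (s.1.filter (· < b)).card = ((s.1.erase a).filter (· < b)).card + 1 := by
        intro a b ha hab
        rw [Finset.filter_erase, Finset.card_erase_add_one]
        simp [ha, hab]
      have hg : ∀ a b : V, ¬ a < b →
          ((s.1.erase a).filter (· < b)) = (s.1.filter (· < b)) := by
        intro a b hab
        rw [Finset.filter_erase, Finset.erase_eq_of_notMem]
        simp [hab]
      have he : ((s.delete ⟨v, hv⟩).delete ⟨w, hw⟩) = ((s.delete ⟨w, hw'⟩).delete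
          ⟨v, Finset.mem_erase.2 ⟨hne.symm, hv⟩⟩) :=
        Subtype.ext (Finset.erase_right_comm)
      simp only [he]
      rw [← Pi.single_add]
      rw [Pi.single_eq_zero_iff]
      rcases lt_or_gt_of_ne hne with h | h
      · rw [hg v w h.not_gt, hf w v hw' h]
        ring
      · rw [hg w v h.not_gt, hf v w hv h]
        ring
    · rintro ⟨⟨v, hv⟩, ⟨w, hw⟩⟩ _ _ h
      have hne : w ≠ v := Finset.ne_of_mem_erase hw
      simp only [Sigma.mk.injEq, Subtype.mk.injEq] at h
      exact hne h.1

/-- The cycles of dimension `j - 1`. In dimension `-1` every chain is a cycle. -/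
def cycles : (j : ℕ) → Submodule K (Chain K G j)
  | 0 => ⊤
  | j + 1 => LinearMap.ker (boundary K G j)

/-- The boundaries of dimension `j - 1`. -/
def boundaries (j : ℕ) : Submodule K (Chain K G j) := LinearMap.range (boundary K G j)

/-- The reduced simplicial homology of the clique complex of `G` in dimension `j - 1`:
cycles modulo boundaries. -/
abbrev ReducedHomology (j : ℕ) : Type _ :=
  cycles K G j ⧸ (boundaries K G j).submoduleOf (cycles K G j)

/-- The total reduced Betti number of the clique complex of `G`: the sum of `dim H̃_{j-1}` over
`0 ≤ j ≤ |V|`. There are no faces with more than `|V|` vertices. -/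
def totalBetti : ℕ :=
  ∑ j ∈ Finset.range (Fintype.card V + 1), Module.finrank K (ReducedHomology K G j)

end Homology

/-- `b_H(n)` over the field `K`: the maximum of the total reduced Betti number of the clique
complex of `G` over all graphs `G` on at most `n` vertices without an induced copy of `H`. (The
set is finite, and it is nonempty if `H` has a vertex.) -/
def maxBetti (K : Type*) [Field K] {V : Type*} (H : SimpleGraph V) (n : ℕ) : ℕ :=
  sSup {b | ∃ k ≤ n, ∃ G : SimpleGraph (Fin k), ¬ H.IsIndContained G ∧ b = totalBetti K G}

/-- `c_H` over the field `K` exists and equals `c`, where `c_H` is the limit of `b_H(n)^{1/n}`. -/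
def HasGrowthRate (K : Type*) [Field K] {V : Type*} (H : SimpleGraph V) (c : ℝ) : Prop :=
  Tendsto (fun n : ℕ => (maxBetti K H n : ℝ) ^ (1 / (n : ℝ))) atTop (𝓝 c)

/-- The complete multipartite graph `K_{5,5,…}` with countably many parts of size five. -/
abbrev infiniteMultipartiteFive : SimpleGraph (Σ _ : ℕ, Fin 5) :=
  completeMultipartiteGraph fun _ : ℕ => Fin 5

/-- `Γ_d`: the root on `[1, 2]` of `x^{2d} - x^{d-1} - ⋯ - x - 1 = 0` (unique for `d ≥ 1`, see
`existsUnique_root` and `gamma_spec`). -/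
def gamma (d : ℕ) : ℝ :=
  sInf {x : ℝ | x ∈ Set.Icc 1 2 ∧ x ^ (2 * d) - ∑ i ∈ Finset.range d, x ^ i = 0}

theorem existsUnique_root (d : ℕ) (hd : 1 ≤ d) :
    ∃! x : ℝ, x ∈ Set.Icc 1 2 ∧ x ^ (2 * d) - ∑ i ∈ Finset.range d, x ^ i = 0 := by
  have hlt : ∀ x y : ℝ, 1 ≤ x → x < y → x ^ (2 * d) - ∑ i ∈ Finset.range d, x ^ i = 0 →
      y ^ (2 * d) - ∑ i ∈ Finset.range d, y ^ i = 0 → False := by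
    intro x y hx hxy h1 h2
    have hlt : ∑ i ∈ Finset.range d, y ^ i * x ^ (2 * d) <
        ∑ i ∈ Finset.range d, x ^ i * y ^ (2 * d) := by
      refine Finset.sum_lt_sum_of_nonempty (by simp; omega) fun i hi => ?_
      have hi' := Finset.mem_range.1 hi
      obtain ⟨k, hk, hk0⟩ : ∃ k, 2 * d = i + k ∧ k ≠ 0 := ⟨2 * d - i, by omega, by omega⟩
      rw [hk, pow_add, pow_add]
      have hp : x ^ k < y ^ k := pow_lt_pow_left₀ hxy (by linarith) hk0
      have hx0 : 0 < x ^ i * y ^ i := by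
        have : 0 < y := by linarith
        positivity
      nlinarith
    rw [← Finset.sum_mul, ← Finset.sum_mul] at hlt
    rw [sub_eq_zero] at h1 h2
    rw [← h1, ← h2, mul_comm] at hlt
    exact lt_irrefl _ hlt
  have hc : ContinuousOn (fun x : ℝ => x ^ (2 * d) - ∑ i ∈ Finset.range d, x ^ i)
      (Set.Icc 1 2) := by fun_prop
  have h0 : (0 : ℝ) ∈ Set.Icc ((1 : ℝ) ^ (2 * d) - ∑ i ∈ Finset.range d, (1 : ℝ) ^ i)
      ((2 : ℝ) ^ (2 * d) - ∑ i ∈ Finset.range d, (2 : ℝ) ^ i) := by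
    have : (1 : ℝ) ≤ d := by exact_mod_cast hd
    constructor
    · simpa using this
    · rw [geom_sum_eq (by norm_num)]
      have h : (2 : ℝ) ^ d ≤ 2 ^ (2 * d) := pow_le_pow_right₀ (by norm_num) (by omega)
      linarith
  obtain ⟨x, hx, hx0⟩ := intermediate_value_Icc (by norm_num) hc h0
  refine ⟨x, ⟨hx, hx0⟩, fun y ⟨hy, hy0⟩ => ?_⟩
  rcases lt_trichotomy y x with h | h | h
  · exact (hlt y x hy.1 h hy0 hx0).elim
  · exact h
  · exact (hlt x y hx.1 h hx0 hy0).elim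

theorem gamma_spec (d : ℕ) (hd : 1 ≤ d) :
    gamma d ∈ Set.Icc 1 2 ∧ gamma d ^ (2 * d) - ∑ i ∈ Finset.range d, gamma d ^ i = 0 := by
  obtain ⟨x, hx, hu⟩ := existsUnique_root d hd
  have : gamma d = x := by
    have hs : {x : ℝ | x ∈ Set.Icc 1 2 ∧ x ^ (2 * d) - ∑ i ∈ Finset.range d, x ^ i = 0} = {x} :=
      Set.eq_singleton_iff_unique_mem.2 ⟨hx, hu⟩
    rw [gamma, hs, csInf_singleton]
  rw [this]
  exact hx

end CliqueBetti

end

/-! Let `F` be the complement of `G`, so that the faces are the independent sets of `F`, and let `b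
W` be the total Betti number of the complex induced on `W`. Comparing the complex with the deletion
and the link of a vertex `v` gives `b W ≤ b (W - v) + b (W \ N_F[v])`. If `v` is isolated in `F`,
the complex is a cone and `b W ≤ 0`. These two facts and `b ∅ ≤ 1` form the structure `Branching`;
the upper bounds use nothing else.

Deleting the neighbours `u₁, …, u_d` of `v` in `F` one after another finally isolates `v`, so `b W`
is at most the sum of the link terms `b (W \ {u₁, …, u_{j-1}} \ N[u_j])`. If `v` has minimum degree,
each term misses at least `d + 1` vertices, and one more for every earlier `u_i` not adjacent to
`u_j`. Induction gives `b W ≤ x ^ |W|` as soon as `d ≤ x ^ (d + 1)` for all `d`; the worst case `d =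
4` yields `x = 4 ^ (1/5)` for all graphs. If `G` has no `i` independent vertices, then `F` has no
clique of size `i`, neighbourhoods in `F` contain nonadjacent pairs, and the gain improves the base:
to `3 ^ (1/4)` for `i = 5` (`Branching.le_pow_of_pow_four`), to `2 ^ (1/3)` for `i = 4`
(`Branching.le_pow_of_pow_three`), and to `gamma 4` for `i = 3` (`Branching.le_gamma_four_pow`). The
case `i = 4` is the longest: a minimal counterexample (`Critical`) has all degrees at most five, and
minimum degrees three, four and five are excluded by going through the triangle-free graphs that can
occur as the neighbourhood of a vertex. For `i ≤ 2` the graph `G` is complete, hence its complex is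
a cone or empty.

Lower bounds come from joins: products of cycles and dual cocycles show that Betti numbers are
supermultiplicative (`totalBetti_mul_le`). The building blocks are edgeless graphs on three, four
and five vertices and one graph on `14` vertices, whose Betti numbers are bounded below by the Euler
characteristic. Supermultiplicativity and Fekete's lemma also give the limit when `H` is edgeless on
`i` vertices, together with the bound `maxBetti ≤ c ^ n` without a constant.

For general `H` there are two cases. If `H` is not induced in `K_{5,5,…}`, then the finite complete
multipartite graphs with parts of size five are `H`-free and attain the universal bound. Otherwise
`H` lies between the edgeless graph on its largest part, of size `i`, and a complete multipartite
graph with `m` parts of size `i`. Excluding the latter from `G` means that `F` has no `m` disjoint,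
mutually nonadjacent cliques of size `i`. Vertices of large degree in `F` branch at rate close to
`1`; once all degrees are bounded, deleting boundedly many vertices destroys all `i`-cliques. Hence
`H` and the edgeless graph have the same rate (`Branching.le_of_not_packs`). -/

noncomputable section

namespace CliqueBetti

/-! ### Ranks of block, graded and square-zero matrices -/

section LinearAlgebra

variable {K : Type*} [Field K]

open Matrix

theorem toMatrix'_mulVecLin {m n : Type*} [Fintype n] [DecidableEq n] (M : Matrix m n K) :
    LinearMap.toMatrix' M.mulVecLin = M := by
  rw [← Matrix.toLin'_apply', LinearMap.toMatrix'_toLin']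

/-- A certificate for the rank: choose a left inverse of a basis of the column space and lifts of
the basis vectors. Certificates of this kind, unlike ranks, combine directly under block sums and
Kronecker products. -/
theorem exists_mul_mul_eq_one {m n : Type*} [Fintype m] [Fintype n] [DecidableEq m]
    [DecidableEq n] (M : Matrix m n K) :
    ∃ (P : Matrix (Fin M.rank) m K) (Q : Matrix n (Fin M.rank) K), P * M * Q = 1 := by
  let R := LinearMap.range M.mulVecLin
  let b : Module.Basis (Fin M.rank) K R := Module.finBasis K R
  let f : (Fin M.rank → K) →ₗ[K] (m → K) := R.subtype ∘ₗ b.equivFun.symm.toLinearMap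
  have hf : LinearMap.ker f = ⊥ := by
    rw [LinearMap.ker_eq_bot]
    exact Subtype.val_injective.comp b.equivFun.symm.injective
  obtain ⟨g, hg⟩ := f.exists_leftInverse_of_injective hf
  obtain ⟨s, hs⟩ := M.mulVecLin.rangeRestrict.exists_rightInverse_of_surjective
    (LinearMap.range_rangeRestrict _)
  let h : (Fin M.rank → K) →ₗ[K] (n → K) := s ∘ₗ b.equivFun.symm.toLinearMap
  have hh : M.mulVecLin ∘ₗ h = f := by
    refine LinearMap.ext fun x => ?_
    exact congrArg Subtype.val (LinearMap.congr_fun hs (b.equivFun.symm x))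
  refine ⟨LinearMap.toMatrix' g, LinearMap.toMatrix' h, ?_⟩
  have hM : M * LinearMap.toMatrix' h = LinearMap.toMatrix' f := by
    rw [← hh, LinearMap.toMatrix'_comp, toMatrix'_mulVecLin]
  rw [Matrix.mul_assoc, hM, ← LinearMap.toMatrix'_comp, hg, LinearMap.toMatrix'_id]

theorem card_le_rank_of_mul_mul_isUnit {m n k : Type*} [Fintype m] [Fintype n] [Fintype k]
    [DecidableEq k] (M : Matrix m n K) (P : Matrix k m K) (Q : Matrix n k K)
    (h : IsUnit (P * M * Q)) : Fintype.card k ≤ M.rank := by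
  rw [← Matrix.rank_of_isUnit _ h]
  exact (rank_mul_le_left _ _).trans (rank_mul_le_right _ _)

/-- The certificates of the diagonal blocks compress the whole matrix to a unitriangular one. -/
theorem rank_add_rank_le_rank_fromBlocks {m n m' n' : Type*} [Fintype m] [Fintype n]
    [Fintype m'] [Fintype n'] [DecidableEq m] [DecidableEq n] [DecidableEq m'] [DecidableEq n']
    (A : Matrix m n K) (B : Matrix m n' K) (D : Matrix m' n' K) :
    A.rank + D.rank ≤ (fromBlocks A B 0 D).rank := by
  obtain ⟨P, Q, h⟩ := exists_mul_mul_eq_one A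
  obtain ⟨R, S, h'⟩ := exists_mul_mul_eq_one D
  have := card_le_rank_of_mul_mul_isUnit (fromBlocks A B 0 D) (fromBlocks P 0 0 R)
    (fromBlocks Q 0 0 S) (by
      rw [Matrix.isUnit_iff_isUnit_det]
      simp [fromBlocks_multiply, h, h'])
  simpa using this

theorem finrank_range_add_le {E E' : Type*} [AddCommGroup E] [AddCommGroup E'] [Module K E]
    [Module K E'] [FiniteDimensional K E'] (f g : E →ₗ[K] E') :
    Module.finrank K (LinearMap.range (f + g)) ≤
      Module.finrank K (LinearMap.range f) + Module.finrank K (LinearMap.range g) := by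
  refine (Submodule.finrank_mono (LinearMap.range_add_le f g)).trans ?_
  exact Submodule.finrank_add_le_finrank_add_finrank _ _

theorem rank_add_le {m n : Type*} [Fintype m] [Fintype n] (A B : Matrix m n K) :
    (A + B).rank ≤ A.rank + B.rank := by
  rw [Matrix.rank, Matrix.mulVecLin_add]
  exact finrank_range_add_le _ _

theorem rank_sum_le {m n ι : Type*} [Fintype m] [Fintype n] (s : Finset ι)
    (A : ι → Matrix m n K) : (∑ i ∈ s, A i).rank ≤ ∑ i ∈ s, (A i).rank := by
  classical
  induction s using Finset.induction_on with
  | empty => simp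
  | insert a s ha ih =>
    rw [Finset.sum_insert ha, Finset.sum_insert ha]
    exact (rank_add_le _ _).trans (by gcongr)

/-- The rank of a matrix that raises a grading by one is the sum of the ranks of its
homogeneous pieces. -/
theorem rank_eq_sum_of_graded {ι : Type*} [Fintype ι] [DecidableEq ι] (g : ι → ℕ) (N : ℕ)
    (hN : ∀ i, g i < N) (M : Matrix ι ι K) (hM : ∀ s t, g t ≠ g s + 1 → M s t = 0) :
    M.rank = ∑ j ∈ Finset.range N,
      (M.submatrix (Subtype.val : {s // g s = j} → ι)
        (Subtype.val : {t // g t = j + 1} → ι)).rank := by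
  set S : ∀ j, Matrix {s // g s = j} {t // g t = j + 1} K := fun j =>
    M.submatrix (Subtype.val : {s // g s = j} → ι) (Subtype.val : {t // g t = j + 1} → ι)
  apply le_antisymm
  -- Upper bound: the matrix is the sum of its homogeneous pieces, each of which factors through the
  -- corresponding block.
  · let A : ℕ → Matrix ι ι K := fun j => of fun s t => if g s = j then M s t else 0
    have hA : M = ∑ j ∈ Finset.range N, A j := by
      ext s t
      simp [A, Matrix.sum_apply, hN]
    conv_lhs => rw [hA]
    refine (rank_sum_le _ _).trans (Finset.sum_le_sum fun j _ => ?_)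
    have : A j = (of fun (s : ι) (a : {s // g s = j}) => if s = a.1 then (1 : K) else 0) * S j *
        (of fun (b : {t // g t = j + 1}) (t : ι) => if b.1 = t then (1 : K) else 0) := by
      ext s t
      simp only [A, S, Matrix.mul_apply, of_apply, submatrix_apply]
      by_cases hs : g s = j
      · by_cases ht : g t = j + 1
        · rw [Finset.sum_eq_single ⟨t, ht⟩, Finset.sum_eq_single ⟨s, hs⟩]
          · simp [hs]
          · intro a _ ha
            rw [if_neg fun h => ha (Subtype.ext h.symm), zero_mul]
          · simp
          · intro b _ hb
            rw [if_neg fun h => hb (Subtype.ext h), mul_zero]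
          · simp
        · rw [hM s t (by omega)]
          rw [Finset.sum_eq_zero]
          · simp
          · rintro ⟨b, hb⟩ _
            rw [if_neg (by rintro rfl; exact ht hb), mul_zero]
      · rw [if_neg hs, Finset.sum_eq_zero]
        rintro ⟨b, hb⟩ _
        rw [Finset.sum_eq_zero, zero_mul]
        rintro ⟨a, ha⟩ _
        rw [if_neg (by rintro rfl; exact hs ha), zero_mul]
    rw [this]
    exact (rank_mul_le_left _ _).trans (rank_mul_le_right _ _)
  -- Lower bound: the certificates of the blocks live in different degrees and glue to a certificate
  -- of the whole matrix.
  · choose P Q h using fun j => exists_mul_mul_eq_one (S j)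
    let k := Σ j : Fin N, Fin (S j).rank
    let P' : Matrix k ι K := of fun x s => if hs : g s = x.1 then P x.1 x.2 ⟨s, hs⟩ else 0
    let Q' : Matrix ι k K := of fun t x => if ht : g t = x.1 + 1 then Q x.1 ⟨t, ht⟩ x.2 else 0
    have hPM : ∀ (x : k) (t : ι) , (P' * M) x t =
        if ht : g t = x.1 + 1 then (P x.1 * S x.1) x.2 ⟨t, ht⟩ else 0 := by
      intro x t
      simp only [P', Matrix.mul_apply, of_apply, S, submatrix_apply]
      split_ifs with ht
      · symm
        refine Finset.sum_bij_ne_zero (fun a _ _ => a.1) (by simp) ?_ ?_ ?_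
        · intro a _ _ b _ _ hab
          exact Subtype.ext hab
        · intro b _ hb
          by_cases hs : g b = x.1
          · rw [dif_pos hs] at hb
            exact ⟨⟨b, hs⟩, Finset.mem_univ _, hb, rfl⟩
          · simp [hs] at hb
        · intro a _ _
          rw [dif_pos a.2]
      · refine Finset.sum_eq_zero fun s _ => ?_
        split_ifs with hs
        · rw [hM s t (by omega), mul_zero]
        · simp
    have hPMQ : P' * M * Q' = 1 := by
      ext x y
      rw [Matrix.mul_apply]
      simp only [hPM]
      by_cases hxy : x.1 = y.1
      · obtain ⟨x1, x2⟩ := x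
        obtain ⟨y1, y2⟩ := y
        obtain rfl : x1 = y1 := hxy
        have h1 := congrFun (congrFun (h x1) x2) y2
        rw [Matrix.mul_apply] at h1
        have : (1 : Matrix k k K) ⟨x1, x2⟩ ⟨x1, y2⟩ =
            (1 : Matrix (Fin (S x1).rank) (Fin (S x1).rank) K) x2 y2 := by
          simp [Matrix.one_apply, Sigma.ext_iff]
        rw [this, ← h1]
        symm
        refine Finset.sum_bij_ne_zero (fun a _ _ => a.1) (by simp) ?_ ?_ ?_
        · intro a _ _ b _ _ hab
          exact Subtype.ext hab
        · intro b _ hb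
          by_cases hs : g b = x1 + 1
          · simp only [Q', of_apply, dif_pos hs] at hb
            exact ⟨⟨b, hs⟩, Finset.mem_univ _, hb, rfl⟩
          · simp [hs] at hb
        · intro a _ _
          simp [Q', a.2]
      · rw [Matrix.one_apply_ne (fun h => hxy (by rw [h]))]
        refine Finset.sum_eq_zero fun t _ => ?_
        simp only [Q', of_apply]
        split_ifs with h1 h2
        · exact absurd (Fin.ext (by omega)) hxy
        · simp
        · simp
        · simp
    have := card_le_rank_of_mul_mul_isUnit M P' Q' (by rw [hPMQ]; exact isUnit_one)
    simpa [k, Fintype.card_sigma, Finset.sum_range] using this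

/-- A square-zero matrix has as many independent cycles, dual to cocycles, as the dimension of its
homology. -/
theorem exists_cycles_cocycles {n : Type*} [Fintype n] [DecidableEq n] (D : Matrix n n K)
    (hD : D * D = 0) : ∃ (P : Matrix n (Fin (Fintype.card n - 2 * D.rank)) K)
      (Q : Matrix (Fin (Fintype.card n - 2 * D.rank)) n K), D * P = 0 ∧ Q * D = 0 ∧ Q * P = 1 := by
  let Z := LinearMap.ker D.mulVecLin
  let B := LinearMap.range D.mulVecLin
  have hBZ : B ≤ Z := by
    rw [LinearMap.range_le_ker_iff, ← Matrix.mulVecLin_mul, hD, Matrix.mulVecLin_zero]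
  have hdim : Module.finrank K B + Module.finrank K Z = Fintype.card n := by
    rw [LinearMap.finrank_range_add_finrank_ker, Module.finrank_fintype_fun_eq_card]
  have hB : Module.finrank K B = D.rank := rfl
  -- the quotient map to `(n → K) ⧸ B` restricted to `Z`
  let f : (Z ⧸ B.submoduleOf Z) →ₗ[K] ((n → K) ⧸ B) :=
    Submodule.mapQ (B.submoduleOf Z) B Z.subtype le_rfl
  have hf : LinearMap.ker f = ⊥ := by
    rw [LinearMap.ker_eq_bot']
    intro x
    induction x using Submodule.Quotient.induction_on with
    | H z =>
      intro hz
      have hz : (Submodule.Quotient.mk (z : n → K) : (n → K) ⧸ B) = 0 := hz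
      rw [Submodule.Quotient.mk_eq_zero] at hz
      rwa [Submodule.Quotient.mk_eq_zero]
  obtain ⟨g, hg⟩ := f.exists_leftInverse_of_injective hf
  have hdimQ : Module.finrank K (Z ⧸ B.submoduleOf Z) = Fintype.card n - 2 * D.rank := by
    have h1 := Submodule.finrank_quotient_add_finrank (B.submoduleOf Z)
    have h2 : Module.finrank K (B.submoduleOf Z) = Module.finrank K B :=
      (Submodule.submoduleOfEquivOfLe hBZ).finrank_eq
    omega
  let b : Module.Basis (Fin (Fintype.card n - 2 * D.rank)) K (Z ⧸ B.submoduleOf Z) :=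
    Module.finBasisOfFinrankEq K _ hdimQ
  obtain ⟨s, hs⟩ := (B.submoduleOf Z).mkQ.exists_rightInverse_of_surjective
    (Submodule.range_mkQ _)
  let p : (Fin (Fintype.card n - 2 * D.rank) → K) →ₗ[K] (n → K) :=
    Z.subtype ∘ₗ s ∘ₗ b.equivFun.symm.toLinearMap
  let q : (n → K) →ₗ[K] (Fin (Fintype.card n - 2 * D.rank) → K) :=
    b.equivFun.toLinearMap ∘ₗ g ∘ₗ B.mkQ
  have h1 : D.mulVecLin ∘ₗ p = 0 := LinearMap.ext fun x => (s (b.equivFun.symm x)).2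
  have h2 : q ∘ₗ D.mulVecLin = 0 := by
    refine LinearMap.ext fun x => ?_
    have : B.mkQ (D.mulVecLin x) = 0 := by
      rw [Submodule.mkQ_apply, Submodule.Quotient.mk_eq_zero]
      exact ⟨x, rfl⟩
    simp only [q, LinearMap.comp_apply, this, map_zero, LinearMap.zero_apply]
  have h3 : q ∘ₗ p = LinearMap.id := by
    refine LinearMap.ext fun x => ?_
    have e1 : B.mkQ (s (b.equivFun.symm x) : n → K) = f (b.equivFun.symm x) := by
      have := LinearMap.congr_fun hs (b.equivFun.symm x)
      simp only [LinearMap.comp_apply, LinearMap.id_apply] at this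
      conv_rhs => rw [← this]
      rfl
    have e2 := LinearMap.congr_fun hg (b.equivFun.symm x)
    simp only [LinearMap.comp_apply, LinearMap.id_apply] at e2
    show b.equivFun (g (B.mkQ (s (b.equivFun.symm x) : n → K))) = x
    rw [e1, e2, LinearEquiv.apply_symm_apply]
  refine ⟨LinearMap.toMatrix' p, LinearMap.toMatrix' q, ?_, ?_, ?_⟩
  · rw [← map_zero LinearMap.toMatrix', ← h1, LinearMap.toMatrix'_comp, toMatrix'_mulVecLin]
  · rw [← map_zero LinearMap.toMatrix', ← h2, LinearMap.toMatrix'_comp, toMatrix'_mulVecLin]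
  · rw [← LinearMap.toMatrix'_comp, h3, LinearMap.toMatrix'_id]

/-- Converse to `exists_cycles_cocycles`: cycles with a dual family of cocycles are independent
modulo the image of `D`. Hence the block matrix `[D P]` has rank at least `rank D + |k|`, while `D *
[D P] = 0` bounds that rank by `|n| - rank D`. -/
theorem card_add_two_mul_rank_le {n k : Type*} [Fintype n] [Fintype k] [DecidableEq n]
    [DecidableEq k] (D : Matrix n n K) (hD : D * D = 0) (P : Matrix n k K) (Q : Matrix k n K)
    (h1 : D * P = 0) (h2 : Q * D = 0) (h3 : Q * P = 1) :
    Fintype.card k + 2 * D.rank ≤ Fintype.card n := by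
  have hA : D * fromCols D P = 0 := by
    rw [mul_fromCols, hD, h1, fromCols_zero]
  have hle := rank_add_rank_le_card_of_mul_eq_zero hA
  obtain ⟨R, S, hRS⟩ := exists_mul_mul_eq_one D
  have : IsUnit (fromRows R Q * fromCols D P * fromBlocks S 0 0 (1 : Matrix k k K)) := by
    rw [fromRows_mul_fromCols, fromBlocks_multiply, h2, h3]
    rw [Matrix.isUnit_iff_isUnit_det]
    simp [hRS]
  have := card_le_rank_of_mul_mul_isUnit _ _ _ this
  simp at this
  omega

end LinearAlgebra

/-! ### The boundary matrix, and deletion and link of a vertex -/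

section BoundaryMatrix

open Matrix

variable {V : Type*} [LinearOrder V] (K : Type*) [Field K] (G : SimpleGraph V)

/-- The coefficient of the face `s` in the boundary of the simplex `t`. -/
def incidence (s t : Finset V) : K :=
  ∑ u ∈ t, if t.erase u = s then (-1) ^ (t.filter (· < u)).card else 0

theorem incidence_eq_zero {s t : Finset V} (h : ∀ u ∈ t, t.erase u ≠ s) :
    incidence K s t = 0 :=
  Finset.sum_eq_zero fun u hu => if_neg (h u hu)

theorem incidence_eq_zero_of_card {s t : Finset V} (h : t.card ≠ s.card + 1) :
    incidence K s t = 0 :=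
  incidence_eq_zero K fun u hu hs => h (by rw [← hs, Finset.card_erase_add_one hu])

theorem incidence_insert_left {v : V} {s t : Finset V} (ht : v ∉ t) :
    incidence K (insert v s) t = 0 :=
  incidence_eq_zero K fun _ _ h => ht
    (Finset.mem_of_mem_erase (h ▸ Finset.mem_insert_self v s))

theorem incidence_insert_right {v : V} {s t : Finset V} (hs : v ∉ s) (ht : v ∉ t) :
    incidence K s (insert v t) = if s = t then (-1) ^ (t.filter (· < v)).card else 0 := by
  rw [incidence, Finset.sum_insert ht, Finset.sum_eq_zero, add_zero, Finset.erase_insert ht]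
  · simp only [eq_comm (a := t), Finset.filter_insert, lt_irrefl, if_false]
  · intro u hu
    refine if_neg fun h => hs ?_
    rw [← h, Finset.mem_erase]
    exact ⟨by rintro rfl; exact ht hu, Finset.mem_insert_self _ _⟩

/-- Adding `v` flips the sign of the face opposite `u` exactly when `v < u`. That sign is the ratio
of `(-1)` to the number of vertices above `v` in the two sets, so it is removed by conjugation with
a diagonal matrix, which does not affect ranks. -/
theorem incidence_insert_insert {v : V} {s t : Finset V} (hs : v ∉ s) (ht : v ∉ t) :
    incidence K (insert v s) (insert v t) =
      (-1) ^ (s.filter (v < ·)).card * incidence K s t * (-1) ^ (t.filter (v < ·)).card := by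
  have hsq : ∀ n : ℕ, (-1 : K) ^ n * (-1) ^ n = 1 := fun n => by
    rw [← mul_pow]; simp
  rw [incidence, Finset.sum_insert ht, Finset.erase_insert ht, if_neg, zero_add, incidence,
    Finset.mul_sum, Finset.sum_mul]
  · refine Finset.sum_congr rfl fun u hu => ?_
    have huv : u ≠ v := by rintro rfl; exact ht hu
    rw [Finset.erase_insert_of_ne huv.symm]
    have hiff : insert v (t.erase u) = insert v s ↔ t.erase u = s := by
      constructor
      · intro h
        have := congrArg (Finset.erase · v) h
        simpa [Finset.erase_insert hs, Finset.erase_insert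
          (fun h => ht (Finset.mem_of_mem_erase h))] using this
      · rintro rfl; rfl
    simp only [hiff]
    split_ifs with h
    · subst h
      rw [Finset.filter_insert]
      split_ifs with hvu
      · have h1 : (t.filter (v < ·)).card = ((t.erase u).filter (v < ·)).card + 1 := by
          rw [Finset.filter_erase, Finset.card_erase_add_one]
          simp [hu, hvu]
        have h2 : v ∉ t.filter (· < u) := fun h => ht (Finset.mem_filter.1 h).1
        rw [Finset.card_insert_of_notMem h2, h1, pow_succ, pow_succ]
        linear_combination (1 : K) * (-1) ^ (t.filter (· < u)).card *
          hsq ((t.erase u).filter (v < ·)).card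
      · have h1 : ((t.erase u).filter (v < ·)) = (t.filter (v < ·)) := by
          rw [Finset.filter_erase, Finset.erase_eq_of_notMem]
          simp [hvu]
        rw [h1]
        linear_combination (-1 : K) * (-1) ^ (t.filter (· < u)).card *
          hsq (t.filter (v < ·)).card
    · simp
  · intro h
    exact ht (h ▸ Finset.mem_insert_self v s)

/-- The cliques of `G` inside `W`. -/
def cliqueSets (W : Finset V) : Finset (Finset V) := by
  classical exact W.powerset.filter fun s => G.IsClique (s : Set V)

variable {G}

theorem mem_cliqueSets {W s : Finset V} :
    s ∈ cliqueSets G W ↔ s ⊆ W ∧ G.IsClique (s : Set V) := by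
  simp [cliqueSets]

variable (G)

/-- The boundary matrix of the clique complex of `G[W]`, in all degrees at once. -/
def boundaryMatrix (W : Finset V) : Matrix (cliqueSets G W) (cliqueSets G W) K :=
  of fun s t => incidence K s.1 t.1

/-- The number of cliques in `W` minus twice the rank of the boundary matrix. This is the total
reduced Betti number of the clique complex of `G[W]`. -/
def bettiSum (W : Finset V) : ℤ :=
  (cliqueSets G W).card - 2 * (boundaryMatrix K G W).rank

theorem notMem_of_mem_cliqueSets_erase {W s : Finset V} {v : V}
    (hs : s ∈ cliqueSets G (W.erase v)) : v ∉ s := fun h => by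
  simpa using (mem_cliqueSets.1 hs).1 h

theorem notMem_of_mem_cliqueSets_adj [DecidableRel G.Adj] {W s : Finset V} {v : V}
    (hs : s ∈ cliqueSets G (W.filter (G.Adj v))) : v ∉ s := fun h => by
  simpa using (mem_cliqueSets.1 hs).1 h

/-- The cliques in `W` are those that avoid `v` and those that contain `v`; the latter correspond
to the cliques in the neighbourhood of `v`. -/
def cliqueSetsEquiv [DecidableRel G.Adj] {W : Finset V} {v : V} (hv : v ∈ W) :
    cliqueSets G (W.erase v) ⊕ cliqueSets G (W.filter (G.Adj v)) ≃ cliqueSets G W :=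
  Equiv.ofBijective
    (Sum.elim
      (fun s => ⟨s.1, mem_cliqueSets.2 ⟨(mem_cliqueSets.1 s.2).1.trans (Finset.erase_subset _ _),
        (mem_cliqueSets.1 s.2).2⟩⟩)
      (fun s => ⟨insert v s.1, mem_cliqueSets.2 (by
        obtain ⟨h1, h2⟩ := mem_cliqueSets.1 s.2
        refine ⟨Finset.insert_subset hv (h1.trans (Finset.filter_subset _ _)), ?_⟩
        rw [Finset.coe_insert]
        exact h2.insert fun b hb _ => (Finset.mem_filter.1 (h1 hb)).2)⟩)) (by
    constructor
    · rintro (s | s) (t | t) h <;> simp only [Sum.elim_inl, Sum.elim_inr, Subtype.mk.injEq] at h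
      · exact congrArg Sum.inl (Subtype.ext h)
      · exact absurd (h ▸ Finset.mem_insert_self v t.1) (notMem_of_mem_cliqueSets_erase G s.2)
      · exact absurd (h ▸ Finset.mem_insert_self v s.1) (notMem_of_mem_cliqueSets_erase G t.2)
      · refine congrArg Sum.inr (Subtype.ext ?_)
        have := congrArg (Finset.erase · v) h
        simpa [Finset.erase_insert (notMem_of_mem_cliqueSets_adj G s.2),
          Finset.erase_insert (notMem_of_mem_cliqueSets_adj G t.2)] using this
    · rintro ⟨t, ht⟩
      obtain ⟨h1, h2⟩ := mem_cliqueSets.1 ht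
      by_cases hvt : v ∈ t
      · refine ⟨Sum.inr ⟨t.erase v, mem_cliqueSets.2 ⟨fun w hw => ?_, ?_⟩⟩, ?_⟩
        · obtain ⟨hwv, hwt⟩ := Finset.mem_erase.1 hw
          exact Finset.mem_filter.2 ⟨h1 hwt, h2 hvt hwt hwv.symm⟩
        · exact h2.subset (by exact_mod_cast Finset.erase_subset v t)
        · simp [Finset.insert_erase hvt]
      · exact ⟨Sum.inl ⟨t, mem_cliqueSets.2 ⟨Finset.subset_erase.2 ⟨h1, hvt⟩, h2⟩⟩, rfl⟩)

/-- The lower left block vanishes because a face avoiding `v` has no boundary face containing `v`.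
The diagonal blocks are the deletion of `v` and, up to signs, the link of `v`. -/
theorem boundaryMatrix_submatrix [DecidableRel G.Adj] {W : Finset V} {v : V} (hv : v ∈ W) :
    (boundaryMatrix K G W).submatrix (cliqueSetsEquiv G hv) (cliqueSetsEquiv G hv) =
      fromBlocks (boundaryMatrix K G (W.erase v))
        (of fun s t => if s.1 = t.1 then (-1) ^ (t.1.filter (· < v)).card else 0) 0
        (diagonal (fun s => (-1) ^ (s.1.filter (v < ·)).card) *
          boundaryMatrix K G (W.filter (G.Adj v)) *
          diagonal (fun s => (-1) ^ (s.1.filter (v < ·)).card)) := by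
  ext (s | s) (t | t)
  · rfl
  · exact incidence_insert_right K (notMem_of_mem_cliqueSets_erase G s.2)
      (notMem_of_mem_cliqueSets_adj G t.2)
  · exact incidence_insert_left K (notMem_of_mem_cliqueSets_erase G t.2)
  · rw [fromBlocks_apply₂₂, Matrix.mul_diagonal, Matrix.diagonal_mul]
    exact incidence_insert_insert K (notMem_of_mem_cliqueSets_adj G s.2)
      (notMem_of_mem_cliqueSets_adj G t.2)

/-- The numbers of cliques of deletion and link add up, while the rank of a block triangular matrix
is at least the sum of the ranks of the diagonal blocks. This replaces the long exact sequence of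
the pair. -/
theorem bettiSum_le_add [DecidableRel G.Adj] {W : Finset V} {v : V} (hv : v ∈ W) :
    bettiSum K G W ≤ bettiSum K G (W.erase v) + bettiSum K G (W.filter (G.Adj v)) := by
  have hc := Fintype.card_congr (cliqueSetsEquiv G hv)
  rw [Fintype.card_sum] at hc
  simp only [Fintype.card_coe] at hc
  have hr := rank_submatrix (boundaryMatrix K G W) (cliqueSetsEquiv G hv) (cliqueSetsEquiv G hv)
  rw [boundaryMatrix_submatrix] at hr
  have hb := rank_add_rank_le_rank_fromBlocks (boundaryMatrix K G (W.erase v))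
    (of fun (s : cliqueSets G (W.erase v)) (t : cliqueSets G (W.filter (G.Adj v))) =>
      if s.1 = t.1 then (-1 : K) ^ (t.1.filter (· < v)).card else 0)
    (diagonal (fun s => (-1) ^ (s.1.filter (v < ·)).card) *
          boundaryMatrix K G (W.filter (G.Adj v)) *
          diagonal (fun s => (-1) ^ (s.1.filter (v < ·)).card))
  rw [hr] at hb
  have hu : IsUnit (diagonal (fun s : cliqueSets G (W.filter (G.Adj v)) =>
      (-1 : K) ^ (s.1.filter (v < ·)).card)).det := by
    rw [det_diagonal, isUnit_iff_ne_zero]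
    exact Finset.prod_ne_zero_iff.2 fun s _ => pow_ne_zero _ (by simp)
  rw [rank_mul_eq_left_of_isUnit_det _ _ hu, rank_mul_eq_right_of_isUnit_det _ _ hu] at hb
  simp only [bettiSum]
  omega

/-- For a cone, deletion and link of the apex coincide, and the off-diagonal block is a diagonal
matrix of signs. So the rank is at least half of the number of cliques. -/
theorem bettiSum_nonpos_of_cone {W : Finset V} {v : V} (hv : v ∈ W)
    (h : ∀ w ∈ W, w ≠ v → G.Adj v w) : bettiSum K G W ≤ 0 := by
  classical
  have hW : W.filter (G.Adj v) = W.erase v := by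
    ext w
    simp only [Finset.mem_filter, Finset.mem_erase]
    exact ⟨fun hw => ⟨hw.2.ne', hw.1⟩, fun hw => ⟨hw.2, h w hw.2 hw.1⟩⟩
  have hc := Fintype.card_congr (cliqueSetsEquiv G hv)
  rw [Fintype.card_sum] at hc
  simp only [Fintype.card_coe] at hc
  have hr := rank_submatrix (boundaryMatrix K G W) (cliqueSetsEquiv G hv) (cliqueSetsEquiv G hv)
  rw [boundaryMatrix_submatrix] at hr
  have he : ∀ s, s ∈ cliqueSets G (W.erase v) ↔ s ∈ cliqueSets G (W.filter (G.Adj v)) := by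
    rw [hW]; simp
  let e : cliqueSets G (W.erase v) ≃ cliqueSets G (W.filter (G.Adj v)) :=
    Equiv.subtypeEquivRight he
  have hs := rank_submatrix_le (fromBlocks (boundaryMatrix K G (W.erase v))
        (of fun s t => if s.1 = t.1 then (-1) ^ (t.1.filter (· < v)).card else 0) 0
        (diagonal (fun s => (-1) ^ (s.1.filter (v < ·)).card) *
          boundaryMatrix K G (W.filter (G.Adj v)) *
          diagonal (fun s => (-1) ^ (s.1.filter (v < ·)).card))) Sum.inl (Sum.inr ∘ e)
  rw [hr] at hs
  have hd : (fromBlocks (boundaryMatrix K G (W.erase v))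
        (of fun s t => if s.1 = t.1 then (-1) ^ (t.1.filter (· < v)).card else 0) 0
        (diagonal (fun s => (-1) ^ (s.1.filter (v < ·)).card) *
          boundaryMatrix K G (W.filter (G.Adj v)) *
          diagonal (fun s => (-1) ^ (s.1.filter (v < ·)).card))).submatrix Sum.inl (Sum.inr ∘ e) =
      diagonal fun s : cliqueSets G (W.erase v) => (-1 : K) ^ (s.1.filter (· < v)).card := by
    ext s t
    simp only [submatrix_apply, Function.comp_apply, fromBlocks_apply₁₂, of_apply,
      diagonal_apply, e, Equiv.subtypeEquivRight_apply_coe, Subtype.ext_iff]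
    split_ifs with h
    · rw [h]
    · rfl
  rw [hd, rank_of_det_ne_zero] at hs
  · have h2 : (cliqueSets G (W.filter (G.Adj v))).card = (cliqueSets G (W.erase v)).card := by
      rw [hW]
    simp only [Fintype.card_coe] at hs
    simp only [bettiSum]
    omega
  · rw [det_diagonal]
    exact Finset.prod_ne_zero_iff.2 fun s _ => pow_ne_zero _ (by simp)

theorem bettiSum_empty_le : bettiSum K G ∅ ≤ 1 := by
  have : (cliqueSets G ∅).card ≤ 1 := by
    refine Finset.card_le_one.2 fun s hs t ht => ?_
    rw [Finset.subset_empty.1 (mem_cliqueSets.1 hs).1, Finset.subset_empty.1 (mem_cliqueSets.1 ht).1]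
  simp only [bettiSum]
  omega

end BoundaryMatrix

/-! ### Total Betti number, boundary matrix and Euler characteristic -/

section TotalBetti

open Matrix

variable {V : Type*} [LinearOrder V] [Fintype V] (K : Type*) [Field K] (G : SimpleGraph V)

theorem boundary_apply (j : ℕ) (x : Chain K G (j + 1)) (s : Face G j) :
    boundary K G j x s = ∑ t : Face G (j + 1), incidence K s.1 t.1 * x t := by
  rw [boundary, Fintype.linearCombination_apply, Finset.sum_apply]
  refine Finset.sum_congr rfl fun t _ => ?_
  rw [Pi.smul_apply, Finset.sum_apply, smul_eq_mul, mul_comm, incidence,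
    ← Finset.sum_coe_sort t.1]
  congr 1
  refine Finset.sum_congr rfl fun u _ => ?_
  simp only [Pi.single_apply, Subtype.ext_iff, Face.delete, eq_comm (a := s.1)]

theorem finrank_boundaries (j : ℕ) :
    Module.finrank K (boundaries K G j) =
      (of fun (s : Face G j) (t : Face G (j + 1)) => incidence K s.1 t.1).rank := by
  have : boundary K G j =
      (of fun (s : Face G j) (t : Face G (j + 1)) => incidence K s.1 t.1).mulVecLin := by
    refine LinearMap.ext fun x => funext fun s => ?_
    rw [boundary_apply]
    rfl
  rw [boundaries, this]
  rfl

theorem boundaries_le_cycles (j : ℕ) : boundaries K G j ≤ cycles K G j := by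
  cases j with
  | zero => exact le_top
  | succ j =>
    rintro _ ⟨x, rfl⟩
    exact boundary_boundary K G j x

theorem finrank_reducedHomology_add (j : ℕ) :
    Module.finrank K (ReducedHomology K G j) + Module.finrank K (boundaries K G j) =
      Module.finrank K (cycles K G j) := by
  have h1 := Submodule.finrank_quotient_add_finrank ((boundaries K G j).submoduleOf (cycles K G j))
  rwa [(Submodule.submoduleOfEquivOfLe (boundaries_le_cycles K G j)).finrank_eq] at h1

theorem finrank_cycles_zero : Module.finrank K (cycles K G 0) = Fintype.card (Face G 0) := by
  rw [cycles, finrank_top, Module.finrank_fintype_fun_eq_card]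

theorem finrank_cycles_succ (j : ℕ) : Module.finrank K (cycles K G (j + 1)) +
    Module.finrank K (boundaries K G j) = Fintype.card (Face G (j + 1)) := by
  rw [cycles, boundaries, add_comm, LinearMap.finrank_range_add_finrank_ker,
    Module.finrank_fintype_fun_eq_card]

theorem isEmpty_face {V : Type*} [Fintype V] (G : SimpleGraph V) {j : ℕ} (hj : Fintype.card V < j) : IsEmpty (Face G j) :=
  ⟨fun s => by
    have := Finset.card_le_univ s.1
    rw [s.2.card_eq] at this
    omega⟩

theorem finrank_boundaries_eq_zero {j : ℕ} (hj : Fintype.card V ≤ j) :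
    Module.finrank K (boundaries K G j) = 0 := by
  have := isEmpty_face G (Nat.lt_succ_of_le hj)
  rw [finrank_boundaries]
  have h := rank_le_card_width
    (of fun (s : Face G j) (t : Face G (j + 1)) => incidence K s.1 t.1)
  simpa using h

/-- Each Betti number is the number of faces minus the ranks of the boundary maps out of and into
that degree. In the truncated sum every rank is subtracted twice except the last one, which is
subtracted once; this explains the correction term. -/
theorem sum_finrank_reducedHomology (n : ℕ) :
    ∑ j ∈ Finset.range (n + 1), (Module.finrank K (ReducedHomology K G j) : ℤ) =
      ∑ j ∈ Finset.range (n + 1), (Fintype.card (Face G j) : ℤ) -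
        2 * ∑ j ∈ Finset.range (n + 1), (Module.finrank K (boundaries K G j) : ℤ) +
        Module.finrank K (boundaries K G n) := by
  induction n with
  | zero =>
    have h1 := finrank_reducedHomology_add K G 0
    rw [finrank_cycles_zero] at h1
    simp
    omega
  | succ n ih =>
    have h1 := finrank_reducedHomology_add K G (n + 1)
    have h2 := finrank_cycles_succ K G n
    rw [Finset.sum_range_succ, ih, Finset.sum_range_succ _ (n + 1),
      Finset.sum_range_succ _ (n + 1)]
    omega

/-- The Euler–Poincaré formula for a truncated complex: with alternating signs all ranks cancel
except the last. -/
theorem alternating_sum_finrank_reducedHomology (n : ℕ) :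
    ∑ j ∈ Finset.range (n + 1), (-1) ^ j * (Module.finrank K (ReducedHomology K G j) : ℤ) =
      ∑ j ∈ Finset.range (n + 1), (-1) ^ j * (Fintype.card (Face G j) : ℤ) -
        (-1) ^ n * Module.finrank K (boundaries K G n) := by
  induction n with
  | zero =>
    have h1 := finrank_reducedHomology_add K G 0
    rw [finrank_cycles_zero] at h1
    simp
    omega
  | succ n ih =>
    have h1 := finrank_reducedHomology_add K G (n + 1)
    have h2 := finrank_cycles_succ K G n
    rw [Finset.sum_range_succ, ih, Finset.sum_range_succ _ (n + 1)]
    zify at h1 h2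
    rw [pow_succ]
    linear_combination (-1 : ℤ) ^ n * (-1) * (h1 + h2)

def cliqueSetsCardEquiv (j : ℕ) :
    {s : cliqueSets G Finset.univ // s.1.card = j} ≃ Face G j where
  toFun s := ⟨s.1.1, (mem_cliqueSets.1 s.1.2).2, s.2⟩
  invFun s := ⟨⟨s.1, mem_cliqueSets.2 ⟨Finset.subset_univ _, s.2.1⟩⟩, s.2.2⟩
  left_inv _ := rfl
  right_inv _ := rfl

theorem card_cliqueSets_univ : (cliqueSets G Finset.univ).card =
    ∑ j ∈ Finset.range (Fintype.card V + 1), Fintype.card (Face G j) := by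
  rw [Finset.card_eq_sum_card_fiberwise (f := Finset.card)
    (t := Finset.range (Fintype.card V + 1))]
  · refine Finset.sum_congr rfl fun j _ => ?_
    rw [← Fintype.card_congr (cliqueSetsCardEquiv G j), Fintype.card_subtype]
    refine Finset.card_bij' (fun s hs => ⟨s, (Finset.mem_filter.1 hs).1⟩) (fun s _ => s.1)
      ?_ ?_ ?_ ?_
    · intro s hs
      simpa using (Finset.mem_filter.1 hs).2
    · intro s hs
      exact Finset.mem_filter.2 ⟨s.2, by simpa using hs⟩
    · intros; rfl
    · intros; rfl
  · intro s _
    simpa [Nat.lt_succ_iff] using Finset.card_le_univ s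

theorem rank_boundaryMatrix_univ : (boundaryMatrix K G Finset.univ).rank =
    ∑ j ∈ Finset.range (Fintype.card V + 1), Module.finrank K (boundaries K G j) := by
  rw [rank_eq_sum_of_graded (fun s : cliqueSets G Finset.univ => s.1.card) (Fintype.card V + 1)]
  · refine Finset.sum_congr rfl fun j _ => ?_
    rw [finrank_boundaries, ← rank_submatrix _ (cliqueSetsCardEquiv G j)
      (cliqueSetsCardEquiv G (j + 1))]
    rfl
  · intro s
    simpa [Nat.lt_succ_iff] using Finset.card_le_univ s.1
  · intro s t h
    exact incidence_eq_zero_of_card K h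

/-- The boundary matrix in all degrees at once is graded, so its rank is the sum of the ranks in the
single degrees, and the correction term of the truncated sum vanishes at the top degree. -/
theorem totalBetti_eq_bettiSum : (totalBetti K G : ℤ) = bettiSum K G Finset.univ := by
  rw [totalBetti, bettiSum, card_cliqueSets_univ, rank_boundaryMatrix_univ]
  push_cast
  rw [sum_finrank_reducedHomology, finrank_boundaries_eq_zero K G le_rfl]
  simp

/-- The Euler characteristic bounds the total Betti number from below. -/
theorem abs_euler_le_totalBetti :
    |∑ s ∈ cliqueSets G Finset.univ, (-1 : ℤ) ^ s.card| ≤ totalBetti K G := by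
  have h := alternating_sum_finrank_reducedHomology K G (Fintype.card V)
  rw [finrank_boundaries_eq_zero K G le_rfl] at h
  have h2 : ∑ s ∈ cliqueSets G Finset.univ, (-1 : ℤ) ^ s.card =
      ∑ j ∈ Finset.range (Fintype.card V + 1), (-1) ^ j * (Fintype.card (Face G j) : ℤ) := by
    rw [← Finset.sum_fiberwise_of_maps_to (g := Finset.card)
      (t := Finset.range (Fintype.card V + 1))]
    · refine Finset.sum_congr rfl fun j _ => ?_
      rw [Finset.sum_congr rfl (g := fun _ => (-1 : ℤ) ^ j), Finset.sum_const, nsmul_eq_mul,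
        mul_comm]
      · congr 2
        rw [← Fintype.card_congr (cliqueSetsCardEquiv G j), Fintype.card_subtype]
        refine Finset.card_bij' (fun s hs => ⟨s, (Finset.mem_filter.1 hs).1⟩) (fun s _ => s.1)
          ?_ ?_ ?_ ?_
        · intro s hs
          simpa using (Finset.mem_filter.1 hs).2
        · intro s hs
          exact Finset.mem_filter.2 ⟨s.2, by simpa using hs⟩
        · intros; rfl
        · intros; rfl
      · intro s hs
        rw [(Finset.mem_filter.1 hs).2]
    · intro s _
      simpa [Nat.lt_succ_iff] using Finset.card_le_univ s
  rw [h2]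
  simp only [Nat.cast_zero, mul_zero, sub_zero] at h
  rw [← h, totalBetti]
  push_cast
  refine (Finset.abs_sum_le_sum_abs _ _).trans (Finset.sum_le_sum fun j _ => ?_)
  simp [abs_mul]

theorem boundaryMatrix_mul_self :
    boundaryMatrix K G Finset.univ * boundaryMatrix K G Finset.univ = 0 := by
  ext s t
  rw [Matrix.mul_apply, Matrix.zero_apply]
  by_cases hc : t.1.card = s.1.card + 2
  · let s' : Face G s.1.card := cliqueSetsCardEquiv G _ ⟨s, rfl⟩
    let t' : Face G (s.1.card + 2) := cliqueSetsCardEquiv G _ ⟨t, hc⟩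
    have h := congrFun (boundary_boundary K G s.1.card (Pi.single t' 1)) s'
    rw [boundary_apply] at h
    simp only [boundary_apply, Pi.single_apply, mul_ite, mul_one, mul_zero,
      Finset.sum_ite_eq', Finset.mem_univ, if_true, Pi.zero_apply] at h
    rw [← h]
    symm
    refine Finset.sum_bij_ne_zero (fun r _ _ => ((cliqueSetsCardEquiv G _).symm r).1)
      (by simp) ?_ ?_ ?_
    · intro a _ _ b _ _ hab
      exact (cliqueSetsCardEquiv G _).symm.injective (Subtype.ext hab)
    · intro r _ hr
      have hcr : r.1.card = s.1.card + 1 := by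
        by_contra hne
        exact hr (by
          show incidence K s.1 r.1 * _ = 0
          rw [incidence_eq_zero_of_card K hne, zero_mul])
      exact ⟨cliqueSetsCardEquiv G _ ⟨r, hcr⟩, Finset.mem_univ _, hr, rfl⟩
    · intros; rfl
  · refine Finset.sum_eq_zero fun r _ => ?_
    show incidence K s.1 r.1 * incidence K r.1 t.1 = 0
    by_cases hr : r.1.card = s.1.card + 1
    · rw [incidence_eq_zero_of_card K (s := r.1) (t := t.1) (by omega), mul_zero]
    · rw [incidence_eq_zero_of_card K hr, zero_mul]

end TotalBetti

/-! ### Joins and supermultiplicativity -/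

section Join

open Matrix Kronecker

variable {V₁ V₂ V : Type*} [LinearOrder V₁] [LinearOrder V₂] [LinearOrder V]
  (f : V₁ ↪o V) (g : V₂ ↪o V) (K : Type*) [Field K]

/-- The union of the images of two finite sets. -/
def joinSet (s : Finset V₁) (t : Finset V₂) : Finset V :=
  s.map f.toEmbedding ∪ t.map g.toEmbedding

variable {f g}

theorem apply_left_mem_joinSet (hfg : ∀ x y, f x < g y) {s : Finset V₁} {t : Finset V₂} {x : V₁} :
    f x ∈ joinSet f g s t ↔ x ∈ s := by
  simp only [joinSet, Finset.mem_union, Finset.mem_map, RelEmbedding.coe_toEmbedding,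
    EmbeddingLike.apply_eq_iff_eq, exists_eq_right, or_iff_left_iff_imp]
  rintro ⟨y, _, hy⟩
  exact absurd hy (hfg x y).ne'

theorem apply_right_mem_joinSet (hfg : ∀ x y, f x < g y) {s : Finset V₁} {t : Finset V₂}
    {y : V₂} : g y ∈ joinSet f g s t ↔ y ∈ t := by
  simp only [joinSet, Finset.mem_union, Finset.mem_map, RelEmbedding.coe_toEmbedding,
    EmbeddingLike.apply_eq_iff_eq, exists_eq_right, or_iff_right_iff_imp]
  rintro ⟨x, _, hx⟩
  exact absurd hx (hfg x y).ne

theorem joinSet_inj (hfg : ∀ x y, f x < g y) {s s' : Finset V₁} {t t' : Finset V₂} :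
    joinSet f g s t = joinSet f g s' t' ↔ s = s' ∧ t = t' := by
  refine ⟨fun h => ⟨?_, ?_⟩, by rintro ⟨rfl, rfl⟩; rfl⟩
  · ext x
    rw [← apply_left_mem_joinSet hfg (t := t), h, apply_left_mem_joinSet hfg]
  · ext x
    rw [← apply_right_mem_joinSet hfg (s := s), h, apply_right_mem_joinSet hfg]

theorem disjoint_map_map (hfg : ∀ x y, f x < g y) (s : Finset V₁) (t : Finset V₂) :
    Disjoint (s.map f.toEmbedding) (t.map g.toEmbedding) := by
  rw [Finset.disjoint_left]
  simp only [Finset.mem_map, RelEmbedding.coe_toEmbedding]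
  rintro _ ⟨x, _, rfl⟩ ⟨y, _, hy⟩
  exact absurd hy (hfg x y).ne'

theorem joinSet_erase_left (hfg : ∀ x y, f x < g y) (s : Finset V₁) (t : Finset V₂) (x : V₁) :
    (joinSet f g s t).erase (f x) = joinSet f g (s.erase x) t := by
  have : f x ∉ t.map g.toEmbedding := by
    simp only [Finset.mem_map, RelEmbedding.coe_toEmbedding, not_exists, not_and]
    intro y _ hy
    exact absurd hy (hfg x y).ne'
  rw [joinSet, joinSet, Finset.erase_union_distrib, Finset.erase_eq_of_notMem this]
  congr 1
  exact (Finset.map_erase f.toEmbedding s x).symm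

theorem joinSet_erase_right (hfg : ∀ x y, f x < g y) (s : Finset V₁) (t : Finset V₂) (y : V₂) :
    (joinSet f g s t).erase (g y) = joinSet f g s (t.erase y) := by
  have : g y ∉ s.map f.toEmbedding := by
    simp only [Finset.mem_map, RelEmbedding.coe_toEmbedding, not_exists, not_and]
    intro x _ hx
    exact absurd hx (hfg x y).ne
  rw [joinSet, joinSet, Finset.erase_union_distrib, Finset.erase_eq_of_notMem this]
  congr 1
  exact (Finset.map_erase g.toEmbedding t y).symm

theorem card_filter_joinSet_left (hfg : ∀ x y, f x < g y) (s : Finset V₁) (t : Finset V₂)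
    (x : V₁) : ((joinSet f g s t).filter (· < f x)).card = (s.filter (· < x)).card := by
  rw [joinSet, Finset.filter_union, Finset.filter_false_of_mem (s := t.map _),
    Finset.union_empty, Finset.filter_map, Finset.card_map]
  · congr 1
    ext
    simp
  · simp only [Finset.mem_map, RelEmbedding.coe_toEmbedding]
    rintro _ ⟨y, _, rfl⟩
    exact (hfg x y).not_gt

theorem card_filter_joinSet_right (hfg : ∀ x y, f x < g y) (s : Finset V₁) (t : Finset V₂)
    (y : V₂) : ((joinSet f g s t).filter (· < g y)).card =
      s.card + (t.filter (· < y)).card := by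
  rw [joinSet, Finset.filter_union, Finset.filter_true_of_mem (s := s.map _),
    Finset.filter_map, Finset.card_union_of_disjoint (disjoint_map_map hfg _ _), Finset.card_map,
    Finset.card_map]
  · congr 2
    ext
    simp
  · simp only [Finset.mem_map, RelEmbedding.coe_toEmbedding]
    rintro _ ⟨x, _, rfl⟩
    exact hfg x y

/-- The Leibniz rule. All vertices of `V₁` precede those of `V₂`, so deleting a vertex of the second
factor picks up the extra sign `(-1) ^ s.card`. -/
theorem incidence_joinSet (hfg : ∀ x y, f x < g y) (s s' : Finset V₁) (t t' : Finset V₂) :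
    incidence K (joinSet f g s t) (joinSet f g s' t') =
      incidence K s s' * (if t = t' then 1 else 0) +
        (if s = s' then (-1) ^ s.card else 0) * incidence K t t' := by
  rw [incidence]
  conv_lhs => rw [joinSet]
  rw [Finset.sum_union (disjoint_map_map hfg _ _), Finset.sum_map, Finset.sum_map]
  simp only [RelEmbedding.coe_toEmbedding]
  rw [← joinSet]
  simp only [joinSet_erase_left hfg, joinSet_erase_right hfg, joinSet_inj hfg,
    card_filter_joinSet_left hfg, card_filter_joinSet_right hfg]
  congr 1
  · rw [incidence, Finset.sum_mul]
    refine Finset.sum_congr rfl fun u _ => ?_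
    by_cases h : t = t' <;> by_cases h' : s'.erase u = s <;>
      simp [h, h', eq_comm (a := t')]
  · rw [incidence, Finset.mul_sum]
    refine Finset.sum_congr rfl fun u _ => ?_
    by_cases h : s = s'
    · subst h
      by_cases h' : t'.erase u = t <;> simp [h', pow_add]
    · simp [h, Ne.symm h]

variable [Fintype V₁] [Fintype V₂] [Fintype V] {G : SimpleGraph V}

/-- The cliques of a join are the unions of the cliques of the two factors. -/
def joinCliqueSetsEquiv (hfg : ∀ x y, f x < g y)
    (hsurj : ∀ z, (∃ x, f x = z) ∨ ∃ y, g y = z) (hadj : ∀ x y, G.Adj (f x) (g y)) :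
    cliqueSets (G.comap f) Finset.univ × cliqueSets (G.comap g) Finset.univ ≃
      cliqueSets G Finset.univ :=
  Equiv.ofBijective
    (fun p => ⟨joinSet f g p.1.1 p.2.1, mem_cliqueSets.2 ⟨Finset.subset_univ _, by
      have h1 := (mem_cliqueSets.1 p.1.2).2
      have h2 := (mem_cliqueSets.1 p.2.2).2
      intro z hz w hw hzw
      rw [Finset.mem_coe] at hz hw
      obtain ⟨x, rfl⟩ | ⟨x, rfl⟩ := hsurj z <;> obtain ⟨y, rfl⟩ | ⟨y, rfl⟩ := hsurj w
      · rw [apply_left_mem_joinSet hfg] at hz hw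
        exact h1 hz hw (by rintro rfl; exact hzw rfl)
      · exact hadj x y
      · exact (hadj y x).symm
      · rw [apply_right_mem_joinSet hfg] at hz hw
        exact h2 hz hw (by rintro rfl; exact hzw rfl)⟩⟩) (by
    constructor
    · rintro ⟨⟨s, hs⟩, ⟨t, ht⟩⟩ ⟨⟨s', hs'⟩, ⟨t', ht'⟩⟩ h
      obtain ⟨rfl, rfl⟩ := (joinSet_inj hfg).1 (Subtype.ext_iff.1 h)
      rfl
    · rintro ⟨r, hr⟩
      have hr' := (mem_cliqueSets.1 hr).2
      refine ⟨⟨⟨Finset.univ.filter (f · ∈ r), mem_cliqueSets.2 ⟨Finset.subset_univ _, ?_⟩⟩,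
        ⟨Finset.univ.filter (g · ∈ r), mem_cliqueSets.2 ⟨Finset.subset_univ _, ?_⟩⟩⟩, ?_⟩
      · intro x hx y hy hxy
        simp only [Finset.coe_filter, Finset.mem_univ, true_and, Set.mem_ofPred_eq] at hx hy
        exact hr' hx hy (by simpa using hxy)
      · intro x hx y hy hxy
        simp only [Finset.coe_filter, Finset.mem_univ, true_and, Set.mem_ofPred_eq] at hx hy
        exact hr' hx hy (by simpa using hxy)
      · refine Subtype.ext (Finset.ext fun z => ?_)
        obtain ⟨x, rfl⟩ | ⟨x, rfl⟩ := hsurj z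
        · simp only [apply_left_mem_joinSet hfg]
          simp
        · simp only [apply_right_mem_joinSet hfg]
          simp)

/-- The boundary matrix of a join is that of a tensor product of complexes, `D₁ ⊗ 1 + ε ⊗ D₂` with
`ε` the sign of the degree. -/
theorem boundaryMatrix_join (hfg : ∀ x y, f x < g y)
    (hsurj : ∀ z, (∃ x, f x = z) ∨ ∃ y, g y = z) (hadj : ∀ x y, G.Adj (f x) (g y)) :
    (boundaryMatrix K G Finset.univ).submatrix (joinCliqueSetsEquiv hfg hsurj hadj)
        (joinCliqueSetsEquiv hfg hsurj hadj) =
      boundaryMatrix K (G.comap f) Finset.univ ⊗ₖ 1 +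
        diagonal (fun s : cliqueSets (G.comap f) Finset.univ => (-1 : K) ^ s.1.card) ⊗ₖ
          boundaryMatrix K (G.comap g) Finset.univ := by
  ext ⟨s, t⟩ ⟨s', t'⟩
  refine (incidence_joinSet K hfg s.1 s'.1 t.1 t'.1).trans ?_
  simp only [Matrix.add_apply, kronecker_apply, Matrix.one_apply, diagonal_apply,
    Subtype.ext_iff]
  rfl

/-- The total Betti number is supermultiplicative under joins. -/
theorem totalBetti_mul_le (hfg : ∀ x y, f x < g y)
    (hsurj : ∀ z, (∃ x, f x = z) ∨ ∃ y, g y = z) (hadj : ∀ x y, G.Adj (f x) (g y)) :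
    totalBetti K (G.comap f) * totalBetti K (G.comap g) ≤ totalBetti K G := by
  set D₁ := boundaryMatrix K (G.comap f) Finset.univ with hD₁
  set D₂ := boundaryMatrix K (G.comap g) Finset.univ with hD₂
  obtain ⟨P₁, Q₁, h1, h2, h3⟩ := exists_cycles_cocycles D₁ (boundaryMatrix_mul_self K _)
  obtain ⟨P₂, Q₂, h1', h2', h3'⟩ := exists_cycles_cocycles D₂ (boundaryMatrix_mul_self K _)
  have hb := boundaryMatrix_join K hfg hsurj hadj
  set e := joinCliqueSetsEquiv hfg hsurj hadj
  have hsq : (boundaryMatrix K G Finset.univ).submatrix e e *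
      (boundaryMatrix K G Finset.univ).submatrix e e = 0 := by
    rw [submatrix_mul_equiv, boundaryMatrix_mul_self]
    rfl
  -- Tensor products of cycles are cycles and those of cocycles are cocycles, since each summand of
  -- the boundary kills one factor; the duality is preserved. This is the easy inequality in the
  -- Künneth formula.
  have hle := card_add_two_mul_rank_le _ hsq (P₁ ⊗ₖ P₂) (Q₁ ⊗ₖ Q₂) (by
      rw [hb, Matrix.add_mul, ← mul_kronecker_mul, ← mul_kronecker_mul, h1, h1']
      simp) (by
      rw [hb, Matrix.mul_add, ← mul_kronecker_mul, ← mul_kronecker_mul, h2, h2']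
      simp) (by
      rw [← mul_kronecker_mul, h3, h3', one_kronecker_one])
  rw [rank_submatrix, Fintype.card_congr e] at hle
  simp only [Fintype.card_prod, Fintype.card_fin, Fintype.card_coe] at hle
  have t1 := totalBetti_eq_bettiSum K (G.comap f)
  have t2 := totalBetti_eq_bettiSum K (G.comap g)
  have t := totalBetti_eq_bettiSum K G
  rw [bettiSum] at t1 t2 t
  rw [← hD₁] at t1
  rw [← hD₂] at t2
  have e1 : totalBetti K (G.comap f) =
      (cliqueSets (G.comap f) Finset.univ).card - 2 * D₁.rank := by omega
  have e2 : totalBetti K (G.comap g) =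
      (cliqueSets (G.comap g) Finset.univ).card - 2 * D₂.rank := by omega
  rw [e1, e2]
  zify
  rw [t]
  zify at hle
  linarith

end Join

/-! ### Branching inequalities; all graphs, and graphs without five-cliques -/

section Branching

variable {V : Type*} [DecidableEq V] (F : SimpleGraph V) [DecidableRel F.Adj]

/-- The neighbours of `v` inside `W`. -/
def nbrs (W : Finset V) (v : V) : Finset V := W.filter (F.Adj v)

/-- The vertices of `W` outside the closed neighbourhood of `v`. -/
def rest (W : Finset V) (v : V) : Finset V := W.filter fun w => w ≠ v ∧ ¬ F.Adj v w

/-- The inequalities satisfied by the total Betti numbers of the independence complexes of the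
induced subgraphs of `F`. -/
structure Branching (b : Finset V → ℝ) : Prop where
  empty_le : b ∅ ≤ 1
  branch : ∀ W, ∀ v ∈ W, b W ≤ b (W.erase v) + b (rest F W v)
  isolated : ∀ W, ∀ v ∈ W, (∀ w ∈ W, ¬ F.Adj v w) → b W ≤ 0

variable {F}

@[simp] theorem mem_nbrs {W : Finset V} {v w : V} : w ∈ nbrs F W v ↔ w ∈ W ∧ F.Adj v w :=
  Finset.mem_filter

@[simp] theorem mem_rest {W : Finset V} {v w : V} :
    w ∈ rest F W v ↔ w ∈ W ∧ w ≠ v ∧ ¬ F.Adj v w :=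
  Finset.mem_filter

theorem rest_subset (W : Finset V) (v : V) : rest F W v ⊆ W := Finset.filter_subset _ _

theorem nbrs_subset (W : Finset V) (v : V) : nbrs F W v ⊆ W := Finset.filter_subset _ _

theorem card_rest {W : Finset V} {v : V} (hv : v ∈ W) :
    (rest F W v).card + (nbrs F W v).card + 1 = W.card := by
  have h : W = insert v (rest F W v ∪ nbrs F W v) := by
    ext w
    simp only [Finset.mem_insert, Finset.mem_union, mem_rest, mem_nbrs]
    refine ⟨fun hw => ?_, ?_⟩
    · by_cases h1 : w = v <;> by_cases h2 : F.Adj v w <;> simp [*]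
    · rintro (rfl | h | h)
      · exact hv
      · exact h.1
      · exact h.1
  have hd : Disjoint (rest F W v) (nbrs F W v) := by
    rw [Finset.disjoint_left]
    simp only [mem_rest, mem_nbrs]
    exact fun a h h' => h.2.2 h'.2
  have hn : v ∉ rest F W v ∪ nbrs F W v := by simp
  conv_rhs => rw [h]
  rw [Finset.card_insert_of_notMem hn, Finset.card_union_of_disjoint hd]

theorem rest_sdiff (W S : Finset V) (v : V) : rest F (W \ S) v = rest F W v \ S := by
  ext w
  simp only [mem_rest, Finset.mem_sdiff]
  tauto

/-- If the vertices of `R` lie in `S` and outside the closed neighbourhood of `v`, then they are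
counted in addition to the closed neighbourhood. -/
theorem card_rest_sdiff_add_le {W S R : Finset V} {v : V} (hv : v ∈ W) (hR : R ⊆ S)
    (hRW : R ⊆ rest F W v) :
    (rest F W v \ S).card + ((nbrs F W v).card + 1 + R.card) ≤ W.card := by
  have h1 : (rest F W v \ S).card ≤ (rest F W v \ R).card :=
    Finset.card_le_card (Finset.sdiff_subset_sdiff le_rfl hR)
  have h2 := Finset.card_sdiff_add_card_eq_card hRW
  have h3 := card_rest (F := F) hv
  omega

namespace Branching

variable {b : Finset V → ℝ}

theorem step (hb : Branching F b) {W S : Finset V} {u : V} (hu : u ∈ W) (huS : u ∉ S) :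
    b (W \ S) ≤ b (rest F W u \ S) + b (W \ insert u S) := by
  have h := hb.branch (W \ S) u (Finset.mem_sdiff.2 ⟨hu, huS⟩)
  rw [rest_sdiff, ← Finset.sdiff_insert] at h
  linarith

theorem first_step (hb : Branching F b) {W : Finset V} {u : V} (hu : u ∈ W) :
    b W ≤ b (rest F W u) + b (W \ {u}) := by
  have h := hb.branch W u hu
  rw [← Finset.sdiff_singleton_eq_erase] at h
  linarith

/-- This ends every sequence of deletions: once all neighbours of `v` are gone, `v` is isolated and
the remaining term drops out. -/
theorem sdiff_nonpos (hb : Branching F b) {W S : Finset V} {v : V} (hv : v ∈ W) (hvS : v ∉ S)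
    (hS : nbrs F W v ⊆ S) : b (W \ S) ≤ 0 := by
  refine hb.isolated _ v (Finset.mem_sdiff.2 ⟨hv, hvS⟩) fun w hw h => ?_
  rw [Finset.mem_sdiff] at hw
  exact hw.2 (hS (mem_nbrs.2 ⟨hw.1, h⟩))

/-- The neighbours of `v` are deleted one after another. Each deletion leaves a term on the
non-neighbours of the deleted vertex, and the last remainder is nonpositive because `v` has become
isolated. -/
theorem sum_nbrs (hb : Branching F b) {W : Finset V} {v : V} (hv : v ∈ W) {M : ℝ}
    (hM : ∀ u ∈ nbrs F W v, ∀ T ⊆ rest F W u, b T ≤ M) :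
    b W ≤ (nbrs F W v).card * M := by
  have key : ∀ S ⊆ nbrs F W v, b W ≤ S.card * M + b (W \ S) := by
    intro S
    induction S using Finset.induction_on with
    | empty => simp
    | insert u S hu ih =>
      intro hS
      have h1 := ih ((Finset.subset_insert _ _).trans hS)
      have hu' := hS (Finset.mem_insert_self u S)
      have h2 := hb.step (mem_nbrs.1 hu').1 hu
      have h3 := hM u hu' (rest F W u \ S) Finset.sdiff_subset
      rw [Finset.card_insert_of_notMem hu]
      push_cast
      linarith
  have h := key _ le_rfl
  have h0 := hb.sdiff_nonpos hv (by simp) (le_refl (nbrs F W v))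
  linarith

/-- Refines `sum_nbrs` by the number of neighbours deleted before `u`. If the neighbours are
pairwise nonadjacent, each earlier one is a further vertex missing from the term of `u`. -/
theorem sum_nbrs_of_card (hb : Branching F b) {W : Finset V} {v : V} (hv : v ∈ W) {M : ℕ → ℝ}
    (hM : ∀ u ∈ nbrs F W v, ∀ S ⊆ nbrs F W v, u ∉ S → b (rest F W u \ S) ≤ M S.card) :
    b W ≤ ∑ i ∈ Finset.range (nbrs F W v).card, M i := by
  have key : ∀ S ⊆ nbrs F W v, b W ≤ ∑ i ∈ Finset.range S.card, M i + b (W \ S) := by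
    intro S
    induction S using Finset.induction_on with
    | empty => simp
    | insert u S hu ih =>
      intro hS
      have hS' := (Finset.subset_insert _ _).trans hS
      have h1 := ih hS'
      have hu' := hS (Finset.mem_insert_self u S)
      have h2 := hb.step (mem_nbrs.1 hu').1 hu
      have h3 := hM u hu' S hS' hu
      rw [Finset.card_insert_of_notMem hu, Finset.sum_range_succ]
      linarith
  have h := key _ le_rfl
  have h0 := hb.sdiff_nonpos hv (by simp) (le_refl (nbrs F W v))
  linarith

end Branching

theorem ssubset_of_subset_of_card_lt {s t : Finset V} (h : s ⊆ t) (hc : s.card < t.card) :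
    s ⊂ t :=
  h.ssubset_of_ne fun he => by rw [he] at hc; exact lt_irrefl _ hc

theorem exists_min_nbrs {W : Finset V} (hW : W.Nonempty) :
    ∃ v ∈ W, ∀ u ∈ W, (nbrs F W v).card ≤ (nbrs F W u).card :=
  Finset.exists_min_image W (fun v => (nbrs F W v).card) hW

/-- The bound `x ^ |T|` for proper subsets `T`, in terms of the number `k` of removed vertices. -/
theorem le_inv_pow_mul {b : Finset V → ℝ} {x : ℝ} (hx : 1 ≤ x) {W T : Finset V} {k : ℕ}
    (h : b T ≤ x ^ T.card) (hk : T.card + k ≤ W.card) :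
    b T ≤ x⁻¹ ^ k * x ^ W.card := by
  refine h.trans ?_
  have hx0 : 0 < x := by linarith
  rw [inv_pow, inv_mul_eq_div, le_div_iff₀ (by positivity), ← pow_add]
  exact pow_le_pow_right₀ hx hk

/-- The extremal bound for all graphs, in terms of the growth of `d ≤ x ^ (d + 1)`. -/
theorem Branching.le_pow_of_forall {b : Finset V → ℝ} (hb : Branching F b) {x : ℝ} (hx : 1 ≤ x)
    (hd : ∀ d : ℕ, (d : ℝ) ≤ x ^ (d + 1)) (W : Finset V) : b W ≤ x ^ W.card := by
  induction W using Finset.strongInduction with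
  | H W ih =>
  rcases W.eq_empty_or_nonempty with rfl | hW
  · simpa using hb.empty_le
  obtain ⟨v, hv, hmin⟩ := exists_min_nbrs (F := F) hW
  set d := (nbrs F W v).card with hd'
  have hX : 0 < x ^ W.card := by positivity
  have h := hb.sum_nbrs hv (M := x⁻¹ ^ (d + 1) * x ^ W.card) fun u hu T hT => by
    have huW := (mem_nbrs.1 hu).1
    have h1 := card_rest (F := F) huW
    have h2 := Finset.card_le_card hT
    have h3 := hmin u huW
    refine le_inv_pow_mul hx (ih T (ssubset_of_subset_of_card_lt
      (hT.trans (rest_subset _ _)) (by omega))) (by omega)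
  refine h.trans ?_
  rw [← mul_assoc]
  refine mul_le_of_le_one_left hX.le ?_
  rw [inv_pow, ← div_eq_mul_inv, div_le_one (by positivity)]
  exact hd d

/-- The inequality `d ^ 5 ≤ 4 ^ (d + 1)` is sharp exactly at `d = 4`, the degree in a disjoint union
of complete graphs on five vertices. -/
theorem le_pow_succ_of_pow_five {x : ℝ} (hx : 1 ≤ x) (h5 : x ^ 5 = 4) (d : ℕ) :
    (d : ℝ) ≤ x ^ (d + 1) := by
  have h : d ^ 5 ≤ 4 ^ (d + 1) := by
    rcases le_or_gt d 4 with h | h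
    · interval_cases d <;> norm_num
    · induction d, h using Nat.le_induction with
      | base => norm_num
      | succ n hn ih =>
        have : (n + 1) ^ 5 ≤ 4 * n ^ 5 := by
          obtain ⟨m, rfl⟩ : ∃ m, n = m + 5 := ⟨n - 5, by simp at hn; omega⟩
          have : 0 ≤ m := Nat.zero_le _
          ring_nf
          nlinarith [Nat.zero_le (m ^ 2), Nat.zero_le (m ^ 3), Nat.zero_le (m ^ 4),
            Nat.zero_le (m ^ 5)]
        rw [pow_succ 4]
        linarith
  have h' : (d : ℝ) ^ 5 ≤ (x ^ (d + 1)) ^ 5 := by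
    rw [← pow_mul, mul_comm, pow_mul, h5]
    exact_mod_cast h
  exact le_of_pow_le_pow_left₀ (by norm_num) (by positivity) h'

theorem Branching.le_pow_of_pow_five {b : Finset V → ℝ} (hb : Branching F b) {x : ℝ} (hx : 1 ≤ x)
    (h5 : x ^ 5 = 4) (W : Finset V) : b W ≤ x ^ W.card :=
  hb.le_pow_of_forall hx (le_pow_succ_of_pow_five hx h5) W

/-- The inequality `d ^ 4 ≤ 3 ^ (d + 1)` fails only at `d = 4`, where `256 > 243`; equality holds at
`d = 3`. -/
theorem le_pow_succ_of_pow_four {x : ℝ} (hx : 1 ≤ x) (h4 : x ^ 4 = 3) {d : ℕ} (hd : d ≠ 4) :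
    (d : ℝ) ≤ x ^ (d + 1) := by
  have h : d ^ 4 ≤ 3 ^ (d + 1) := by
    rcases le_or_gt d 4 with h | h
    · interval_cases d <;> first | omega | norm_num
    · clear hd
      induction d, h using Nat.le_induction with
      | base => norm_num
      | succ n hn ih =>
        have : (n + 1) ^ 4 ≤ 3 * n ^ 4 := by
          obtain ⟨m, rfl⟩ : ∃ m, n = m + 5 := ⟨n - 5, by simp at hn; omega⟩
          have : 0 ≤ m := Nat.zero_le _
          ring_nf
          nlinarith [Nat.zero_le (m ^ 2), Nat.zero_le (m ^ 3), Nat.zero_le (m ^ 4)]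
        rw [pow_succ 3]
        linarith
  have h' : (d : ℝ) ^ 4 ≤ (x ^ (d + 1)) ^ 4 := by
    rw [← pow_mul, mul_comm, pow_mul, h4]
    exact_mod_cast h
  exact le_of_pow_le_pow_left₀ (by norm_num) (by positivity) h'

/-- The extremal bound for induced subgraphs without a complete graph on five vertices. -/
theorem Branching.le_pow_of_pow_four {b : Finset V → ℝ} (hb : Branching F b) {x : ℝ} (hx : 1 ≤ x)
    (h4 : x ^ 4 = 3) (W : Finset V) (hW : ∀ s ⊆ W, ¬ F.IsNClique 5 s) : b W ≤ x ^ W.card := by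
  induction W using Finset.strongInduction with
  | H W ih =>
  rcases W.eq_empty_or_nonempty with rfl | hne
  · simpa using hb.empty_le
  obtain ⟨v, hv, hmin⟩ := exists_min_nbrs (F := F) hne
  have hX : 0 < x ^ W.card := by positivity
  have hx0 : 0 < x := by positivity
  have hT : ∀ (T : Finset V) (k : ℕ), T ⊆ W → 0 < k → T.card + k ≤ W.card →
      b T ≤ x⁻¹ ^ k * x ^ W.card := fun T k hTW hk hc =>
    le_inv_pow_mul hx (ih T (ssubset_of_subset_of_card_lt hTW (by omega))
      fun s hs => hW s (hs.trans hTW)) hc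
  by_cases hd : (nbrs F W v).card = 4
  · -- two of the four neighbours are not adjacent
    obtain ⟨a, ha, c, hc, hac, hnac⟩ : ∃ a ∈ nbrs F W v, ∃ c ∈ nbrs F W v, a ≠ c ∧
        ¬ F.Adj a c := by
      by_contra! h
      refine hW (insert v (nbrs F W v)) (Finset.insert_subset hv (nbrs_subset _ _)) ?_
      refine ⟨?_, ?_⟩
      · rw [Finset.coe_insert]
        exact SimpleGraph.IsClique.insert (fun x hx y hy hxy => h x hx y hy hxy)
          fun y hy _ => (mem_nbrs.1 hy).2
      · rw [Finset.card_insert_of_notMem (by simp), hd]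
    have hrest : (nbrs F W v \ {a, c}).card = 2 := by
      rw [Finset.card_sdiff_of_subset, hd, Finset.card_pair hac]
      intro z hz
      simp only [Finset.mem_insert, Finset.mem_singleton] at hz
      rcases hz with rfl | rfl <;> assumption
    obtain ⟨e, f, hef, heq⟩ := Finset.card_eq_two.1 hrest
    have he : e ∈ nbrs F W v \ {a, c} := by rw [heq]; simp
    have hf : f ∈ nbrs F W v \ {a, c} := by rw [heq]; simp
    simp only [Finset.mem_sdiff, Finset.mem_insert, Finset.mem_singleton, not_or] at he hf
    have hsub : nbrs F W v ⊆ {f, e, c, a} := by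
      intro z hz
      by_cases hz' : z = a ∨ z = c
      · rcases hz' with rfl | rfl <;> simp
      · have : z ∈ nbrs F W v \ {a, c} := by
          simp only [Finset.mem_sdiff, Finset.mem_insert, Finset.mem_singleton]
          exact ⟨hz, hz'⟩
        rw [heq] at this
        simp only [Finset.mem_insert, Finset.mem_singleton] at this ⊢
        tauto
    have hge : ∀ z ∈ nbrs F W v, 4 ≤ (nbrs F W z).card := fun z hz =>
      hd ▸ hmin z (mem_nbrs.1 hz).1
    have mW : ∀ z ∈ nbrs F W v, z ∈ W := fun z hz => (mem_nbrs.1 hz).1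
    -- The four neighbours are deleted in the order `a, c, e, f`. All have degree at least four, and
    -- `c` gains one vertex from its earlier non-neighbour `a`; the exponents are `5, 6, 5, 5`.
    have t1 : b (rest F W a) ≤ x⁻¹ ^ 5 * x ^ W.card := by
      have := card_rest (F := F) (mW a ha)
      have := hge a ha
      exact hT _ 5 (rest_subset _ _) (by norm_num) (by omega)
    have t2 : b (rest F W c \ {a}) ≤ x⁻¹ ^ 6 * x ^ W.card := by
      have := card_rest_sdiff_add_le (F := F) (R := {a}) (S := {a}) (mW c hc) le_rfl
        (by simp [mW a ha, hac, SimpleGraph.adj_comm, hnac])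
      have := hge c hc
      rw [Finset.card_singleton] at *
      exact hT _ 6 (Finset.sdiff_subset.trans (rest_subset _ _)) (by norm_num) (by omega)
    have t3 : b (rest F W e \ {c, a}) ≤ x⁻¹ ^ 5 * x ^ W.card := by
      have h1 := card_rest_sdiff_add_le (F := F) (R := ∅) (S := {c, a}) (mW e he.1)
        (by simp) (by simp)
      have := hge e he.1
      rw [Finset.card_empty] at h1
      exact hT _ 5 (Finset.sdiff_subset.trans (rest_subset _ _)) (by norm_num) (by omega)
    have t4 : b (rest F W f \ {e, c, a}) ≤ x⁻¹ ^ 5 * x ^ W.card := by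
      have h1 := card_rest_sdiff_add_le (F := F) (R := ∅) (S := {e, c, a}) (mW f hf.1)
        (by simp) (by simp)
      have := hge f hf.1
      rw [Finset.card_empty] at h1
      exact hT _ 5 (Finset.sdiff_subset.trans (rest_subset _ _)) (by norm_num) (by omega)
    have s1 := hb.first_step (mW a ha)
    have s2 := hb.step (S := {a}) (mW c hc) (by simp [hac.symm])
    have s3 := hb.step (S := {c, a}) (mW e he.1) (by simp [he.2])
    have s4 := hb.step (S := {e, c, a}) (mW f hf.1) (by simp [hf.2, hef.symm])
    have s5 := hb.sdiff_nonpos (S := {f, e, c, a}) hv (by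
      have hvn : v ∉ nbrs F W v := by simp
      simp only [Finset.mem_insert, Finset.mem_singleton, not_or]
      exact ⟨by rintro rfl; exact hvn hf.1, by rintro rfl; exact hvn he.1,
        by rintro rfl; exact hvn hc, by rintro rfl; exact hvn ha⟩) hsub
    have hx13 : (1.3 : ℝ) ≤ x := by
      by_contra! hlt
      have : x ^ 4 < 1.3 ^ 4 := pow_lt_pow_left₀ hlt hx0.le (by norm_num)
      norm_num [h4] at this
    -- Since `x ^ 6 = 3 * x ^ 2`, the claim is `3 * x + 1 ≤ 3 * x ^ 2`, which holds from `x = 1.3`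
    -- on.
    have hcoef : 3 * x⁻¹ ^ 5 + x⁻¹ ^ 6 ≤ 1 := by
      have : 3 * x⁻¹ ^ 5 + x⁻¹ ^ 6 = (3 * x + 1) / x ^ 6 := by field_simp
      rw [this, div_le_one (by positivity)]
      have h6 : x ^ 6 = 3 * x ^ 2 := by rw [← h4]; ring
      rw [h6]
      nlinarith
    have := mul_le_mul_of_nonneg_right hcoef hX.le
    linarith
  · have h := hb.sum_nbrs hv (M := x⁻¹ ^ ((nbrs F W v).card + 1) * x ^ W.card)
      fun u hu T hTu => by
        have huW := (mem_nbrs.1 hu).1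
        have h1 := card_rest (F := F) huW
        have h2 := Finset.card_le_card hTu
        have h3 := hmin u huW
        exact hT T _ (hTu.trans (rest_subset _ _)) (by omega) (by omega)
    refine h.trans ?_
    rw [← mul_assoc]
    refine mul_le_of_le_one_left hX.le ?_
    rw [inv_pow, ← div_eq_mul_inv, div_le_one (by positivity)]
    exact le_pow_succ_of_pow_four hx h4 hd

end Branching

/-! ### Vertices of degree at most two, and triangle-free graphs -/

section LowDegree

variable {V : Type*} [DecidableEq V] {F : SimpleGraph V} [DecidableRel F.Adj]

/-- `p` and `q` form a triangle with `z` that is a connected component of `F[T]`. -/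
structure IsolatedTriangle (F : SimpleGraph V) [DecidableRel F.Adj] (T : Finset V)
    (z p q : V) : Prop where
  left_mem : p ∈ T
  right_mem : q ∈ T
  adj_left : F.Adj z p
  adj_right : F.Adj z q
  adj : F.Adj p q
  nbrs_self : ∀ w ∈ T, F.Adj z w → w = p ∨ w = q
  nbrs_left : ∀ w ∈ T, F.Adj p w → w = z ∨ w = q
  nbrs_right : ∀ w ∈ T, F.Adj q w → w = z ∨ w = p

namespace Branching

variable {b : Finset V → ℝ} {y X : ℝ} {W : Finset V}

/-- A vertex of degree at most one allows to remove two further vertices. -/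
theorem le_of_nbrs_card_le_one (hb : Branching F b)
    (H : ∀ (T : Finset V) (k : ℕ), T ⊆ W → 0 < k → T.card + k ≤ W.card → b T ≤ y ^ k * X)
    (hy : 0 < y) (hX : 0 < X) {T : Finset V} {k : ℕ} {z : V}
    (hTW : T ⊆ W) (hz : z ∈ T) (hd : (nbrs F T z).card ≤ 1) (hk : T.card + k ≤ W.card) :
    b T ≤ y ^ (k + 2) * X := by
  rcases (nbrs F T z).eq_empty_or_nonempty with h0 | ⟨p, hp⟩
  · refine (hb.isolated T z hz fun w hw h => ?_).trans (by positivity)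
    have : w ∈ nbrs F T z := mem_nbrs.2 ⟨hw, h⟩
    rw [h0] at this
    simp at this
  · obtain ⟨hpT, hzp⟩ := mem_nbrs.1 hp
    -- Deleting the only neighbour `p` isolates `z`, so only the term of `p` survives, and it misses
    -- both `p` and `z`.
    have h1 := hb.first_step hpT
    have h2 := hb.sdiff_nonpos (S := {p}) hz (by simpa using hzp.ne) fun w hw => by
      simpa using Finset.card_le_one.1 hd w hw p hp
    have h3 := card_rest (F := F) hpT
    have h4 : 0 < (nbrs F T p).card := Finset.card_pos.2 ⟨z, mem_nbrs.2 ⟨hz, hzp.symm⟩⟩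
    have h5 := H (rest F T p) (k + 2) ((rest_subset _ _).trans hTW) (by omega) (by omega)
    linarith

/-- A vertex of degree at most two gives a gain unless it lies in an isolated triangle. -/
theorem le_of_nbrs_card_le_two (hb : Branching F b)
    (H : ∀ (T : Finset V) (k : ℕ), T ⊆ W → 0 < k → T.card + k ≤ W.card → b T ≤ y ^ k * X)
    (hy : 0 < y) (hy1 : y ≤ 1) (hy2 : 1 ≤ y + y ^ 2) (hX : 0 < X)
    {T : Finset V} {k : ℕ} {z : V} (hTW : T ⊆ W) (hz : z ∈ T) (hd : (nbrs F T z).card ≤ 2)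
    (hk : T.card + k ≤ W.card) :
    b T ≤ (y ^ (k + 3) + y ^ (k + 4)) * X ∨ ∃ p q, IsolatedTriangle F T z p q := by
  have hyk : 0 < y ^ k := by positivity
  have one : ∀ w ∈ T, (nbrs F T w).card ≤ 1 → b T ≤ (y ^ (k + 3) + y ^ (k + 4)) * X := by
    intro w hw hw1
    refine (hb.le_of_nbrs_card_le_one H hy hX hTW hw hw1 hk).trans ?_
    gcongr
    -- The bound for degree one is weakened to the form needed for degree two; this is where `1 ≤ y
    -- + y ^ 2` enters.
    have : y ^ (k + 3) + y ^ (k + 4) = y ^ (k + 2) * (y + y ^ 2) := by ring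
    rw [this]
    exact le_mul_of_one_le_right (by positivity) hy2
  by_cases hd1 : (nbrs F T z).card ≤ 1
  · exact Or.inl (one z hz hd1)
  obtain ⟨p, q, hpq, hz2⟩ := Finset.card_eq_two.1 (show (nbrs F T z).card = 2 by omega)
  have hp : p ∈ nbrs F T z := by rw [hz2]; simp
  have hq : q ∈ nbrs F T z := by rw [hz2]; simp
  obtain ⟨hpT, hzp⟩ := mem_nbrs.1 hp
  obtain ⟨hqT, hzq⟩ := mem_nbrs.1 hq
  by_cases hp1 : (nbrs F T p).card ≤ 1
  · exact Or.inl (one p hpT hp1)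
  by_cases hq1 : (nbrs F T q).card ≤ 1
  · exact Or.inl (one q hqT hq1)
  -- removing `p` and then `q`
  have two : ∀ p q, p ∈ T → q ∈ T → p ≠ q → F.Adj z p → F.Adj z q → nbrs F T z = {p, q} →
      ∀ i j, T.card + k ≤ W.card → (rest F T p).card + i ≤ T.card → 0 < i → 0 < j →
      (rest F T q \ {p}).card + j ≤ T.card → b T ≤ (y ^ (k + i) + y ^ (k + j)) * X := by
    intro p q hpT hqT hpq hzp hzq hz2 i j hk hi hi0 hj0 hj
    have s1 := hb.first_step hpT
    have s2 := hb.step (S := {p}) hqT (by simpa using hpq.symm)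
    have s3 := hb.sdiff_nonpos (S := {q, p}) hz (by simp [hzp.ne, hzq.ne]) (by
      rw [hz2, Finset.pair_comm])
    have t1 := H (rest F T p) (k + i) ((rest_subset _ _).trans hTW) (by omega) (by omega)
    have t2 := H (rest F T q \ {p}) (k + j)
      (Finset.sdiff_subset.trans ((rest_subset _ _).trans hTW)) (by omega) (by omega)
    rw [add_mul]
    linarith
  -- Deleting both neighbours always costs `y ^ (k + 3)` twice. One exponent improves to `k + 4` if
  -- `p` and `q` are not adjacent or one of them has degree three; otherwise `z, p, q` is an
  -- isolated triangle.
  by_cases hadj : F.Adj p q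
  · by_cases hp2 : (nbrs F T p).card ≤ 2
    · by_cases hq2 : (nbrs F T q).card ≤ 2
      · refine Or.inr ⟨p, q, hpT, hqT, hzp, hzq, hadj, ?_, ?_, ?_⟩
        · intro w hw h
          have : w ∈ nbrs F T z := mem_nbrs.2 ⟨hw, h⟩
          rw [hz2] at this
          simpa using this
        · have : nbrs F T p = {z, q} := (Finset.eq_of_subset_of_card_le (by
            intro w
            simp only [Finset.mem_insert, Finset.mem_singleton]
            rintro (rfl | rfl)
            · exact mem_nbrs.2 ⟨hz, hzp.symm⟩
            · exact mem_nbrs.2 ⟨hqT, hadj⟩) (by rw [Finset.card_pair hzq.ne]; omega)).symm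
          intro w hw h
          have h' : w ∈ nbrs F T p := mem_nbrs.2 ⟨hw, h⟩
          rw [this] at h'
          simpa using h'
        · have : nbrs F T q = {z, p} := (Finset.eq_of_subset_of_card_le (by
            intro w
            simp only [Finset.mem_insert, Finset.mem_singleton]
            rintro (rfl | rfl)
            · exact mem_nbrs.2 ⟨hz, hzq.symm⟩
            · exact mem_nbrs.2 ⟨hpT, hadj.symm⟩) (by rw [Finset.card_pair hzp.ne]; omega)).symm
          intro w hw h
          have h' : w ∈ nbrs F T q := mem_nbrs.2 ⟨hw, h⟩
          rw [this] at h'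
          simpa using h'
      · have c1 := card_rest (F := F) hpT
        have c2 := card_rest_sdiff_add_le (F := F) (R := ∅) (S := {p}) hqT (by simp) (by simp)
        rw [Finset.card_empty] at c2
        exact Or.inl (two p q hpT hqT hpq hzp hzq hz2 3 4 hk (by omega) (by omega) (by omega)
          (by omega))
    · have c1 := card_rest (F := F) hqT
      have c2 := card_rest_sdiff_add_le (F := F) (R := ∅) (S := {q}) hpT (by simp) (by simp)
      rw [Finset.card_empty] at c2
      exact Or.inl (two q p hqT hpT hpq.symm hzq hzp (by rw [hz2, Finset.pair_comm]) 3 4 hk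
        (by omega) (by omega) (by omega) (by omega))
  · have c1 := card_rest (F := F) hpT
    have c2 := card_rest_sdiff_add_le (F := F) (R := {p}) (S := {p}) hqT (by simp)
      (by simp [hpT, hpq, SimpleGraph.adj_comm, hadj])
    rw [Finset.card_singleton] at c2
    exact Or.inl (two p q hpT hqT hpq hzp hzq hz2 3 4 hk (by omega) (by omega) (by omega)
      (by omega))

end Branching

theorem exists_eq_of_card_three {s : Finset V} (hs : s.card = 3) {a : V} (ha : a ∈ s) :
    ∃ c d, a ≠ c ∧ a ≠ d ∧ c ≠ d ∧ s = {a, c, d} := by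
  have h : (s.erase a).card = 2 := by rw [Finset.card_erase_of_mem ha, hs]
  obtain ⟨c, d, hcd, h2⟩ := Finset.card_eq_two.1 h
  have hc : c ∈ s.erase a := by rw [h2]; simp
  have hd : d ∈ s.erase a := by rw [h2]; simp
  refine ⟨c, d, (Finset.ne_of_mem_erase hc).symm, (Finset.ne_of_mem_erase hd).symm, hcd, ?_⟩
  rw [← Finset.insert_erase ha, h2]

theorem gamma_four_bounds : 1.243 < gamma 4 ∧ gamma 4 < 1.244 := by
  obtain ⟨⟨h1, -⟩, h⟩ := gamma_spec 4 (by norm_num)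
  set g := gamma 4
  norm_num [Finset.sum_range_succ] at h
  -- The quotient `(1 + t + t ^ 2 + t ^ 3) / t ^ 8` is decreasing; the inequality is proved in
  -- cross-multiplied form.
  have key : ∀ s t : ℝ, 1 ≤ s → s ≤ t → 1 + t + t ^ 2 + t ^ 3 = t ^ 8 →
      s ^ 8 ≤ 1 + s + s ^ 2 + s ^ 3 := by
    intro s t hs hst ht
    have e1 : s ^ 8 * t ^ 8 = s ^ 8 * (1 + t + t ^ 2 + t ^ 3) := by rw [ht]
    have p1 : s ^ 5 ≤ t ^ 5 := pow_le_pow_left₀ (by linarith) hst 5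
    have p2 : s ^ 6 ≤ t ^ 6 := pow_le_pow_left₀ (by linarith) hst 6
    have p3 : s ^ 7 ≤ t ^ 7 := pow_le_pow_left₀ (by linarith) hst 7
    have p4 : s ^ 8 ≤ t ^ 8 := pow_le_pow_left₀ (by linarith) hst 8
    have hs0 : 0 < s := by linarith
    have ht0 : 0 < t := by linarith
    have q : s ^ 8 * (1 + t + t ^ 2 + t ^ 3) ≤ t ^ 8 * (1 + s + s ^ 2 + s ^ 3) := by
      have a1 : s ^ 8 * t ≤ t ^ 8 * s := by
        have := mul_le_mul_of_nonneg_right p3 (show 0 ≤ s * t by positivity)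
        nlinarith
      have a2 : s ^ 8 * t ^ 2 ≤ t ^ 8 * s ^ 2 := by
        have := mul_le_mul_of_nonneg_right p2 (show 0 ≤ s ^ 2 * t ^ 2 by positivity)
        nlinarith
      have a3 : s ^ 8 * t ^ 3 ≤ t ^ 8 * s ^ 3 := by
        have := mul_le_mul_of_nonneg_right p1 (show 0 ≤ s ^ 3 * t ^ 3 by positivity)
        nlinarith
      linarith
    rw [← e1] at q
    have ht8 : 0 < t ^ 8 := by positivity
    nlinarith
  have hg : 1 + g + g ^ 2 + g ^ 3 = g ^ 8 := by linarith
  constructor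
  · by_contra! hlt
    have p5 : g ^ 5 ≤ 1.243 ^ 5 := pow_le_pow_left₀ (by linarith) hlt 5
    have g0 : 0 < g := by linarith
    have e : (1 + g + g ^ 2 + g ^ 3) = g ^ 5 * g ^ 3 := by rw [hg]; ring
    have b5 : (1.243 : ℝ) ^ 5 < 2.9674 := by norm_num
    have : g ^ 5 * g ^ 3 ≤ 2.9674 * g ^ 3 := by
      have : 0 < g ^ 3 := by positivity
      nlinarith
    have hf : 0 ≤ 1.9674 * g ^ 3 - g ^ 2 - g - 1 := by linarith
    nlinarith [sq_nonneg (g - 1.243), mul_pos g0 g0]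
  · by_contra! hlt
    have := key 1.244 g (by norm_num) hlt hg
    norm_num at this

/-- Equality holds at `d = 4` by the definition of `gamma 4`, and from there on induction works
because `g ^ n * (g ^ 2 - 1) ≥ 1`. The inequality fails at `d = 3`, which therefore needs a separate
argument for triangle-free graphs. -/
theorem geom_sum_gamma_four_le {d : ℕ} (hd : d ≠ 3) :
    ∑ i ∈ Finset.range d, gamma 4 ^ i ≤ gamma 4 ^ (2 * d) := by
  obtain ⟨hlo, hhi⟩ := gamma_four_bounds
  have hspec := (gamma_spec 4 (by norm_num)).2
  set g := gamma 4
  rcases le_or_gt 4 d with h | h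
  · clear hd
    induction d, h using Nat.le_induction with
    | base => linarith
    | succ n hn ih =>
      rw [Finset.sum_range_succ, show 2 * (n + 1) = 2 * n + 2 by ring, pow_add]
      have h1 : g ^ 4 ≤ g ^ n := pow_le_pow_right₀ (by linarith) hn
      have h2 : g ^ n * 1 ≤ g ^ n * (g ^ n * (g ^ 2 - 1)) := by
        have hg4 : (2.3 : ℝ) ≤ g ^ 4 := by
          have := pow_le_pow_left₀ (by norm_num) hlo.le 4
          norm_num at this
          linarith
        have hg2 : (0.5 : ℝ) ≤ g ^ 2 - 1 := by nlinarith
        have : 1 ≤ g ^ n * (g ^ 2 - 1) := by nlinarith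
        have : 0 < g ^ n := by linarith
        gcongr
      have h3 : g ^ n * (g ^ n * (g ^ 2 - 1)) = g ^ (2 * n) * g ^ 2 - g ^ (2 * n) := by ring
      linarith
  · interval_cases d
    · simp
    · simpa using one_le_pow₀ (n := 2) (show 1 ≤ g by linarith)
    · have := pow_le_pow_left₀ (by norm_num) hlo.le 4
      norm_num [Finset.sum_range_succ] at this ⊢
      linarith
    · omega

/-- The total cost of deleting `d` pairwise nonadjacent neighbours of degree at least `d`: the
`i`-th term misses `d + 1` vertices of a closed neighbourhood and the `i` neighbours deleted before.
-/
theorem sum_inv_gamma_four_le {d : ℕ} (hd : d ≠ 3) :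
    ∑ i ∈ Finset.range d, (gamma 4)⁻¹ ^ (d + 1 + i) ≤ 1 := by
  have hlo := gamma_four_bounds.1
  have hg : 0 < gamma 4 := by linarith
  have h := geom_sum_gamma_four_le hd
  rw [← Finset.sum_range_reflect] at h
  have : ∑ i ∈ Finset.range d, (gamma 4)⁻¹ ^ (d + 1 + i) =
      (∑ j ∈ Finset.range d, gamma 4 ^ (d - 1 - j)) / gamma 4 ^ (2 * d) := by
    rw [Finset.sum_div]
    refine Finset.sum_congr rfl fun i hi => ?_
    rw [Finset.mem_range] at hi
    rw [eq_div_iff (by positivity), inv_pow, inv_mul_eq_div, div_eq_iff (by positivity), ← pow_add]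
    congr 1
    omega
  rw [this, div_le_one (by positivity)]
  exact h

/-- The extremal bound for triangle-free induced subgraphs. -/
theorem Branching.le_gamma_four_pow {b : Finset V → ℝ} (hb : Branching F b) (W : Finset V)
    (hW : ∀ p ∈ W, ∀ q ∈ W, ∀ r ∈ W, F.Adj p q → F.Adj q r → ¬ F.Adj p r) :
    b W ≤ gamma 4 ^ W.card := by
  induction W using Finset.strongInduction with
  | H W ih =>
  rcases W.eq_empty_or_nonempty with rfl | hne
  · simpa using hb.empty_le
  obtain ⟨v, hv, hmin⟩ := exists_min_nbrs (F := F) hne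
  obtain ⟨hlo, hhi⟩ := gamma_four_bounds
  have hx : 1 ≤ gamma 4 := by linarith
  have hX : 0 < gamma 4 ^ W.card := by positivity
  have H : ∀ (T : Finset V) (k : ℕ), T ⊆ W → 0 < k → T.card + k ≤ W.card →
      b T ≤ (gamma 4)⁻¹ ^ k * gamma 4 ^ W.card := fun T k hTW hk hc =>
    le_inv_pow_mul hx (ih T (ssubset_of_subset_of_card_lt hTW (by omega))
      fun p hp q hq r hr => hW p (hTW hp) q (hTW hq) r (hTW hr)) hc
  have hind : ∀ p ∈ nbrs F W v, ∀ q ∈ nbrs F W v, ¬ F.Adj p q := by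
    intro p hp q hq hpq
    rw [mem_nbrs] at hp hq
    exact hW v hv p hp.1 q hq.1 hp.2 hpq hq.2
  have mW : ∀ z ∈ nbrs F W v, z ∈ W := fun z hz => (mem_nbrs.1 hz).1
  have hcard : ∀ u ∈ nbrs F W v, ∀ S ⊆ nbrs F W v, u ∉ S →
      (rest F W u \ S).card + ((nbrs F W u).card + 1 + S.card) ≤ W.card := by
    intro u hu S hS huS
    refine card_rest_sdiff_add_le (mW u hu) le_rfl fun z hz => ?_
    refine mem_rest.2 ⟨mW z (hS hz), ?_, hind u hu z (hS hz)⟩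
    rintro rfl
    exact huS hz
  by_cases hd : (nbrs F W v).card = 3
  · have hy1 : (gamma 4)⁻¹ ≤ 0.805 := by
      rw [inv_le_comm₀ (by linarith) (by norm_num)]
      norm_num
      linarith
    have hy2 : 0.803 ≤ (gamma 4)⁻¹ := by
      rw [le_inv_comm₀ (by norm_num) (by linarith)]
      norm_num
      linarith
    set y := (gamma 4)⁻¹
    set X := gamma 4 ^ W.card
    have hy0 : 0 < y := by linarith
    have hpow : ∀ k, y ^ k ≤ 0.805 ^ k := fun k => pow_le_pow_left₀ hy0.le hy1 k
    have three : ∀ a c d, a ≠ c → a ≠ d → c ≠ d → nbrs F W v = {a, c, d} →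
        b W ≤ b (rest F W a) + b (rest F W c \ {a}) + b (rest F W d \ {c, a}) := by
      intro a c d hac had hcd heq
      have ha : a ∈ nbrs F W v := by rw [heq]; simp
      have hc : c ∈ nbrs F W v := by rw [heq]; simp
      have hd : d ∈ nbrs F W v := by rw [heq]; simp
      have s1 := hb.first_step (mW a ha)
      have s2 := hb.step (S := {a}) (mW c hc) (by simp [hac.symm])
      have s3 := hb.step (S := {c, a}) (mW d hd) (by simp [hcd.symm, had.symm])
      have s4 := hb.sdiff_nonpos (S := {d, c, a}) hv (by
        have hvn : v ∉ nbrs F W v := by simp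
        simp only [Finset.mem_insert, Finset.mem_singleton, not_or]
        exact ⟨by rintro rfl; exact hvn hd, by rintro rfl; exact hvn hc,
          by rintro rfl; exact hvn ha⟩) (by
        rw [heq]
        intro z
        simp only [Finset.mem_insert, Finset.mem_singleton]
        tauto)
      linarith
    -- If some neighbour has degree four, it is deleted first and the exponents are `5, 5, 6`, which
    -- suffices. If all have degree three, the next neighbour has degree at most two in each of the
    -- first two terms, as it has lost `v`; branching once more there replaces `y ^ 4` by `y ^ 7 + y
    -- ^ 8` and `y ^ 5` by `y ^ 8 + y ^ 9`.
    by_cases hex : ∃ a ∈ nbrs F W v, 4 ≤ (nbrs F W a).card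
    · obtain ⟨a, ha, ha4⟩ := hex
      obtain ⟨c, d, hac, had, hcd, heq⟩ := exists_eq_of_card_three hd ha
      have hc : c ∈ nbrs F W v := by rw [heq]; simp
      have hd' : d ∈ nbrs F W v := by rw [heq]; simp
      have h0 := three a c d hac had hcd heq
      have c1 := card_rest (F := F) (mW a ha)
      have c2 := hcard c hc {a} (by simpa using ha) (by simp [hac.symm])
      have c3 := hcard d hd' {c, a} (by
        intro z; simp only [Finset.mem_insert, Finset.mem_singleton]
        rintro (rfl | rfl) <;> assumption) (by simp [hcd.symm, had.symm])
      rw [Finset.card_singleton] at c2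
      rw [Finset.card_pair hac.symm] at c3
      have m1 := hmin c (mW c hc)
      have m2 := hmin d (mW d hd')
      have t1 := H (rest F W a) 5 (rest_subset _ _) (by norm_num) (by omega)
      have t2 := H (rest F W c \ {a}) 5 (Finset.sdiff_subset.trans (rest_subset _ _))
        (by norm_num) (by omega)
      have t3 := H (rest F W d \ {c, a}) 6 (Finset.sdiff_subset.trans (rest_subset _ _))
        (by norm_num) (by omega)
      have p5 := hpow 5
      have p6 := hpow 6
      have : (y ^ 5 + y ^ 5 + y ^ 6) * X ≤ 1 * X := by
        gcongr
        norm_num at p5 p6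
        linarith
      linarith
    · push Not at hex
      obtain ⟨a, ha⟩ : (nbrs F W v).Nonempty := Finset.card_pos.1 (by omega)
      obtain ⟨c, d, hac, had, hcd, heq⟩ := exists_eq_of_card_three hd ha
      have hc : c ∈ nbrs F W v := by rw [heq]; simp
      have hd' : d ∈ nbrs F W v := by rw [heq]; simp
      have h0 := three a c d hac had hcd heq
      have c1 := card_rest (F := F) (mW a ha)
      have c2 := hcard c hc {a} (by simpa using ha) (by simp [hac.symm])
      have c3 := hcard d hd' {c, a} (by
        intro z; simp only [Finset.mem_insert, Finset.mem_singleton]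
        rintro (rfl | rfl) <;> assumption) (by simp [hcd.symm, had.symm])
      rw [Finset.card_singleton] at c2
      rw [Finset.card_pair hac.symm] at c3
      have m0 := hmin a (mW a ha)
      have m1 := hmin c (mW c hc)
      have m2 := hmin d (mW d hd')
      have noTri : ∀ T ⊆ W, ∀ z ∈ T, ¬ ∃ p q, IsolatedTriangle F T z p q := by
        rintro T hTW z hz ⟨p, q, h⟩
        exact hW z (hTW hz) p (hTW h.left_mem) q (hTW h.right_mem) h.adj_left h.adj h.adj_right
      have deg2 : ∀ e ∈ nbrs F W v, ∀ T ⊆ W, v ∉ T → (nbrs F T e).card ≤ 2 := by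
        intro e he T hTW hvT
        have h1 : nbrs F T e ⊆ (nbrs F W e).erase v := by
          intro z hz
          rw [mem_nbrs] at hz
          exact Finset.mem_erase.2 ⟨by rintro rfl; exact hvT hz.1,
            mem_nbrs.2 ⟨hTW hz.1, hz.2⟩⟩
        have h2 := Finset.card_le_card h1
        rw [Finset.card_erase_of_mem (mem_nbrs.2 ⟨hv, (mem_nbrs.1 he).2.symm⟩)] at h2
        have := hex e he
        omega
      have sub1 : rest F W a ⊆ W := rest_subset _ _
      have sub2 : rest F W c \ {a} ⊆ W := Finset.sdiff_subset.trans (rest_subset _ _)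
      have cm : c ∈ rest F W a := mem_rest.2 ⟨mW c hc, hac.symm, hind a ha c hc⟩
      have dm : d ∈ rest F W c \ {a} := by
        rw [Finset.mem_sdiff, mem_rest]
        exact ⟨⟨mW d hd', hcd.symm, hind c hc d hd'⟩, by simp [had.symm]⟩
      have hy3 : 1 ≤ y + y ^ 2 := by nlinarith
      have t1 := (hb.le_of_nbrs_card_le_two H hy0 (by linarith) hy3 hX (k := 4) sub1 cm
        (deg2 c hc _ sub1 (by simp [(mem_nbrs.1 ha).2.symm])) (by omega)).resolve_right
        (noTri _ sub1 _ cm)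
      have t2 := (hb.le_of_nbrs_card_le_two H hy0 (by linarith) hy3 hX (k := 5) sub2 dm
        (deg2 d hd' _ sub2 (by simp [(mem_nbrs.1 hc).2.symm])) (by omega)).resolve_right
        (noTri _ sub2 _ dm)
      have t3 := H (rest F W d \ {c, a}) 6 (Finset.sdiff_subset.trans (rest_subset _ _))
        (by norm_num) (by omega)
      have p6 := hpow 6
      have p7 := hpow 7
      have p8 := hpow 8
      have p9 := hpow 9
      have : ((y ^ 7 + y ^ 8) + (y ^ 8 + y ^ 9) + y ^ 6) * X ≤ 1 * X := by
        gcongr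
        norm_num at p6 p7 p8 p9
        linarith
      norm_num at t1 t2
      linarith
  · have h := hb.sum_nbrs_of_card hv
      (M := fun i => (gamma 4)⁻¹ ^ ((nbrs F W v).card + 1 + i) * gamma 4 ^ W.card)
      fun u hu S hS huS => by
        have h1 := hcard u hu S hS huS
        have h2 := hmin u (mW u hu)
        exact H _ _ (Finset.sdiff_subset.trans (rest_subset _ _)) (by omega) (by omega)
    rw [← Finset.sum_mul] at h
    exact h.trans (mul_le_of_le_one_left hX.le (sum_inv_gamma_four_le hd))

end LowDegree

/-! ### Minimal counterexamples without four-cliques: costs, and degree three -/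

section Critical

variable {V : Type*} [DecidableEq V]

/-- A graph `F[W]` without complete subgraphs on four vertices that violates the bound `X`, while
all smaller induced subgraphs satisfy it. Here `y` is the inverse of `2 ^ (1 / 3)`. -/
structure Critical (F : SimpleGraph V) [DecidableRel F.Adj] (b : Finset V → ℝ) (y X : ℝ)
    (W : Finset V) : Prop where
  branching : Branching F b
  pos : 0 < y
  cube : y ^ 3 = 1 / 2
  X_pos : 0 < X
  bound : ∀ (T : Finset V) (k : ℕ), T ⊆ W → 0 < k → T.card + k ≤ W.card → b T ≤ y ^ k * X
  no_four : ∀ p ∈ W, ∀ q ∈ W, ∀ r ∈ W, ∀ s ∈ W, F.Adj p q → F.Adj p r → F.Adj p s →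
    F.Adj q r → F.Adj q s → F.Adj r s → False
  lt : X < b W

variable {F : SimpleGraph V} [DecidableRel F.Adj]

theorem mem_rest_comm {W : Finset V} {u a : V} (hu : u ∈ W) (h : a ∈ rest F W u) :
    u ∈ rest F W a := by
  rw [mem_rest] at h ⊢
  exact ⟨hu, h.2.1.symm, fun h' => h.2.2 h'.symm⟩

theorem adj_of_nbrs_subset {W S : Finset V} {p w : V} (h : nbrs F W p ⊆ insert w S)
    (hS : S.card < (nbrs F W p).card) : F.Adj p w := by
  by_contra hpw
  have : nbrs F W p ⊆ S := by
    intro z hz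
    rcases Finset.mem_insert.1 (h hz) with rfl | h'
    · exact absurd (mem_nbrs.1 hz).2 hpw
    · exact h'
  exact absurd (Finset.card_le_card this) (by omega)

theorem card_nbrs_add_le {W T R : Finset V} {z : V} (hT : T ⊆ W) (hR : R ⊆ nbrs F W z)
    (hRT : ∀ r ∈ R, r ∉ T) : (nbrs F T z).card + R.card ≤ (nbrs F W z).card := by
  rw [← Finset.card_union_of_disjoint]
  · refine Finset.card_le_card (Finset.union_subset ?_ hR)
    intro w hw
    rw [mem_nbrs] at hw ⊢
    exact ⟨hT hw.1, hw.2⟩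
  · rw [Finset.disjoint_left]
    intro w hw hw'
    exact hRT w hw' (mem_nbrs.1 hw).1

theorem eq_of_two_outside {W : Finset V} {u p q r : V} {A : Finset V}
    (hA : A ⊆ nbrs F W u) (hcard : (nbrs F W u).card ≤ A.card + 2) (hp : p ∈ nbrs F W u)
    (hq : q ∈ nbrs F W u) (hpq : p ≠ q) (hpA : p ∉ A) (hqA : q ∉ A) (hr : r ∈ nbrs F W u)
    (hrA : r ∉ A) : r = p ∨ r = q := by
  by_contra! h
  have hsub : insert r (insert p (insert q A)) ⊆ nbrs F W u := by
    intro z hz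
    simp only [Finset.mem_insert] at hz
    rcases hz with rfl | rfl | rfl | h
    exacts [hr, hp, hq, hA h]
  have := Finset.card_le_card hsub
  rw [Finset.card_insert_of_notMem (by simp [h, hrA]), Finset.card_insert_of_notMem
    (by simp [hpq, hpA]), Finset.card_insert_of_notMem hqA] at this
  omega

namespace Critical

variable {b : Finset V → ℝ} {y X : ℝ} {W : Finset V}

theorem bounds (C : Critical F b y X W)
    : 0.7937 < y ∧ y < 0.7938 ∧ 0.6299 < y ^ 2 ∧ y ^ 2 < 0.6302 := by
  have h0 := C.pos
  have h3 := C.cube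
  have h1 : 0.7937 < y := by
    by_contra! h
    have := pow_le_pow_left₀ h0.le h 3
    norm_num [h3] at this
  have h2 : y < 0.7938 := by
    by_contra! h
    have := pow_le_pow_left₀ (by norm_num) h 3
    norm_num [h3] at this
  refine ⟨h1, h2, ?_, ?_⟩ <;> nlinarith

/-- With `y ^ 3 = 1 / 2` all costs become linear in `1, y, y ^ 2`, so that each comparison with `1`
follows from the numerical bounds by linear arithmetic. -/
theorem pows (C : Critical F b y X W)
    : y ^ 4 = y / 2 ∧ y ^ 5 = y ^ 2 / 2 ∧ y ^ 6 = 1 / 4 ∧ y ^ 7 = y / 4 ∧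
    y ^ 8 = y ^ 2 / 4 ∧ y ^ 9 = 1 / 8 ∧ y ^ 10 = y / 8 ∧ y ^ 11 = y ^ 2 / 8 := by
  have h3 := C.cube
  refine ⟨?_, ?_, ?_, ?_, ?_, ?_, ?_, ?_⟩
  · linear_combination y * h3
  · linear_combination y ^ 2 * h3
  · linear_combination (y ^ 3 + 1 / 2) * h3
  · linear_combination y * (y ^ 3 + 1 / 2) * h3
  · linear_combination y ^ 2 * (y ^ 3 + 1 / 2) * h3
  · linear_combination (y ^ 6 + y ^ 3 / 2 + 1 / 4) * h3
  · linear_combination y * (y ^ 6 + y ^ 3 / 2 + 1 / 4) * h3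
  · linear_combination y ^ 2 * (y ^ 6 + y ^ 3 / 2 + 1 / 4) * h3

theorem contra (C : Critical F b y X W) {c : ℝ} (h : b W ≤ c * X) (hc : c ≤ 1) : False := by
  have := mul_le_mul_of_nonneg_right hc C.X_pos.le
  linarith [C.lt]

/-- The exponent counts vertices missing from the term of `u`: its closed neighbourhood, and the
non-neighbours `R` of `u` that were deleted earlier. The next four lemmas are the cases `|R| = 0, 1,
2, 3`. -/
theorem cost (C : Critical F b y X W)
    {u : V} (hu : u ∈ W) {S : Finset V} (R : Finset V) (hRS : R ⊆ S)
    (hR : R ⊆ rest F W u) {k : ℕ} (hk0 : 0 < k) (hk : k ≤ (nbrs F W u).card + 1 + R.card) :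
    b (rest F W u \ S) ≤ y ^ k * X := by
  have h := card_rest_sdiff_add_le hu hRS hR
  exact C.bound _ k (Finset.sdiff_subset.trans (rest_subset _ _)) hk0 (by omega)

theorem cost_zero (C : Critical F b y X W) {u : V} (hu : u ∈ W) {S : Finset V} (d : ℕ)
    (hd : d ≤ (nbrs F W u).card) : b (rest F W u \ S) ≤ y ^ (d + 1) * X :=
  C.cost hu ∅ (by simp) (by simp) (by omega) (by simp; omega)

theorem cost_one (C : Critical F b y X W)
    {u : V} (hu : u ∈ W) {S : Finset V} (d : ℕ) (hd : d ≤ (nbrs F W u).card)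
    {a : V} (haS : a ∈ S) (ha : a ∈ rest F W u) : b (rest F W u \ S) ≤ y ^ (d + 2) * X :=
  C.cost hu {a} (by simpa using haS) (by simpa using ha) (by omega) (by simp; omega)

theorem cost_two (C : Critical F b y X W)
    {u : V} (hu : u ∈ W) {S : Finset V} (d : ℕ) (hd : d ≤ (nbrs F W u).card)
    {a c : V} (hac : a ≠ c) (haS : a ∈ S) (hcS : c ∈ S) (ha : a ∈ rest F W u)
    (hc : c ∈ rest F W u) : b (rest F W u \ S) ≤ y ^ (d + 3) * X :=
  C.cost hu {a, c} (by simp [Finset.insert_subset_iff, haS, hcS])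
    (by rw [Finset.insert_subset_iff, Finset.singleton_subset_iff]; exact ⟨ha, hc⟩)
    (by omega) (by rw [Finset.card_pair hac]; omega)

theorem cost_three (C : Critical F b y X W)
    {u : V} (hu : u ∈ W) {S : Finset V} (d : ℕ) (hd : d ≤ (nbrs F W u).card)
    {a c e : V} (hac : a ≠ c) (hae : a ≠ e) (hce : c ≠ e) (haS : a ∈ S) (hcS : c ∈ S)
    (heS : e ∈ S) (ha : a ∈ rest F W u) (hc : c ∈ rest F W u) (he : e ∈ rest F W u) :
    b (rest F W u \ S) ≤ y ^ (d + 4) * X :=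
  C.cost hu {a, c, e} (by simp [Finset.insert_subset_iff, haS, hcS, heS])
    (by rw [Finset.insert_subset_iff, Finset.insert_subset_iff, Finset.singleton_subset_iff]
        exact ⟨ha, hc, he⟩)
    (by omega) (by
      rw [Finset.card_insert_of_notMem (by simp [hac, hae]), Finset.card_pair hce]; omega)

/-- The cost of a vertex `u` when a vertex `z` outside its neighbourhood has at most one
neighbour left; `R` is a set of neighbours of `z` that are removed. -/
theorem cost_leaf (C : Critical F b y X W) {u : V} (hu : u ∈ W) {S : Finset V} {k : ℕ}
    (hk : (rest F W u \ S).card + k ≤ W.card) {z : V} (hz : z ∈ rest F W u) (hzS : z ∉ S)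
    (R : Finset V) (hR : R ⊆ nbrs F W z) (hRT : ∀ r ∈ R, r = u ∨ F.Adj u r ∨ r ∈ S)
    (hd : (nbrs F W z).card ≤ R.card + 1) : b (rest F W u \ S) ≤ y ^ (k + 2) * X := by
  have hTW : rest F W u \ S ⊆ W := Finset.sdiff_subset.trans (rest_subset _ _)
  have := card_nbrs_add_le hTW hR fun r hr hrT => by
    rw [Finset.mem_sdiff, mem_rest] at hrT
    rcases hRT r hr with h | h | h
    exacts [hrT.1.2.1 h, hrT.1.2.2 h, hrT.2 h]
  exact C.branching.le_of_nbrs_card_le_one C.bound C.pos C.X_pos hTW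
    (Finset.mem_sdiff.2 ⟨hz, hzS⟩) (by omega) hk

/-- As `cost_leaf`, but with up to two surviving neighbours of `z`. The gain is then smaller, and an
isolated triangle at `z` remains as an exception that must be ruled out separately. -/
theorem cost_deg_two (C : Critical F b y X W) {u : V} (hu : u ∈ W) {S : Finset V} {k : ℕ}
    (hk : (rest F W u \ S).card + k ≤ W.card) {z : V} (hz : z ∈ rest F W u) (hzS : z ∉ S)
    (R : Finset V) (hR : R ⊆ nbrs F W z) (hRT : ∀ r ∈ R, r = u ∨ F.Adj u r ∨ r ∈ S)
    (hd : (nbrs F W z).card ≤ R.card + 2) :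
    b (rest F W u \ S) ≤ (y ^ (k + 3) + y ^ (k + 4)) * X ∨
      ∃ p q, IsolatedTriangle F (rest F W u \ S) z p q := by
  have hTW : rest F W u \ S ⊆ W := Finset.sdiff_subset.trans (rest_subset _ _)
  have := card_nbrs_add_le hTW hR fun r hr hrT => by
    rw [Finset.mem_sdiff, mem_rest] at hrT
    rcases hRT r hr with h | h | h
    exacts [hrT.1.2.1 h, hrT.1.2.2 h, hrT.2 h]
  obtain ⟨h1, h2, h3, h4⟩ := C.bounds
  exact C.branching.le_of_nbrs_card_le_two C.bound C.pos (by linarith) (by linarith) C.X_pos hTW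
    (Finset.mem_sdiff.2 ⟨hz, hzS⟩) (by omega) hk

/-- Branching at a vertex of degree six alone contradicts criticality: `y + y ^ 7 = 5 * y / 4 < 1`.
-/
theorem card_nbrs_le_five (C : Critical F b y X W)
    {u : V} (hu : u ∈ W) : (nbrs F W u).card ≤ 5 := by
  by_contra! h
  have s := C.branching.first_step hu
  have t1 := C.cost_zero hu (S := ∅) 6 h
  rw [Finset.sdiff_empty] at t1
  have t2 := C.bound (W \ {u}) 1 Finset.sdiff_subset (by norm_num) (by
    rw [Finset.card_sdiff_of_subset (by simpa using hu), Finset.card_singleton]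
    have := Finset.card_pos.2 ⟨u, hu⟩
    omega)
  obtain ⟨-, -, -, p7, -⟩ := C.pows
  obtain ⟨h1, h2, h3, h4⟩ := C.bounds
  exact C.contra (c := y ^ 7 + y ^ 1) (by norm_num at t1; linarith) (by
    rw [p7]; linarith)

/-- A leaf gives the factor `y ^ 2 < 1`, and two neighbours of degree at least two give `2 * y ^ 3 =
1`. -/
theorem three_le_card_nbrs (C : Critical F b y X W) {v : V} (hv : v ∈ W)
    (hmin : ∀ u ∈ W, (nbrs F W v).card ≤ (nbrs F W u).card) : 3 ≤ (nbrs F W v).card := by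
  by_contra! h
  obtain ⟨h1, h2, h3, h4⟩ := C.bounds
  by_cases hd : (nbrs F W v).card ≤ 1
  · have := C.branching.le_of_nbrs_card_le_one C.bound C.pos C.X_pos (k := 0) le_rfl hv hd
      (by omega)
    exact C.contra this (by rw [zero_add]; linarith)
  · have h2' : (nbrs F W v).card = 2 := by omega
    have := C.branching.sum_nbrs hv (M := y ^ 3 * X) fun u hu T hT => by
      have huW := (mem_nbrs.1 hu).1
      have c1 := card_rest (F := F) huW
      have c2 := Finset.card_le_card hT
      have c3 := hmin u huW
      exact C.bound T 3 (hT.trans (rest_subset _ _)) (by norm_num) (by omega)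
    rw [h2', C.cube] at this
    exact C.contra (c := 1) (by push_cast at this; linarith) le_rfl

/-- Deleting three neighbours one after the other. -/
theorem seq_three (C : Critical F b y X W)
    {u₁ u₂ u₃ : V} (h1 : u₁ ∈ W) (h2 : u₂ ∈ W) (h3 : u₃ ∈ W) (h12 : u₁ ≠ u₂)
    (h13 : u₁ ≠ u₃) (h23 : u₂ ≠ u₃) :
    b W ≤ b (rest F W u₁ \ ∅) + b (rest F W u₂ \ {u₁}) + b (rest F W u₃ \ {u₂, u₁}) +
      b (W \ {u₃, u₂, u₁}) := by
  have s1 := C.branching.first_step h1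
  have s2 := C.branching.step (S := {u₁}) h2 (by simp [h12.symm])
  have s3 := C.branching.step (S := {u₂, u₁}) h3 (by simp [h13.symm, h23.symm])
  rw [Finset.sdiff_empty]
  linarith

theorem seq_four (C : Critical F b y X W)
    {u₁ u₂ u₃ u₄ : V} (h1 : u₁ ∈ W) (h2 : u₂ ∈ W) (h3 : u₃ ∈ W) (h4 : u₄ ∈ W)
    (h12 : u₁ ≠ u₂) (h13 : u₁ ≠ u₃) (h23 : u₂ ≠ u₃) (h14 : u₁ ≠ u₄) (h24 : u₂ ≠ u₄)
    (h34 : u₃ ≠ u₄) :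
    b W ≤ b (rest F W u₁ \ ∅) + b (rest F W u₂ \ {u₁}) + b (rest F W u₃ \ {u₂, u₁}) +
      b (rest F W u₄ \ {u₃, u₂, u₁}) + b (W \ {u₄, u₃, u₂, u₁}) := by
  have s1 := C.seq_three h1 h2 h3 h12 h13 h23
  have s2 := C.branching.step (S := {u₃, u₂, u₁}) h4 (by simp [h14.symm, h24.symm, h34.symm])
  linarith

theorem seq_five (C : Critical F b y X W)
    {u₁ u₂ u₃ u₄ u₅ : V} (h1 : u₁ ∈ W) (h2 : u₂ ∈ W) (h3 : u₃ ∈ W) (h4 : u₄ ∈ W)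
    (h5 : u₅ ∈ W) (h12 : u₁ ≠ u₂) (h13 : u₁ ≠ u₃) (h23 : u₂ ≠ u₃) (h14 : u₁ ≠ u₄)
    (h24 : u₂ ≠ u₄) (h34 : u₃ ≠ u₄) (h15 : u₁ ≠ u₅) (h25 : u₂ ≠ u₅) (h35 : u₃ ≠ u₅)
    (h45 : u₄ ≠ u₅) :
    b W ≤ b (rest F W u₁ \ ∅) + b (rest F W u₂ \ {u₁}) + b (rest F W u₃ \ {u₂, u₁}) +
      b (rest F W u₄ \ {u₃, u₂, u₁}) + b (rest F W u₅ \ {u₄, u₃, u₂, u₁}) +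
      b (W \ {u₅, u₄, u₃, u₂, u₁}) := by
  have s1 := C.seq_four h1 h2 h3 h4 h12 h13 h23 h14 h24 h34
  have s2 := C.branching.step (S := {u₄, u₃, u₂, u₁}) h5
    (by simp [h15.symm, h25.symm, h35.symm, h45.symm])
  linarith

/-- A sequence of deletions may stop one neighbour early: `v` is then a leaf or isolated, which is
worth two vertices beyond those of `S`. -/
theorem leaf_left (C : Critical F b y X W)
    {S : Finset V} {v w : V} (hSW : S ⊆ W) (hv : v ∈ W) (hvS : v ∉ S)
    (hS : ∀ z ∈ W, F.Adj v z → z = w ∨ z ∈ S) : b (W \ S) ≤ y ^ (S.card + 2) * X := by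
  refine C.branching.le_of_nbrs_card_le_one C.bound C.pos C.X_pos (z := v) Finset.sdiff_subset
    (Finset.mem_sdiff.2 ⟨hv, hvS⟩) ?_ ?_
  · refine Finset.card_le_one.2 fun p hp q hq => ?_
    rw [mem_nbrs, Finset.mem_sdiff] at hp hq
    have h1 := (hS p hp.1.1 hp.2).resolve_right hp.1.2
    have h2 := (hS q hq.1.1 hq.2).resolve_right hq.1.2
    rw [h1, h2]
  · rw [Finset.card_sdiff_add_card_eq_card hSW]

/-! ### Minimum degree three -/

/-- The ends of the path `u₁ u₂ u₃` are deleted, after which `v` is a leaf. If one end has degree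
three, it has lost `v` and `u₂` in the term of the other end and is a leaf there; if both have
degree four, the degrees give the gain. Either way the cost is `y ^ 4 + y ^ 5 + y ^ 6 < 1`. -/
theorem three_path (C : Critical F b y X W)
    (hmin : ∀ u ∈ W, 3 ≤ (nbrs F W u).card) {v u₁ u₂ u₃ : V} (hv : v ∈ W)
    (h1 : u₁ ∈ nbrs F W v) (h2 : u₂ ∈ nbrs F W v) (h3 : u₃ ∈ nbrs F W v)
    (hN : ∀ w ∈ W, F.Adj v w → w = u₁ ∨ w = u₂ ∨ w = u₃) (a12 : F.Adj u₁ u₂) (a23 : F.Adj u₂ u₃)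
    (f13 : u₁ ∈ rest F W u₃) : False := by
  rw [mem_nbrs] at h1 h2 h3
  obtain ⟨p4, p5, p6, -⟩ := C.pows
  obtain ⟨y1, y2, y3, y4⟩ := C.bounds
  have f31 := mem_rest_comm h3.1 f13
  have n13 : u₁ ≠ u₃ := (mem_rest.1 f13).2.1
  -- if one end of the path has degree three
  have key : ∀ u₁ u₃ : V, u₁ ∈ W → u₃ ∈ W → F.Adj v u₁ → F.Adj v u₃ →
      (∀ w ∈ W, F.Adj v w → w = u₁ ∨ w = u₂ ∨ w = u₃) → F.Adj u₁ u₂ → F.Adj u₂ u₃ →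
      u₁ ∈ rest F W u₃ → (nbrs F W u₁).card ≤ 3 → False := by
    intro u₁ u₃ h1 h3 av1 av3 hN a12 a23 f13 hd
    have f31 := mem_rest_comm h3 f13
    have n13 : u₁ ≠ u₃ := (mem_rest.1 f13).2.1
    have s1 := C.branching.first_step h3
    have s2 := C.branching.step (S := {u₃}) h1 (by simp [n13])
    have c1 := card_rest (F := F) h3
    have m3 := hmin u₃ h3
    have t1 := C.cost_leaf h3 (S := ∅) (k := 4) (by rw [Finset.sdiff_empty]; omega) f13 (by simp)
      {v, u₂} (by
        intro z; simp only [Finset.mem_insert, Finset.mem_singleton, mem_nbrs]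
        rintro (rfl | rfl)
        · exact ⟨hv, av1.symm⟩
        · exact ⟨h2.1, a12⟩) (by
        intro z; simp only [Finset.mem_insert, Finset.mem_singleton]
        rintro (rfl | rfl)
        · exact Or.inr (Or.inl av3.symm)
        · exact Or.inr (Or.inl a23.symm)) (by rw [Finset.card_pair h2.2.ne]; omega)
    have t2 := C.cost_one h1 (S := {u₃}) 3 (hmin u₁ h1) (by simp) f31
    have t3 := C.leaf_left (S := {u₁, u₃}) (v := v) (w := u₂) (by
        intro z; simp only [Finset.mem_insert, Finset.mem_singleton]
        rintro (rfl | rfl) <;> assumption) hv (by simp [av1.ne, av3.ne]) (by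
        intro z hz hvz
        have := hN z hz hvz
        simp only [Finset.mem_insert, Finset.mem_singleton]
        tauto)
    rw [Finset.card_pair n13] at t3
    rw [Finset.sdiff_empty] at t1
    norm_num at t1 t2 t3
    exact C.contra (c := y ^ 6 + y ^ 5 + y ^ 4) (by linarith) (by rw [p4, p5, p6]; linarith)
  by_cases hd1 : (nbrs F W u₁).card ≤ 3
  · exact key u₁ u₃ h1.1 h3.1 h1.2 h3.2 hN a12 a23 f13 hd1
  by_cases hd3 : (nbrs F W u₃).card ≤ 3
  · exact key u₃ u₁ h3.1 h1.1 h3.2 h1.2 (fun w hw h => by have := hN w hw h; tauto) a23.symm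
      a12.symm f31 hd3
  have s1 := C.branching.first_step h3.1
  have s2 := C.branching.step (S := {u₃}) h1.1 (by simp [n13])
  have t1 := C.cost_zero h3.1 (S := ∅) 4 (by omega)
  have t2 := C.cost_one h1.1 (S := {u₃}) 4 (by omega) (by simp) f31
  have t3 := C.leaf_left (S := {u₁, u₃}) (v := v) (w := u₂) (by
      intro z; simp only [Finset.mem_insert, Finset.mem_singleton]
      rintro (rfl | rfl)
      exacts [h1.1, h3.1]) hv (by simp [h1.2.ne, h3.2.ne]) (by
      intro z hz hvz
      have := hN z hz hvz
      simp only [Finset.mem_insert, Finset.mem_singleton]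
      tauto)
  rw [Finset.card_pair n13] at t3
  rw [Finset.sdiff_empty] at t1
  norm_num at t1 t2 t3
  exact C.contra (c := y ^ 5 + y ^ 6 + y ^ 4) (by linarith) (by rw [p4, p5, p6]; linarith)

/-- The isolated vertex `u₃` is deleted first, then the ends of the edge `u₁ u₂`. If `u₁` has degree
three, it keeps at most two neighbours in the term of `u₃`, and either this gives a gain or there is
an isolated triangle, which leads back to `three_path` at `u₁`. -/
theorem three_edge (C : Critical F b y X W)
    (hmin : ∀ u ∈ W, 3 ≤ (nbrs F W u).card) {v u₁ u₂ u₃ : V} (hv : v ∈ W)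
    (h1 : u₁ ∈ nbrs F W v) (h2 : u₂ ∈ nbrs F W v) (h3 : u₃ ∈ nbrs F W v)
    (hN : ∀ w ∈ W, F.Adj v w → w = u₁ ∨ w = u₂ ∨ w = u₃) (a12 : F.Adj u₁ u₂)
    (f13 : u₁ ∈ rest F W u₃) (f23 : u₂ ∈ rest F W u₃) : False := by
  rw [mem_nbrs] at h1 h2 h3
  obtain ⟨p4, p5, p6, p7, p8, -⟩ := C.pows
  obtain ⟨y1, y2, y3, y4⟩ := C.bounds
  have f31 := mem_rest_comm h3.1 f13
  have f32 := mem_rest_comm h3.1 f23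
  have n13 : u₁ ≠ u₃ := (mem_rest.1 f13).2.1
  have n23 : u₂ ≠ u₃ := (mem_rest.1 f23).2.1
  have s := C.seq_three h3.1 h1.1 h2.1 n13.symm n23.symm a12.ne
  have s0 := C.branching.sdiff_nonpos (S := {u₂, u₁, u₃}) hv
    (by simp [h1.2.ne, h2.2.ne, h3.2.ne]) (by
      intro z hz
      rw [mem_nbrs] at hz
      have := hN z hz.1 hz.2
      simp only [Finset.mem_insert, Finset.mem_singleton]
      tauto)
  have t3 := C.cost_one h2.1 (S := {u₁, u₃}) 3 (hmin _ h2.1) (a := u₃) (by simp) f32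
  by_cases hd : (nbrs F W u₁).card ≤ 3
  · have c1 := card_rest (F := F) h3.1
    have m3 := hmin u₃ h3.1
    have t2 := C.cost_one h1.1 (S := {u₃}) 3 (hmin _ h1.1) (by simp) f31
    rcases C.cost_deg_two h3.1 (S := ∅) (k := 4) (by rw [Finset.sdiff_empty]; omega) f13 (by simp)
      {v} (by simpa using ⟨hv, h1.2.symm⟩) (by
        intro z; simp only [Finset.mem_singleton]
        rintro rfl
        exact Or.inr (Or.inl h3.2.symm)) (by simpa using hd) with t1 | ⟨p, q, t⟩
    · norm_num at t1 t2 t3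
      exact C.contra (c := y ^ 7 + y ^ 8 + y ^ 5 + y ^ 5) (by rw [Finset.sdiff_empty] at s; linarith)
        (by rw [p7, p8, p5]; linarith)
    -- The triangle contains `u₁`, `u₂` and a third vertex `r`, so the neighbourhood of `u₁` is the
    -- path `v u₂ r`.
    · have h12 : u₂ = p ∨ u₂ = q := t.nbrs_self u₂ (by simpa using f23) a12
      obtain ⟨r, hr, hrW, hr2, hrv⟩ : ∃ r, F.Adj u₁ r ∧ r ∈ W ∧ F.Adj u₂ r ∧ r ∈ rest F W v := by
        have l : ∀ r ∈ rest F W u₃ \ ∅, F.Adj u₁ r → F.Adj u₂ r → r ∈ rest F W v := by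
          intro r hr hr1 hr2
          rw [Finset.sdiff_empty, mem_rest] at hr
          refine mem_rest.2 ⟨hr.1, ?_, fun hvr => ?_⟩
          · rintro rfl
            exact hr.2.2 h3.2.symm
          · rcases hN r hr.1 hvr with rfl | rfl | rfl
            exacts [F.loopless.irrefl _ hr1, F.loopless.irrefl _ hr2, hr.2.1 rfl]
        have lW : ∀ r ∈ rest F W u₃ \ ∅, r ∈ W := fun r hr =>
          (mem_rest.1 (Finset.mem_sdiff.1 hr).1).1
        rcases h12 with rfl | rfl
        · exact ⟨q, t.adj_right, lW q t.right_mem, t.adj, l q t.right_mem t.adj_right t.adj⟩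
        · exact ⟨p, t.adj_left, lW p t.left_mem, t.adj.symm,
            l p t.left_mem t.adj_left t.adj.symm⟩
      have hrv' := mem_rest.1 hrv
      refine C.three_path hmin (v := u₁) (u₁ := v) (u₂ := u₂) (u₃ := r) h1.1
        (mem_nbrs.2 ⟨hv, h1.2.symm⟩) (mem_nbrs.2 ⟨h2.1, a12⟩) (mem_nbrs.2 ⟨hrW, hr⟩) ?_ h2.2 hr2
        (mem_rest_comm hv hrv)
      intro w hw hw1
      have := eq_of_two_outside (F := F) (A := {v}) (u := u₁) (p := u₂) (q := r) (r := w)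
        (by simpa using ⟨hv, h1.2.symm⟩) (by simpa using hd) (mem_nbrs.2 ⟨h2.1, a12⟩)
        (mem_nbrs.2 ⟨hrW, hr⟩) hr2.ne (by simp [h2.2.ne']) (by simp [hrv'.2.1])
        (mem_nbrs.2 ⟨hw, hw1⟩)
      by_cases hwv : w = v
      · exact Or.inl hwv
      · exact Or.inr (this (by simp [hwv]))
  · have t1 := C.cost_zero h3.1 (S := ∅) 3 (hmin _ h3.1)
    have t2 := C.cost_one h1.1 (S := {u₃}) 4 (by omega) (by simp) f31
    norm_num at t1 t2 t3
    exact C.contra (c := y ^ 4 + y ^ 6 + y ^ 5) (by rw [Finset.sdiff_empty] at s; linarith)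
      (by rw [p4, p5, p6]; linarith)

theorem three_indep (C : Critical F b y X W)
    (hmin : ∀ u ∈ W, 3 ≤ (nbrs F W u).card) {v u₁ u₂ u₃ : V} (hv : v ∈ W)
    (h1 : u₁ ∈ nbrs F W v) (h2 : u₂ ∈ nbrs F W v) (h3 : u₃ ∈ nbrs F W v)
    (hN : ∀ w ∈ W, F.Adj v w → w = u₁ ∨ w = u₂ ∨ w = u₃)
    (f12 : u₁ ∈ rest F W u₂) (f13 : u₁ ∈ rest F W u₃) (f23 : u₂ ∈ rest F W u₃) : False := by
  rw [mem_nbrs] at h1 h2 h3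
  obtain ⟨p4, p5, p6, -⟩ := C.pows
  obtain ⟨y1, y2, y3, y4⟩ := C.bounds
  have n12 : u₁ ≠ u₂ := (mem_rest.1 f12).2.1
  have n13 : u₁ ≠ u₃ := (mem_rest.1 f13).2.1
  have n23 : u₂ ≠ u₃ := (mem_rest.1 f23).2.1
  have s := C.seq_three h1.1 h2.1 h3.1 n12 n13 n23
  have s0 := C.branching.sdiff_nonpos (S := {u₃, u₂, u₁}) hv
    (by simp [h1.2.ne, h2.2.ne, h3.2.ne]) (by
      intro z hz
      rw [mem_nbrs] at hz
      have := hN z hz.1 hz.2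
      simp only [Finset.mem_insert, Finset.mem_singleton]
      tauto)
  have t1 := C.cost_zero h1.1 (S := ∅) 3 (hmin _ h1.1)
  have t2 := C.cost_one h2.1 (S := {u₁}) 3 (hmin _ h2.1) (by simp) f12
  have t3 := C.cost_two h3.1 (S := {u₂, u₁}) 3 (hmin _ h3.1) n12 (by simp) (by simp) f13 f23
  norm_num at t1 t2 t3
  exact C.contra (c := y ^ 4 + y ^ 5 + y ^ 6) (by rw [Finset.sdiff_empty] at s; linarith)
    (by rw [p4, p5, p6]; linarith)

/-- Without four-cliques the neighbourhood is triangle-free, hence on three vertices a path, a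
single edge, or edgeless. -/
theorem card_nbrs_ne_three (C : Critical F b y X W)
    (hmin : ∀ u ∈ W, 3 ≤ (nbrs F W u).card) {v : V} (hv : v ∈ W) :
    (nbrs F W v).card ≠ 3 := by
  intro hd
  obtain ⟨a, ha⟩ : (nbrs F W v).Nonempty := Finset.card_pos.1 (by omega)
  obtain ⟨c, d, hac, had, hcd, heq⟩ := exists_eq_of_card_three hd ha
  have hc : c ∈ nbrs F W v := by rw [heq]; simp
  have hd' : d ∈ nbrs F W v := by rw [heq]; simp
  have hN : ∀ w ∈ W, F.Adj v w → w = a ∨ w = c ∨ w = d := fun w hw h => by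
    have : w ∈ nbrs F W v := mem_nbrs.2 ⟨hw, h⟩
    rw [heq] at this
    simpa using this
  obtain ⟨aW, va⟩ := mem_nbrs.1 ha
  obtain ⟨cW, vc⟩ := mem_nbrs.1 hc
  obtain ⟨dW, vd⟩ := mem_nbrs.1 hd'
  have far : ∀ p q, p ∈ W → p ≠ q → ¬ F.Adj p q → p ∈ rest F W q := fun p q hp hpq h =>
    mem_rest.2 ⟨hp, hpq, fun h' => h h'.symm⟩
  have K4 := C.no_four v hv a aW c cW d dW va vc vd
  have hN2 : ∀ w ∈ W, F.Adj v w → w = a ∨ w = d ∨ w = c := fun w hw h => by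
    have := hN w hw h; tauto
  have hN3 : ∀ w ∈ W, F.Adj v w → w = c ∨ w = a ∨ w = d := fun w hw h => by
    have := hN w hw h; tauto
  have hN4 : ∀ w ∈ W, F.Adj v w → w = c ∨ w = d ∨ w = a := fun w hw h => by
    have := hN w hw h; tauto
  by_cases h1 : F.Adj a c <;> by_cases h2 : F.Adj a d <;> by_cases h3 : F.Adj c d
  · exact K4 h1 h2 h3
  · exact C.three_path hmin hv hc ha hd' hN3 h1.symm h2 (far c d cW hcd h3)
  · exact C.three_path hmin hv ha hc hd' hN h1 h3 (far a d aW had h2)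
  · exact C.three_edge hmin hv ha hc hd' hN h1 (far a d aW had h2) (far c d cW hcd h3)
  · exact C.three_path hmin hv ha hd' hc hN2 h2 h3.symm (far a c aW hac h1)
  · exact C.three_edge hmin hv ha hd' hc hN2 h2 (far a c aW hac h1)
      (far d c dW hcd.symm fun h => h3 h.symm)
  · exact C.three_edge hmin hv hc hd' ha hN4 h3 (far c a cW hac.symm fun h => h1 h.symm)
      (far d a dW had.symm fun h => h2 h.symm)
  · exact C.three_indep hmin hv ha hc hd' hN (far a c aW hac h1) (far a d aW had h2)
      (far c d cW hcd h3)

end Critical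

end Critical

/-! ### Isolated triangles, and most neighbourhoods of size four -/

section Critical

variable {V : Type*} [DecidableEq V] {F : SimpleGraph V} [DecidableRel F.Adj]

namespace Critical

variable {b : Finset V → ℝ} {y X : ℝ} {W : Finset V}

/-- Two adjacent pairs `p, q` and `w, w'` such that every vertex not adjacent to `c` is adjacent
to both vertices of the other pair. -/
theorem false_of_two_edges (C : Critical F b y X W)
    {c p q w w' : V} (hp : p ∈ W) (hq : q ∈ W) (hw : w ∈ W) (hw' : w' ∈ W)
    (hpq : F.Adj p q) (hww : F.Adj w w') (h1 : ¬ F.Adj p c → F.Adj p w ∧ F.Adj p w')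
    (h2 : ¬ F.Adj q c → F.Adj q w ∧ F.Adj q w') (h3 : ¬ F.Adj w c → F.Adj w p ∧ F.Adj w q)
    (h4 : ¬ F.Adj w' c → F.Adj w' p ∧ F.Adj w' q)
    (h : (F.Adj p c ∨ F.Adj q c) → (F.Adj w c ∨ F.Adj w' c) → False) : False := by
  by_cases hc : F.Adj w c ∨ F.Adj w' c
  · have hp' := h1 fun h' => h (Or.inl h') hc
    have hq' := h2 fun h' => h (Or.inr h') hc
    exact C.no_four p hp q hq w hw w' hw' hpq hp'.1 hp'.2 hq'.1 hq'.2 hww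
  · have hw1 := h3 fun h' => hc (Or.inl h')
    have hw2 := h4 fun h' => hc (Or.inr h')
    exact C.no_four p hp q hq w hw w' hw' hpq hw1.1.symm hw2.1.symm hw1.2.symm hw2.2.symm hww

/-- Two nonadjacent vertices `a₁, a₂` cannot both lie in a triangle that is isolated after removing
the closed neighbourhood of the other one, if their common neighbours are `c` and the vertices
of `E`, where the neighbour `v` of degree `|E| + 3` or so is not adjacent to the triangles. -/
theorem not_two_triangles (C : Critical F b y X W)
    {E : Finset V} {a₁ a₂ v c p q w w' : V} (h1 : a₁ ∈ W) (h2 : a₂ ∈ W)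
    (hmin : ∀ u ∈ W, E.card + 4 ≤ (nbrs F W u).card)
    (hN1 : ∀ r ∈ W, F.Adj a₁ r → r = v ∨ r = c ∨ r ∈ E ∨ r = w ∨ r = w')
    (hN2 : ∀ r ∈ W, F.Adj a₂ r → r = v ∨ r = c ∨ r ∈ E ∨ r = p ∨ r = q)
    (t1 : IsolatedTriangle F (rest F W a₁ \ ∅) a₂ p q)
    (t2 : IsolatedTriangle F (rest F W a₂ \ ∅) a₁ w w')
    (hv1 : ∀ r ∈ rest F W a₁, F.Adj a₂ r → ¬ F.Adj v r)
    (hv2 : ∀ r ∈ rest F W a₂, F.Adj a₁ r → ¬ F.Adj v r)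
    (hc : ∀ r ∈ rest F W a₁, ∀ s ∈ rest F W a₂, F.Adj a₂ r → F.Adj a₁ s → F.Adj r c →
      F.Adj s c → False) : False := by
  have e1 : rest F W a₁ \ ∅ = rest F W a₁ := Finset.sdiff_empty
  have e2 : rest F W a₂ \ ∅ = rest F W a₂ := Finset.sdiff_empty
  rw [e1] at t1
  rw [e2] at t2
  -- the neighbours of a vertex in one of the triangles
  have key : ∀ a₁ a₂ p q w w', a₁ ∈ W → (∀ r ∈ W, F.Adj a₁ r → r = v ∨ r = c ∨ r ∈ E ∨ r = w ∨
      r = w') → p ∈ rest F W a₁ → F.Adj a₂ p → (∀ r ∈ rest F W a₁, F.Adj p r → r = a₂ ∨ r = q) →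
      ¬ F.Adj v p → ¬ F.Adj p c → F.Adj p w ∧ F.Adj p w' := by
    intro a₁ a₂ p q w w' h1 hN hp hap hpN hvp hpc
    have hsub : ∀ r ∈ nbrs F W p, r = a₂ ∨ r = q ∨ r ∈ E ∨ r = w ∨ r = w' := by
      intro r hr
      obtain ⟨hrW, hpr⟩ := mem_nbrs.1 hr
      by_cases hra : r ∈ rest F W a₁
      · rcases hpN r hra hpr with h | h <;> tauto
      · rw [mem_rest] at hra hp
        have hra1 : r ≠ a₁ := by
          rintro rfl
          exact hp.2.2 hpr.symm
        have har : F.Adj a₁ r := by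
          by_contra h
          exact hra ⟨hrW, hra1, h⟩
        rcases hN r hrW har with rfl | rfl | h | h | h
        · exact absurd hpr.symm hvp
        · exact absurd hpr hpc
        all_goals tauto
    -- If `p` is adjacent to neither `v` nor `c`, its only possible neighbours are `a₂`, `q`, `w`,
    -- `w'` and `E`. There are at most `E.card + 4` of these, so the degree condition forces every
    -- one of them to occur.
    have hdeg := hmin p (mem_rest.1 hp).1
    have card3 : ∀ z : V, (insert a₂ (insert q (insert z E))).card < (nbrs F W p).card := by
      intro z
      have l1 := Finset.card_insert_le z E
      have l2 := Finset.card_insert_le q (insert z E)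
      have l3 := Finset.card_insert_le a₂ (insert q (insert z E))
      omega
    constructor
    · refine adj_of_nbrs_subset (S := insert a₂ (insert q (insert w' E))) (fun r hr => ?_)
        (card3 w')
      have := hsub r hr
      simp only [Finset.mem_insert]
      tauto
    · refine adj_of_nbrs_subset (S := insert a₂ (insert q (insert w E))) (fun r hr => ?_)
        (card3 w)
      have := hsub r hr
      simp only [Finset.mem_insert]
      tauto
  refine C.false_of_two_edges (c := c) (mem_rest.1 t1.left_mem).1 (mem_rest.1 t1.right_mem).1
    (mem_rest.1 t2.left_mem).1 (mem_rest.1 t2.right_mem).1 t1.adj t2.adj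
    (key a₁ a₂ p q w w' h1 hN1 t1.left_mem t1.adj_left t1.nbrs_left
      (hv1 p t1.left_mem t1.adj_left))
    (key a₁ a₂ q p w w' h1 hN1 t1.right_mem t1.adj_right t1.nbrs_right
      (hv1 q t1.right_mem t1.adj_right))
    (key a₂ a₁ w w' p q h2 hN2 t2.left_mem t2.adj_left t2.nbrs_left
      (hv2 w t2.left_mem t2.adj_left))
    (key a₂ a₁ w' w p q h2 hN2 t2.right_mem t2.adj_right t2.nbrs_right
      (hv2 w' t2.right_mem t2.adj_right)) ?_
  rintro (h | h) (h' | h')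
  · exact hc p t1.left_mem w t2.left_mem t1.adj_left t2.adj_left h h'
  · exact hc p t1.left_mem w' t2.right_mem t1.adj_left t2.adj_right h h'
  · exact hc q t1.right_mem w t2.left_mem t1.adj_right t2.adj_left h h'
  · exact hc q t1.right_mem w' t2.right_mem t1.adj_right t2.adj_right h h'

/-! ### Minimum degree four -/

/-- A pair of nonadjacent vertices with three common neighbours is cheap to delete. -/
theorem pair_step (C : Critical F b y X W)
    (hmin : ∀ u ∈ W, 4 ≤ (nbrs F W u).card) {S : Finset V} {a a' v c c' : V}
    (ha : a ∈ W) (ha' : a' ∈ W) (f : a ∈ rest F W a') (haS : a ∉ S) (haS' : a' ∉ S)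
    (hv : v ∈ W) (hc : c ∈ W) (hc' : c' ∈ W) (vc : v ≠ c) (vc' : v ≠ c') (cc' : c ≠ c')
    (av : F.Adj a v) (ac : F.Adj a c) (ac' : F.Adj a c') (av' : F.Adj a' v) (ac'' : F.Adj a' c)
    (ac''' : F.Adj a' c') :
    b (W \ S) ≤ (y ^ 6 + y ^ 7) * X + b (W \ insert a (insert a' S)) := by
  -- If `a` has degree four, it has lost its three common neighbours in the term of `a'` and is a
  -- leaf there: cost `y ^ 7`, then `y ^ 6` for `a`.
  have key : ∀ a a', a ∈ W → a' ∈ W → a ∈ rest F W a' → a ∉ S → a' ∉ S → F.Adj a v → F.Adj a c →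
      F.Adj a c' → F.Adj a' v → F.Adj a' c → F.Adj a' c' → (nbrs F W a).card ≤ 4 →
      b (W \ S) ≤ (y ^ 6 + y ^ 7) * X + b (W \ insert a (insert a' S)) := by
    intro a a' ha ha' f haS haS' av ac ac' av' ac'' ac''' hd
    have f' := mem_rest_comm ha' f
    have n : a ≠ a' := (mem_rest.1 f).2.1
    have s1 := C.branching.step ha' haS'
    have s2 := C.branching.step (S := insert a' S) ha (by simp [n, haS])
    have c1 := card_rest (F := F) ha'
    have c2 : (rest F W a' \ S).card ≤ (rest F W a').card :=
      Finset.card_le_card Finset.sdiff_subset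
    have m := hmin a' ha'
    have t1 := C.cost_leaf ha' (S := S) (k := 5) (by omega) f haS {v, c, c'} (by
        intro z; simp only [Finset.mem_insert, Finset.mem_singleton, mem_nbrs]
        rintro (rfl | rfl | rfl)
        exacts [⟨hv, av⟩, ⟨hc, ac⟩, ⟨hc', ac'⟩]) (by
        intro z; simp only [Finset.mem_insert, Finset.mem_singleton]
        rintro (rfl | rfl | rfl) <;> tauto) (by
        rw [Finset.card_insert_of_notMem (by simp [vc, vc']), Finset.card_pair cc']
        omega)
    have t2 := C.cost_one ha (S := insert a' S) 4 (hmin a ha) (by simp) f'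
    norm_num at t1 t2
    linarith
  have f' := mem_rest_comm ha' f
  have n : a ≠ a' := (mem_rest.1 f).2.1
  by_cases hd : (nbrs F W a).card ≤ 4
  · exact key a a' ha ha' f haS haS' av ac ac' av' ac'' ac''' hd
  by_cases hd' : (nbrs F W a').card ≤ 4
  · have := key a' a ha' ha f' haS' haS av' ac'' ac''' av ac ac' hd'
    rwa [Finset.insert_comm] at this
  -- Both degrees are at least five, which gives `y ^ 6` for `a'` and `y ^ 7` for `a`.
  have s1 := C.branching.step ha' haS'
  have s2 := C.branching.step (S := insert a' S) ha (by simp [n, haS])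
  have t1 := C.cost_zero ha' (S := S) 5 (by omega)
  have t2 := C.cost_one ha (S := insert a' S) 5 (by omega) (by simp) f'
  norm_num at t1 t2
  linarith

/-- Each pair of opposite vertices of the cycle has three common neighbours, namely `v` and the
other pair, so `pair_step` applies twice; `2 * (y ^ 6 + y ^ 7) < 1`. -/
theorem four_cycle (C : Critical F b y X W)
    (hmin : ∀ u ∈ W, 4 ≤ (nbrs F W u).card) {v u₁ u₂ u₃ u₄ : V} (hv : v ∈ W)
    (h1 : u₁ ∈ nbrs F W v) (h2 : u₂ ∈ nbrs F W v) (h3 : u₃ ∈ nbrs F W v) (h4 : u₄ ∈ nbrs F W v)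
    (hN : ∀ w ∈ W, F.Adj v w → w = u₁ ∨ w = u₂ ∨ w = u₃ ∨ w = u₄) (a12 : F.Adj u₁ u₂)
    (a23 : F.Adj u₂ u₃) (a34 : F.Adj u₃ u₄) (a41 : F.Adj u₄ u₁) (f13 : u₁ ∈ rest F W u₃)
    (f24 : u₂ ∈ rest F W u₄) : False := by
  rw [mem_nbrs] at h1 h2 h3 h4
  obtain ⟨-, -, p6, p7, -⟩ := C.pows
  obtain ⟨y1, y2, y3, y4⟩ := C.bounds
  have n13 : u₁ ≠ u₃ := (mem_rest.1 f13).2.1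
  have n24 : u₂ ≠ u₄ := (mem_rest.1 f24).2.1
  have s1 := C.pair_step hmin (S := ∅) h1.1 h3.1 f13 (by simp) (by simp) hv h2.1 h4.1 h2.2.ne
    h4.2.ne n24 h1.2.symm a12 a41.symm h3.2.symm a23.symm a34
  have s2 := C.pair_step hmin (S := insert u₁ (insert u₃ ∅)) h2.1 h4.1 f24
    (by simp [a12.ne', a23.ne]) (by simp [a41.ne, a34.ne']) hv h1.1 h3.1 h1.2.ne
    h3.2.ne n13 h2.2.symm a12.symm a23 h4.2.symm a41 a34.symm
  have s3 := C.branching.sdiff_nonpos (S := insert u₂ (insert u₄ (insert u₁ (insert u₃ ∅)))) hv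
    (by simp [h1.2.ne, h2.2.ne, h3.2.ne, h4.2.ne]) (by
      intro z hz
      rw [mem_nbrs] at hz
      have := hN z hz.1 hz.2
      simp only [Finset.mem_insert]
      tauto)
  rw [Finset.sdiff_empty] at s1
  exact C.contra (c := 2 * (y ^ 6 + y ^ 7)) (by linarith) (by rw [p6, p7]; linarith)

/-- If the inner vertex `u₂` has degree four, deleting `u₁` and then `u₄` makes it a leaf in the
term of `u₄`. If it has degree five, deleting it first gives four costs of `y ^ 6`, and `4 * y ^ 6 =
1` still suffices. -/
theorem four_path (C : Critical F b y X W)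
    (hmin : ∀ u ∈ W, 4 ≤ (nbrs F W u).card) {v u₁ u₂ u₃ u₄ : V} (hv : v ∈ W)
    (h1 : u₁ ∈ nbrs F W v) (h2 : u₂ ∈ nbrs F W v) (h3 : u₃ ∈ nbrs F W v) (h4 : u₄ ∈ nbrs F W v)
    (hN : ∀ w ∈ W, F.Adj v w → w = u₁ ∨ w = u₂ ∨ w = u₃ ∨ w = u₄) (a12 : F.Adj u₁ u₂)
    (a23 : F.Adj u₂ u₃) (a34 : F.Adj u₃ u₄) (f13 : u₁ ∈ rest F W u₃) (f14 : u₁ ∈ rest F W u₄)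
    (f24 : u₂ ∈ rest F W u₄) : False := by
  rw [mem_nbrs] at h1 h2 h3 h4
  obtain ⟨-, p5, p6, -, p8, -⟩ := C.pows
  obtain ⟨y1, y2, y3, y4⟩ := C.bounds
  have n13 : u₁ ≠ u₃ := (mem_rest.1 f13).2.1
  have n14 : u₁ ≠ u₄ := (mem_rest.1 f14).2.1
  have n24 : u₂ ≠ u₄ := (mem_rest.1 f24).2.1
  have f31 := mem_rest_comm h3.1 f13
  have f41 := mem_rest_comm h4.1 f14
  have f42 := mem_rest_comm h4.1 f24
  have m1 := hmin _ h1.1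
  have m2 := hmin _ h2.1
  have m3 := hmin _ h3.1
  have m4 := hmin _ h4.1
  by_cases hd : (nbrs F W u₂).card ≤ 4
  · have s := C.seq_four h1.1 h4.1 h3.1 h2.1 n14 n13 a34.ne' a12.ne n24.symm a23.ne'
    have s0 := C.branching.sdiff_nonpos (S := {u₂, u₃, u₄, u₁}) hv
      (by simp [h1.2.ne, h2.2.ne, h3.2.ne, h4.2.ne]) (by
        intro z hz
        rw [mem_nbrs] at hz
        have := hN z hz.1 hz.2
        simp only [Finset.mem_insert, Finset.mem_singleton]
        tauto)
    have c2 := card_rest_sdiff_add_le (F := F) (R := {u₁}) (S := {u₁}) h4.1 le_rfl (by simpa using f14)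
    rw [Finset.card_singleton] at c2
    have t1 := C.cost_zero h1.1 (S := ∅) 4 m1
    have t2 := C.cost_leaf h4.1 (S := {u₁}) (k := 6) (by omega) f24 (by simp [a12.ne'])
      {v, u₁, u₃} (by
        intro z; simp only [Finset.mem_insert, Finset.mem_singleton, mem_nbrs]
        rintro (rfl | rfl | rfl)
        exacts [⟨hv, h2.2.symm⟩, ⟨h1.1, a12.symm⟩, ⟨h3.1, a23⟩]) (by
        intro z; simp only [Finset.mem_insert, Finset.mem_singleton]
        rintro (rfl | rfl | rfl)
        · exact Or.inr (Or.inl h4.2.symm)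
        · simp
        · exact Or.inr (Or.inl a34.symm)) (by
        rw [Finset.card_insert_of_notMem (by simp [h1.2.ne, h3.2.ne]), Finset.card_pair n13]
        omega)
    have t3 := C.cost_one h3.1 (S := {u₄, u₁}) 4 m3 (by simp) f13
    have t4 := C.cost_one h2.1 (S := {u₃, u₄, u₁}) 4 m2 (by simp) f42
    norm_num at t1 t2 t3 t4
    exact C.contra (c := y ^ 5 + y ^ 8 + y ^ 6 + y ^ 6) (by rw [Finset.sdiff_empty] at s; linarith)
      (by rw [p5, p6, p8]; linarith)
  · have s := C.seq_four h2.1 h4.1 h1.1 h3.1 n24 a12.ne' n14.symm a23.ne a34.ne' n13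
    have s0 := C.branching.sdiff_nonpos (S := {u₃, u₁, u₄, u₂}) hv
      (by simp [h1.2.ne, h2.2.ne, h3.2.ne, h4.2.ne]) (by
        intro z hz
        rw [mem_nbrs] at hz
        have := hN z hz.1 hz.2
        simp only [Finset.mem_insert, Finset.mem_singleton]
        tauto)
    have t1 := C.cost_zero h2.1 (S := ∅) 5 (by omega)
    have t2 := C.cost_one h4.1 (S := {u₂}) 4 m4 (by simp) f24
    have t3 := C.cost_one h1.1 (S := {u₄, u₂}) 4 m1 (by simp) f41
    have t4 := C.cost_one h3.1 (S := {u₁, u₄, u₂}) 4 m3 (by simp) f13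
    norm_num at t1 t2 t3 t4
    exact C.contra (c := y ^ 6 + y ^ 6 + y ^ 6 + y ^ 6)
      (by rw [Finset.sdiff_empty] at s; linarith) (by rw [p6]; norm_num)

/-- At least two of the neighbours are isolated in the neighbourhood. -/
theorem four_sparse (C : Critical F b y X W)
    (hmin : ∀ u ∈ W, 4 ≤ (nbrs F W u).card) {v u₁ u₂ u₃ u₄ : V} (hv : v ∈ W)
    (h1 : u₁ ∈ nbrs F W v) (h2 : u₂ ∈ nbrs F W v) (h3 : u₃ ∈ nbrs F W v) (h4 : u₄ ∈ nbrs F W v)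
    (hN : ∀ w ∈ W, F.Adj v w → w = u₁ ∨ w = u₂ ∨ w = u₃ ∨ w = u₄) (n12 : u₁ ≠ u₂)
    (f13 : u₁ ∈ rest F W u₃) (f14 : u₁ ∈ rest F W u₄) (f23 : u₂ ∈ rest F W u₃)
    (f24 : u₂ ∈ rest F W u₄) (f34 : u₃ ∈ rest F W u₄) : False := by
  rw [mem_nbrs] at h1 h2 h3 h4
  obtain ⟨-, p5, p6, p7, -⟩ := C.pows
  obtain ⟨y1, y2, y3, y4⟩ := C.bounds
  have n13 : u₁ ≠ u₃ := (mem_rest.1 f13).2.1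
  have n14 : u₁ ≠ u₄ := (mem_rest.1 f14).2.1
  have n23 : u₂ ≠ u₃ := (mem_rest.1 f23).2.1
  have n24 : u₂ ≠ u₄ := (mem_rest.1 f24).2.1
  have n34 : u₃ ≠ u₄ := (mem_rest.1 f34).2.1
  -- With `u₃` and `u₄` deleted first, each of `u₁` and `u₂` gains two vertices, whether or not they
  -- are adjacent.
  have s := C.seq_four h3.1 h4.1 h1.1 h2.1 n34 n13.symm n14.symm n23.symm n24.symm n12
  have s0 := C.branching.sdiff_nonpos (S := {u₂, u₁, u₄, u₃}) hv
    (by simp [h1.2.ne, h2.2.ne, h3.2.ne, h4.2.ne]) (by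
      intro z hz
      rw [mem_nbrs] at hz
      have := hN z hz.1 hz.2
      simp only [Finset.mem_insert, Finset.mem_singleton]
      tauto)
  have t1 := C.cost_zero h3.1 (S := ∅) 4 (hmin _ h3.1)
  have t2 := C.cost_one h4.1 (S := {u₃}) 4 (hmin _ h4.1) (by simp) f34
  have t3 := C.cost_two h1.1 (S := {u₄, u₃}) 4 (hmin _ h1.1) n34 (by simp) (by simp)
    (mem_rest_comm h3.1 f13) (mem_rest_comm h4.1 f14)
  have t4 := C.cost_two h2.1 (S := {u₁, u₄, u₃}) 4 (hmin _ h2.1) n34 (by simp) (by simp)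
    (mem_rest_comm h3.1 f23) (mem_rest_comm h4.1 f24)
  norm_num at t1 t2 t3 t4
  exact C.contra (c := y ^ 5 + y ^ 6 + y ^ 7 + y ^ 7) (by rw [Finset.sdiff_empty] at s; linarith)
    (by rw [p5, p6, p7]; linarith)

/-- The neighbourhood consists of a path with three vertices and an isolated vertex. -/
theorem four_short_path (C : Critical F b y X W)
    (hmin : ∀ u ∈ W, 4 ≤ (nbrs F W u).card) {v u₁ u₂ u₃ u₄ : V} (hv : v ∈ W)
    (h1 : u₁ ∈ nbrs F W v) (h2 : u₂ ∈ nbrs F W v) (h3 : u₃ ∈ nbrs F W v) (h4 : u₄ ∈ nbrs F W v)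
    (hN : ∀ w ∈ W, F.Adj v w → w = u₁ ∨ w = u₂ ∨ w = u₃ ∨ w = u₄) (a12 : F.Adj u₁ u₂)
    (a23 : F.Adj u₂ u₃) (f13 : u₁ ∈ rest F W u₃) (f14 : u₁ ∈ rest F W u₄)
    (f24 : u₂ ∈ rest F W u₄) (f34 : u₃ ∈ rest F W u₄) : False := by
  rw [mem_nbrs] at h1 h2 h3 h4
  obtain ⟨-, p5, p6, p7, p8, p9, -⟩ := C.pows
  obtain ⟨y1, y2, y3, y4⟩ := C.bounds
  have m1 := hmin _ h1.1
  have m2 := hmin _ h2.1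
  have m3 := hmin _ h3.1
  have m4 := hmin _ h4.1
  have f31 := mem_rest_comm h3.1 f13
  have f42 := mem_rest_comm h4.1 f24
  have n13 : u₁ ≠ u₃ := (mem_rest.1 f13).2.1
  have n24 : u₂ ≠ u₄ := (mem_rest.1 f24).2.1
  -- If the centre of the path has degree five, starting with it costs `3 * y ^ 6 + y ^ 7`, which is
  -- small enough.
  by_cases hd2 : (nbrs F W u₂).card ≤ 4
  swap
  · have n14 : u₁ ≠ u₄ := (mem_rest.1 f14).2.1
    have n34 : u₃ ≠ u₄ := (mem_rest.1 f34).2.1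
    have s := C.seq_four h2.1 h4.1 h1.1 h3.1 n24 a12.ne' n14.symm a23.ne n34.symm n13
    have s0 := C.branching.sdiff_nonpos (S := {u₃, u₁, u₄, u₂}) hv
      (by simp [h1.2.ne, h2.2.ne, h3.2.ne, h4.2.ne]) (by
        intro z hz
        rw [mem_nbrs] at hz
        have := hN z hz.1 hz.2
        simp only [Finset.mem_insert, Finset.mem_singleton]
        tauto)
    have t1 := C.cost_zero h2.1 (S := ∅) 5 (by omega)
    have t2 := C.cost_one h4.1 (S := {u₂}) 4 m4 (by simp) f24
    have t3 := C.cost_one h1.1 (S := {u₄, u₂}) 4 m1 (by simp) (mem_rest_comm h4.1 f14)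
    have t4 := C.cost_two h3.1 (S := {u₁, u₄, u₂}) 4 m3 n14 (by simp) (by simp) f13
      (mem_rest_comm h4.1 f34)
    norm_num at t1 t2 t3 t4
    exact C.contra (c := y ^ 6 + y ^ 6 + y ^ 6 + y ^ 7)
      (by rw [Finset.sdiff_empty] at s; linarith) (by rw [p6, p7]; linarith)
  -- start at one end of the path
  have key : ∀ u₁ u₃ : V, u₁ ∈ W → u₃ ∈ W → F.Adj v u₁ → F.Adj v u₃ →
      (∀ w ∈ W, F.Adj v w → w = u₁ ∨ w = u₂ ∨ w = u₃ ∨ w = u₄) → F.Adj u₁ u₂ → F.Adj u₂ u₃ →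
      u₁ ∈ rest F W u₃ → u₁ ∈ rest F W u₄ → u₃ ∈ rest F W u₄ → ∀ T : ℝ,
      b (rest F W u₁ \ ∅) ≤ T * X → T ≤ 0.29 → False := by
    intro u₁ u₃ h1 h3 av1 av3 hN a12 a23 f13 f14 f34 T hT hT'
    have n13 : u₁ ≠ u₃ := (mem_rest.1 f13).2.1
    have n14 : u₁ ≠ u₄ := (mem_rest.1 f14).2.1
    have n34 : u₃ ≠ u₄ := (mem_rest.1 f34).2.1
    have s := C.seq_four h1 h4.1 h2.1 h3 n14 a12.ne n24.symm n13 n34.symm a23.ne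
    have s0 := C.branching.sdiff_nonpos (S := {u₃, u₂, u₄, u₁}) hv
      (by simp [av1.ne, h2.2.ne, av3.ne, h4.2.ne]) (by
        intro z hz
        rw [mem_nbrs] at hz
        have := hN z hz.1 hz.2
        simp only [Finset.mem_insert, Finset.mem_singleton]
        tauto)
    have t2 := C.cost_one h4.1 (S := {u₁}) 4 m4 (by simp) f14
    have t3 := C.cost_one h2.1 (S := {u₄, u₁}) 4 m2 (by simp) f42
    have t4 := C.cost_two h3 (S := {u₂, u₄, u₁}) 4 (hmin _ h3) n14 (by simp) (by simp) f13
      (mem_rest_comm h4.1 f34)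
    norm_num at t2 t3 t4
    -- The remaining costs `2 * y ^ 6 + y ^ 7` are about `0.699`, so any first cost up to `0.29` is
    -- enough.
    exact C.contra (c := T + y ^ 6 + y ^ 6 + y ^ 7) (by linarith) (by rw [p6, p7]; linarith)
  have hN' : ∀ w ∈ W, F.Adj v w → w = u₃ ∨ w = u₂ ∨ w = u₁ ∨ w = u₄ := fun w hw h => by
    have := hN w hw h; tauto
  by_cases hd1 : (nbrs F W u₁).card ≤ 4
  swap
  · exact key u₁ u₃ h1.1 h3.1 h1.2 h3.2 hN a12 a23 f13 f14 f34 _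
      (C.cost_zero h1.1 (S := ∅) 5 (by omega)) (by norm_num [p6])
  by_cases hd3 : (nbrs F W u₃).card ≤ 4
  swap
  · exact key u₃ u₁ h3.1 h1.1 h3.2 h1.2 hN' a23.symm a12.symm f31 f34 f14 _
      (C.cost_zero h3.1 (S := ∅) 5 (by omega)) (by norm_num [p6])
  have pr : ∀ u, F.Adj v u → F.Adj u u₂ → u ∈ W → ({v, u₂} : Finset V) ⊆ nbrs F W u := by
    intro u hu hu2 huW z
    simp only [Finset.mem_insert, Finset.mem_singleton, mem_nbrs]
    rintro (rfl | rfl)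
    exacts [⟨hv, hu.symm⟩, ⟨h2.1, hu2⟩]
  have c1 := card_rest (F := F) h1.1
  have c3 := card_rest (F := F) h3.1
  -- With both ends of degree four, each end keeps at most two neighbours in the term of the other,
  -- since `v` and `u₂` are gone. The cost is then at most `y ^ 8 + y ^ 9 < 0.29`, unless both ends
  -- lie in isolated triangles.
  rcases C.cost_deg_two h1.1 (S := ∅) (k := 5) (by rw [Finset.sdiff_empty]; omega) f31 (by simp)
    {v, u₂} (pr u₃ h3.2 a23.symm h3.1) (by
      intro z; simp only [Finset.mem_insert, Finset.mem_singleton]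
      rintro (rfl | rfl)
      exacts [Or.inr (Or.inl h1.2.symm), Or.inr (Or.inl a12)])
    (by rw [Finset.card_pair h2.2.ne]; omega) with t | ⟨p, q, tr1⟩
  · exact key u₁ u₃ h1.1 h3.1 h1.2 h3.2 hN a12 a23 f13 f14 f34 _ t
      (by norm_num [p8, p9]; linarith)
  rcases C.cost_deg_two h3.1 (S := ∅) (k := 5) (by rw [Finset.sdiff_empty]; omega) f13 (by simp)
    {v, u₂} (pr u₁ h1.2 a12 h1.1) (by
      intro z; simp only [Finset.mem_insert, Finset.mem_singleton]
      rintro (rfl | rfl)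
      exacts [Or.inr (Or.inl h3.2.symm), Or.inr (Or.inl a23.symm)])
    (by rw [Finset.card_pair h2.2.ne]; omega) with t | ⟨w, w', tr2⟩
  · exact key u₃ u₁ h3.1 h1.1 h3.2 h1.2 hN' a23.symm a12.symm f31 f34 f14 _ t
      (by norm_num [p8, p9]; linarith)
  have nbr4 : ∀ u u' p q : V, u ∈ W → F.Adj v u → F.Adj u u₂ → F.Adj u' v → F.Adj u' u₂ →
      (nbrs F W u).card ≤ 4 →
      IsolatedTriangle F (rest F W u' \ ∅) u p q → ∀ r ∈ W, F.Adj u r →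
      r = v ∨ r = u₂ ∨ r ∈ (∅ : Finset V) ∨ r = p ∨ r = q := by
    intro u u' p q hu hvu huu2 hu'v hu'2 hd t r hr hur
    have lp := mem_rest.1 (Finset.mem_sdiff.1 t.left_mem).1
    have lq := mem_rest.1 (Finset.mem_sdiff.1 t.right_mem).1
    have ne : ∀ z, ¬ F.Adj u' z → z ∉ ({v, u₂} : Finset V) := by
      intro z hz
      simp only [Finset.mem_insert, Finset.mem_singleton]
      rintro (rfl | rfl)
      exacts [hz hu'v, hz hu'2]
    by_cases hrA : r ∈ ({v, u₂} : Finset V)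
    · simp only [Finset.mem_insert, Finset.mem_singleton] at hrA
      tauto
    · have := eq_of_two_outside (F := F) (A := {v, u₂}) (pr u hvu huu2 hu)
        (by rw [Finset.card_pair h2.2.ne]; omega) (mem_nbrs.2 ⟨lp.1, t.adj_left⟩)
        (mem_nbrs.2 ⟨lq.1, t.adj_right⟩) t.adj.ne (ne p lp.2.2) (ne q lq.2.2)
        (mem_nbrs.2 ⟨hr, hur⟩) hrA
      tauto
  refine C.not_two_triangles (E := ∅) (v := v) (c := u₂) h1.1 h3.1 (by simpa using hmin)
    (nbr4 u₁ u₃ w w' h1.1 h1.2 a12 h3.2.symm a23.symm hd1 tr2)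
    (nbr4 u₃ u₁ p q h3.1 h3.2 a23.symm h1.2.symm a12 hd3 tr1) tr1 tr2 ?_ ?_ ?_
  · intro r hr hr3 hvr
    rw [mem_rest] at hr
    rcases hN r hr.1 hvr with rfl | rfl | rfl | rfl
    exacts [hr.2.1 rfl, hr.2.2 a12, F.loopless.irrefl _ hr3, (mem_rest.1 f34).2.2 hr3.symm]
  · intro r hr hr1 hvr
    rw [mem_rest] at hr
    rcases hN r hr.1 hvr with rfl | rfl | rfl | rfl
    exacts [F.loopless.irrefl _ hr1, hr.2.2 a23.symm, hr.2.1 rfl, (mem_rest.1 f14).2.2 hr1.symm]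
  · intro r hr s hs hr3 hs1 hrc hsc
    rw [mem_rest] at hr hs
    -- `r` and `s` are two further neighbours of `u₂`
    have hsub : ({v, u₁, u₃, r, s} : Finset V) ⊆ nbrs F W u₂ := by
      intro z
      simp only [Finset.mem_insert, Finset.mem_singleton, mem_nbrs]
      rintro (rfl | rfl | rfl | rfl | rfl)
      exacts [⟨hv, h2.2.symm⟩, ⟨h1.1, a12.symm⟩, ⟨h3.1, a23⟩, ⟨hr.1, hrc.symm⟩,
        ⟨hs.1, hsc.symm⟩]
    have hrv : r ≠ v := by rintro rfl; exact hr.2.2 h1.2.symm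
    have hsv : s ≠ v := by rintro rfl; exact hs.2.2 h3.2.symm
    have hrs : r ≠ s := by rintro rfl; exact hr.2.2 hs1
    have hcard : ({v, u₁, u₃, r, s} : Finset V).card = 5 := by
      rw [Finset.card_insert_of_notMem, Finset.card_insert_of_notMem,
        Finset.card_insert_of_notMem, Finset.card_pair hrs]
      · simp [hr3.ne, hs.2.1.symm]
      · simp [n13, hr.2.1.symm, hs1.ne]
      · simp [h1.2.ne, h3.2.ne, hrv.symm, hsv.symm]
    have := Finset.card_le_card hsub
    omega

end Critical

end Critical

/-! ### Degree four: two disjoint edges and stars -/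

section Critical

variable {V : Type*} [DecidableEq V] {F : SimpleGraph V} [DecidableRel F.Adj]

namespace Critical

variable {b : Finset V → ℝ} {y X : ℝ} {W : Finset V}

/-- If the neighbourhood of `v` consists of two disjoint edges, then the deletion is cheap or
there is a triangle at `u₂` that is nearly isolated. -/
theorem two_edges_triangle (C : Critical F b y X W)
    (hmin : ∀ u ∈ W, 4 ≤ (nbrs F W u).card) {v u₁ u₂ u₃ u₄ : V}
    (hv : v ∈ W) (h1 : u₁ ∈ nbrs F W v) (h2 : u₂ ∈ nbrs F W v) (h3 : u₃ ∈ nbrs F W v)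
    (h4 : u₄ ∈ nbrs F W v) (hN : ∀ w ∈ W, F.Adj v w → w = u₁ ∨ w = u₂ ∨ w = u₃ ∨ w = u₄)
    (a12 : F.Adj u₁ u₂) (a34 : F.Adj u₃ u₄) (f13 : u₁ ∈ rest F W u₃) (f14 : u₁ ∈ rest F W u₄)
    (f23 : u₂ ∈ rest F W u₃) (f24 : u₂ ∈ rest F W u₄) :
    (nbrs F W u₁).card ≤ 4 ∧ ((nbrs F W u₂).card ≤ 4 →
      ∃ s s', s ∈ W ∧ s' ∈ W ∧ F.Adj u₂ s ∧ F.Adj u₂ s' ∧ F.Adj s s' ∧ s ≠ v ∧ s' ≠ v ∧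
        s ≠ u₁ ∧ s' ≠ u₁ ∧ (∀ r ∈ W, F.Adj u₂ r → r = v ∨ r = u₁ ∨ r = s ∨ r = s') ∧
        (∀ r ∈ W, F.Adj s r → r = u₂ ∨ r = s' ∨ r = u₁ ∨ (r ≠ v ∧ F.Adj u₃ r ∧ F.Adj u₄ r)) ∧
        (∀ r ∈ W, F.Adj s' r → r = u₂ ∨ r = s ∨ r = u₁ ∨
          (r ≠ v ∧ F.Adj u₃ r ∧ F.Adj u₄ r))) := by
  rw [mem_nbrs] at h1 h2 h3 h4
  obtain ⟨-, p5, p6, p7, p8, p9, p10, -⟩ := C.pows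
  obtain ⟨y1, y2, y3, y4⟩ := C.bounds
  have m1 := hmin _ h1.1
  have m2 := hmin _ h2.1
  have m3 := hmin _ h3.1
  have m4 := hmin _ h4.1
  have f32 := mem_rest_comm h3.1 f23
  have f42 := mem_rest_comm h4.1 f24
  have n13 : u₁ ≠ u₃ := (mem_rest.1 f13).2.1
  have n14 : u₁ ≠ u₄ := (mem_rest.1 f14).2.1
  have n23 : u₂ ≠ u₃ := (mem_rest.1 f23).2.1
  have n24 : u₂ ≠ u₄ := (mem_rest.1 f24).2.1
  have s := C.seq_four h1.1 h3.1 h4.1 h2.1 n13 n14 a34.ne a12.ne n23.symm n24.symm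
  have s0 := C.branching.sdiff_nonpos (S := {u₂, u₄, u₃, u₁}) hv
    (by simp [h1.2.ne, h2.2.ne, h3.2.ne, h4.2.ne]) (by
      intro z hz
      rw [mem_nbrs] at hz
      have := hN z hz.1 hz.2
      simp only [Finset.mem_insert, Finset.mem_singleton]
      tauto)
  have t2 := C.cost_one h3.1 (S := {u₁}) 4 m3 (by simp) f13
  have t3 := C.cost_one h4.1 (S := {u₃, u₁}) 4 m4 (by simp) f14
  have t4 := C.cost_two h2.1 (S := {u₄, u₃, u₁}) 4 m2 a34.ne (by simp) (by simp) f32 f42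
  refine ⟨?_, fun hd2 => ?_⟩
  · by_contra! hd
    have t1 := C.cost_zero h1.1 (S := ∅) 5 (by omega)
    norm_num at t1 t2 t3 t4
    exact C.contra (c := y ^ 6 + y ^ 6 + y ^ 6 + y ^ 7)
      (by rw [Finset.sdiff_empty] at s; linarith) (by rw [p6, p7]; linarith)
  have t1 := C.cost_zero h1.1 (S := ∅) 4 m1
  have pr : ({v, u₁} : Finset V) ⊆ nbrs F W u₂ := by
    intro z
    simp only [Finset.mem_insert, Finset.mem_singleton, mem_nbrs]
    rintro (rfl | rfl)
    exacts [⟨hv, h2.2.symm⟩, ⟨h1.1, a12.symm⟩]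
  have c2 := card_rest_sdiff_add_le (F := F) (R := {u₁}) (S := {u₁}) h3.1 (by simp)
    (by simpa using f13)
  have c3 := card_rest_sdiff_add_le (F := F) (R := {u₁}) (S := {u₃, u₁}) h4.1 (by simp)
    (by simpa using f14)
  rw [Finset.card_singleton] at c2 c3
  -- In the terms of `u₃` and of `u₄` the vertex `u₂` has lost `v` and `u₁`. A gain in either term
  -- is enough for a contradiction, so `u₂` lies in an isolated triangle in both.
  rcases C.cost_deg_two h3.1 (S := {u₁}) (k := 6) (by omega) f23 (by simp [a12.ne'])
    {v, u₁} pr (by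
      intro z; simp only [Finset.mem_insert, Finset.mem_singleton]
      rintro (rfl | rfl)
      exacts [Or.inr (Or.inl h3.2.symm), Or.inr (Or.inr rfl)])
    (by rw [Finset.card_pair h1.2.ne]; omega) with t | ⟨x, x', tr⟩
  · exfalso
    norm_num at t1 t t3 t4
    exact C.contra (c := y ^ 5 + (y ^ 9 + y ^ 10) + y ^ 6 + y ^ 7)
      (by rw [Finset.sdiff_empty] at s; linarith) (by rw [p5, p6, p7, p9, p10]; linarith)
  rcases C.cost_deg_two h4.1 (S := {u₃, u₁}) (k := 6) (by omega) f24 (by simp [a12.ne', n23])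
    {v, u₁} pr (by
      intro z; simp only [Finset.mem_insert, Finset.mem_singleton]
      rintro (rfl | rfl)
      exacts [Or.inr (Or.inl h4.2.symm), Or.inr (Or.inr (Or.inr rfl))])
    (by rw [Finset.card_pair h1.2.ne]; omega) with t | ⟨z, z', tr'⟩
  · exfalso
    norm_num at t1 t2 t t4
    exact C.contra (c := y ^ 5 + y ^ 6 + (y ^ 9 + y ^ 10) + y ^ 7)
      (by rw [Finset.sdiff_empty] at s; linarith) (by rw [p5, p6, p7, p9, p10]; linarith)
  -- both triangles consist of `u₂` and its two further neighbours
  have mx := tr.left_mem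
  have mx' := tr.right_mem
  have mz := tr'.left_mem
  have mz' := tr'.right_mem
  simp only [Finset.mem_sdiff, mem_rest, Finset.mem_insert, Finset.mem_singleton, not_or]
    at mx mx' mz mz'
  have out : ∀ w, ¬ F.Adj u₃ w → w ≠ u₁ → w ∉ ({v, u₁} : Finset V) := by
    intro w hw hw1
    simp only [Finset.mem_insert, Finset.mem_singleton, not_or]
    exact ⟨by rintro rfl; exact hw h3.2.symm, hw1⟩
  have out4 : ∀ w, ¬ F.Adj u₄ w → w ≠ u₁ → w ∉ ({v, u₁} : Finset V) := by
    intro w hw hw1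
    simp only [Finset.mem_insert, Finset.mem_singleton, not_or]
    exact ⟨by rintro rfl; exact hw h4.2.symm, hw1⟩
  have nv : ∀ w, ¬ F.Adj u₃ w → w ≠ v := by
    rintro w hw rfl
    exact hw h3.2.symm
  have two : ∀ r ∈ W, F.Adj u₂ r → r ∉ ({v, u₁} : Finset V) → r = x ∨ r = x' := by
    intro r hr hur hrA
    exact eq_of_two_outside (F := F) pr (by rw [Finset.card_pair h1.2.ne]; omega)
      (mem_nbrs.2 ⟨mx.1.1, tr.adj_left⟩) (mem_nbrs.2 ⟨mx'.1.1, tr.adj_right⟩) tr.adj.ne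
      (out x mx.1.2.2 mx.2) (out x' mx'.1.2.2 mx'.2) (mem_nbrs.2 ⟨hr, hur⟩) hrA
  have hz1 := two z mz.1.1 tr'.adj_left (out4 z mz.1.2.2 mz.2.2)
  have hz2 := two z' mz'.1.1 tr'.adj_right (out4 z' mz'.1.2.2 mz'.2.2)
  have hzz : z ≠ z' := tr'.adj.ne
  have hnx4 : ¬ F.Adj u₄ x := by
    rcases hz1 with h | h
    · rw [← h]; exact mz.1.2.2
    · rcases hz2 with h' | h'
      · rw [← h']; exact mz'.1.2.2
      · exact absurd (h.trans h'.symm) hzz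
  have hnx4' : ¬ F.Adj u₄ x' := by
    rcases hz1 with h | h
    · rcases hz2 with h' | h'
      · exact absurd (h.trans h'.symm) hzz
      · rw [← h']; exact mz'.1.2.2
    · rw [← h]; exact mz.1.2.2
  have nb' : (∀ r ∈ rest F W u₄ \ {u₃, u₁}, F.Adj x r → r = u₂ ∨ r = x') ∧
      (∀ r ∈ rest F W u₄ \ {u₃, u₁}, F.Adj x' r → r = u₂ ∨ r = x) := by
    rcases hz1 with rfl | rfl
    · rcases hz2 with rfl | rfl
      · exact absurd rfl hzz
      · exact ⟨tr'.nbrs_left, tr'.nbrs_right⟩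
    · rcases hz2 with rfl | rfl
      · exact ⟨tr'.nbrs_right, tr'.nbrs_left⟩
      · exact absurd rfl hzz
  -- A neighbour of `x` other than `u₁` that is not adjacent to both `u₃` and `u₄` survives in one
  -- of the two terms, where the isolated triangle leaves only `u₂` and `x'`.
  have fin : ∀ x x', x ∈ W → F.Adj u₂ x → x ≠ u₁ → ¬ F.Adj u₃ x → ¬ F.Adj u₄ x →
      (∀ r ∈ rest F W u₃ \ {u₁}, F.Adj x r → r = u₂ ∨ r = x') →
      (∀ r ∈ rest F W u₄ \ {u₃, u₁}, F.Adj x r → r = u₂ ∨ r = x') →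
      ∀ r ∈ W, F.Adj x r → r = u₂ ∨ r = x' ∨ r = u₁ ∨ (r ≠ v ∧ F.Adj u₃ r ∧ F.Adj u₄ r) := by
    intro x x' hx h2x hx1 h3x h4x hA hB r hr hxr
    by_cases hr1 : r = u₁
    · exact Or.inr (Or.inr (Or.inl hr1))
    have hr3 : r ≠ u₃ := by rintro rfl; exact h3x hxr.symm
    have hr4 : r ≠ u₄ := by rintro rfl; exact h4x hxr.symm
    have hrv : r ≠ v := by
      rintro rfl
      rcases hN x hx hxr.symm with rfl | rfl | rfl | rfl
      exacts [hx1 rfl, F.loopless.irrefl _ h2x, (mem_rest.1 f32).2.2 h2x,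
        (mem_rest.1 f42).2.2 h2x]
    by_cases h3r : F.Adj u₃ r
    · by_cases h4r : F.Adj u₄ r
      · exact Or.inr (Or.inr (Or.inr ⟨hrv, h3r, h4r⟩))
      · exact (hB r (by simp [hr, hr4, h4r, hr3, hr1]) hxr).imp_right Or.inl
    · exact (hA r (by simp [hr, hr3, h3r, hr1]) hxr).imp_right Or.inl
  refine ⟨x, x', mx.1.1, mx'.1.1, tr.adj_left, tr.adj_right, tr.adj, nv x mx.1.2.2,
    nv x' mx'.1.2.2, mx.2, mx'.2, ?_,
    fin x x' mx.1.1 tr.adj_left mx.2 mx.1.2.2 hnx4 tr.nbrs_left nb'.1,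
    fin x' x mx'.1.1 tr.adj_right mx'.2 mx'.1.2.2 hnx4' tr.nbrs_right nb'.2⟩
  intro r hr hur
  by_cases hrA : r ∈ ({v, u₁} : Finset V)
  · simp only [Finset.mem_insert, Finset.mem_singleton] at hrA
    exact hrA.imp_right Or.inl
  · exact Or.inr (Or.inr (two r hr hur hrA))

/-- By symmetry there are triangles `u₂ s s'` and `u₄ t t'`. The degree of `s` forces a common
neighbour of `u₃` and `u₄` other than `v`, which must be `t` or `t'`, say `t`. Then `u₃` is not
adjacent to `t'`, so the degree of `t'` forces both `s` and `s'` to be adjacent to `u₁`, and `u₁,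
u₂, s, s'` is a four-clique. -/
theorem four_two_edges (C : Critical F b y X W)
    (hmin : ∀ u ∈ W, 4 ≤ (nbrs F W u).card) {v u₁ u₂ u₃ u₄ : V}
    (hv : v ∈ W) (h1 : u₁ ∈ nbrs F W v) (h2 : u₂ ∈ nbrs F W v) (h3 : u₃ ∈ nbrs F W v)
    (h4 : u₄ ∈ nbrs F W v) (hN : ∀ w ∈ W, F.Adj v w → w = u₁ ∨ w = u₂ ∨ w = u₃ ∨ w = u₄)
    (a12 : F.Adj u₁ u₂) (a34 : F.Adj u₃ u₄) (f13 : u₁ ∈ rest F W u₃) (f14 : u₁ ∈ rest F W u₄)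
    (f23 : u₂ ∈ rest F W u₃) (f24 : u₂ ∈ rest F W u₄) : False := by
  have w1 := (mem_nbrs.1 h1).1
  have w2 := (mem_nbrs.1 h2).1
  have w3 := (mem_nbrs.1 h3).1
  have w4 := (mem_nbrs.1 h4).1
  have f31 := mem_rest_comm w3 f13
  have f41 := mem_rest_comm w4 f14
  have f32 := mem_rest_comm w3 f23
  have f42 := mem_rest_comm w4 f24
  have hN2 : ∀ w ∈ W, F.Adj v w → w = u₂ ∨ w = u₁ ∨ w = u₃ ∨ w = u₄ := fun w hw h => by
    have := hN w hw h; tauto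
  have hN3 : ∀ w ∈ W, F.Adj v w → w = u₃ ∨ w = u₄ ∨ w = u₁ ∨ w = u₂ := fun w hw h => by
    have := hN w hw h; tauto
  have hN4 : ∀ w ∈ W, F.Adj v w → w = u₄ ∨ w = u₃ ∨ w = u₁ ∨ w = u₂ := fun w hw h => by
    have := hN w hw h; tauto
  have hd2 := (C.two_edges_triangle hmin hv h2 h1 h3 h4 hN2 a12.symm a34 f23 f24 f13 f14).1
  have hd4 := (C.two_edges_triangle hmin hv h4 h3 h1 h2 hN4 a34.symm a12 f41 f42 f31 f32).1
  obtain ⟨s, s', sW, sW', a2s, a2s', ass, sv, sv', s1, s1', hN2s, hs, hs'⟩ :=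
    (C.two_edges_triangle hmin hv h1 h2 h3 h4 hN a12 a34 f13 f14 f23 f24).2 hd2
  obtain ⟨t, t', tW, tW', a4t, a4t', att, tv, tv', t3, t3', hN4t, ht, ht'⟩ :=
    (C.two_edges_triangle hmin hv h3 h4 h1 h2 hN3 a34 a12 f31 f32 f41 f42).2 hd4
  -- `s` has a neighbour that is adjacent to `u₃` and `u₄`
  obtain ⟨r, hr, hrv, hr3, hr4⟩ : ∃ r ∈ W, r ≠ v ∧ F.Adj u₃ r ∧ F.Adj u₄ r := by
    by_contra! hcon
    have hsub : nbrs F W s ⊆ {u₂, s', u₁} := by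
      intro r hr
      obtain ⟨hr, hsr⟩ := mem_nbrs.1 hr
      rcases hs r hr hsr with h | h | h | ⟨h, h', h''⟩
      · simp [h]
      · simp [h]
      · simp [h]
      · exact absurd h'' (hcon r hr h h')
    have := (Finset.card_le_card hsub).trans Finset.card_le_three
    have := hmin s sW
    omega
  have key : ∀ t t' : V, t ∈ W → t' ∈ W → F.Adj u₄ t → F.Adj u₄ t' → F.Adj t t' → F.Adj u₃ t →
      (∀ r ∈ W, F.Adj t' r → r = u₄ ∨ r = t ∨ r = u₃ ∨ (r ≠ v ∧ F.Adj u₁ r ∧ F.Adj u₂ r)) →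
      False := by
    intro t t' tW tW' a4t a4t' att a3t ht'
    have h3t' : ¬ F.Adj u₃ t' := fun h =>
      C.no_four u₃ w3 u₄ w4 t tW t' tW' a34 a3t h a4t a4t' att
    have hcases : ∀ r ∈ nbrs F W t', r = u₄ ∨ r = t ∨ (F.Adj u₁ r ∧ (r = s ∨ r = s')) := by
      intro r hr
      obtain ⟨hr, htr⟩ := mem_nbrs.1 hr
      rcases ht' r hr htr with h | h | rfl | ⟨h, h', h''⟩
      · exact Or.inl h
      · exact Or.inr (Or.inl h)
      · exact absurd htr.symm h3t'
      · rcases hN2s r hr h'' with rfl | rfl | h0 | h0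
        · exact absurd rfl h
        · exact absurd h' (F.loopless.irrefl _)
        · exact Or.inr (Or.inr ⟨h', Or.inl h0⟩)
        · exact Or.inr (Or.inr ⟨h', Or.inr h0⟩)
    have hd := hmin t' tW'
    have side : ∀ s s' : V, (∀ r ∈ nbrs F W t', r = u₄ ∨ r = t ∨ (F.Adj u₁ r ∧ (r = s ∨ r = s'))) →
        F.Adj u₁ s := by
      intro s s' hcases
      by_contra h
      have hsub : nbrs F W t' ⊆ {u₄, t, s'} := by
        intro r hr
        rcases hcases r hr with h' | h' | ⟨h', h'' | h''⟩
        · simp [h']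
        · simp [h']
        · rw [h''] at h'
          exact absurd h' h
        · simp [h'']
      have := (Finset.card_le_card hsub).trans Finset.card_le_three
      omega
    have a1s := side s s' hcases
    have a1s' := side s' s fun r hr => by have := hcases r hr; tauto
    exact C.no_four u₁ w1 u₂ w2 s sW s' sW' a12 a1s a1s' a2s a2s' ass
  rcases hN4t r hr hr4 with rfl | rfl | rfl | rfl
  · exact hrv rfl
  · exact F.loopless.irrefl _ hr3
  · exact key r t' tW tW' a4t a4t' att hr3 ht'
  · exact key r t tW' tW a4t' a4t att.symm hr3 ht

/-- The neighbourhood is a star with centre `c`. -/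
theorem four_star (C : Critical F b y X W)
    (hmin : ∀ u ∈ W, 4 ≤ (nbrs F W u).card) {v c a₁ a₂ a₃ : V} (hv : v ∈ W)
    (hc : c ∈ nbrs F W v) (h1 : a₁ ∈ nbrs F W v) (h2 : a₂ ∈ nbrs F W v) (h3 : a₃ ∈ nbrs F W v)
    (hN : ∀ w ∈ W, F.Adj v w → w = c ∨ w = a₁ ∨ w = a₂ ∨ w = a₃) (c1 : F.Adj c a₁)
    (c2 : F.Adj c a₂) (c3 : F.Adj c a₃) (f12 : a₁ ∈ rest F W a₂) (f13 : a₁ ∈ rest F W a₃)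
    (f23 : a₂ ∈ rest F W a₃) : False := by
  rw [mem_nbrs] at h1 h2 h3 hc
  obtain ⟨-, p5, p6, p7, p8, p9, -⟩ := C.pows
  obtain ⟨y1, y2, y3, y4⟩ := C.bounds
  have f21 := mem_rest_comm h2.1 f12
  have f31 := mem_rest_comm h3.1 f13
  have f32 := mem_rest_comm h3.1 f23
  have n12 : a₁ ≠ a₂ := (mem_rest.1 f12).2.1
  have n13 : a₁ ≠ a₃ := (mem_rest.1 f13).2.1
  have n23 : a₂ ≠ a₃ := (mem_rest.1 f23).2.1
  by_cases hdc : (nbrs F W c).card ≤ 4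
  · -- a vertex of degree four among the leaves has a sparse neighbourhood
    have leaf : ∀ a a' a'' : V, a ∈ W → F.Adj v a → F.Adj c a → F.Adj v a' → F.Adj c a' →
        F.Adj v a'' → F.Adj c a'' → a' ∈ W → a'' ∈ W → a ∈ rest F W a' → a ∈ rest F W a'' →
        a' ∈ rest F W a'' → (∀ w ∈ W, F.Adj v w → w = c ∨ w = a ∨ w = a' ∨ w = a'') →
        (nbrs F W a).card ≤ 4 → False := by
      intro a a' a'' aW va ca va' ca' va'' ca'' aW' aW'' f f' f'' hN hd
      have pr : ({v, c} : Finset V) ⊆ nbrs F W a := by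
        intro z
        simp only [Finset.mem_insert, Finset.mem_singleton, mem_nbrs]
        rintro (rfl | rfl)
        exacts [⟨hv, va.symm⟩, ⟨hc.1, ca.symm⟩]
      have hd' := hmin a aW
      have hcard : (nbrs F W a \ {v, c}).card = 2 := by
        rw [Finset.card_sdiff_of_subset pr, Finset.card_pair hc.2.ne]
        omega
      obtain ⟨w, w', hww, heq⟩ := Finset.card_eq_two.1 hcard
      have hw : w ∈ nbrs F W a \ {v, c} := by rw [heq]; simp
      have hw' : w' ∈ nbrs F W a \ {v, c} := by rw [heq]; simp
      simp only [Finset.mem_sdiff, mem_nbrs, Finset.mem_insert, Finset.mem_singleton, not_or]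
        at hw hw'
      have hNa : ∀ z ∈ W, F.Adj a z → z = v ∨ z = c ∨ z = w ∨ z = w' := by
        intro z hz haz
        by_cases h : z = v ∨ z = c
        · tauto
        · have : z ∈ nbrs F W a \ {v, c} := by
            simp only [Finset.mem_sdiff, mem_nbrs, Finset.mem_insert, Finset.mem_singleton]
            exact ⟨⟨hz, haz⟩, h⟩
          rw [heq] at this
          simp only [Finset.mem_insert, Finset.mem_singleton] at this
          tauto
      have hcN : ∀ z ∈ W, F.Adj c z → z = v ∨ z = a ∨ z = a' ∨ z = a'' := by
        have hsub : ({v, a, a', a''} : Finset V) ⊆ nbrs F W c := by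
          intro z
          simp only [Finset.mem_insert, Finset.mem_singleton, mem_nbrs]
          rintro (rfl | rfl | rfl | rfl)
          exacts [⟨hv, hc.2.symm⟩, ⟨aW, ca⟩, ⟨aW', ca'⟩, ⟨aW'', ca''⟩]
        have h4 : ({v, a, a', a''} : Finset V).card = 4 := by
          rw [Finset.card_insert_of_notMem, Finset.card_insert_of_notMem, Finset.card_pair]
          · exact (mem_rest.1 f'').2.1
          · simp [(mem_rest.1 f).2.1, (mem_rest.1 f').2.1]
          · simp [va.ne, va'.ne, va''.ne]
        have := Finset.eq_of_subset_of_card_le hsub (by omega)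
        intro z hz hcz
        have : z ∈ ({v, a, a', a''} : Finset V) := by
          rw [this]; exact mem_nbrs.2 ⟨hz, hcz⟩
        simpa using this
      have farv : ∀ z ∈ W, F.Adj a z → z ≠ v → z ≠ c → v ∈ rest F W z ∧ c ∈ rest F W z := by
        intro z hz haz hzv hzc
        have nz : z ≠ a ∧ z ≠ a' ∧ z ≠ a'' :=
          ⟨haz.ne', by rintro rfl; exact (mem_rest.1 f).2.2 haz.symm,
            by rintro rfl; exact (mem_rest.1 f').2.2 haz.symm⟩
        refine ⟨mem_rest.2 ⟨hv, hzv.symm, fun h => ?_⟩, mem_rest.2 ⟨hc.1, hzc.symm, fun h => ?_⟩⟩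
        · have := hN z hz h.symm; tauto
        · have := hcN z hz h.symm; tauto
      obtain ⟨fw1, fw2⟩ := farv w hw.1.1 hw.1.2 hw.2.1 hw.2.2
      obtain ⟨fw1', fw2'⟩ := farv w' hw'.1.1 hw'.1.2 hw'.2.1 hw'.2.2
      by_cases hadj : F.Adj w w'
      · exact C.four_two_edges hmin aW (mem_nbrs.2 ⟨hv, va.symm⟩) (mem_nbrs.2 ⟨hc.1, ca.symm⟩)
          (mem_nbrs.2 hw.1) (mem_nbrs.2 hw'.1) hNa hc.2 hadj fw1 fw1' fw2 fw2'
      · exact C.four_sparse hmin aW (mem_nbrs.2 ⟨hv, va.symm⟩) (mem_nbrs.2 ⟨hc.1, ca.symm⟩)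
          (mem_nbrs.2 hw.1) (mem_nbrs.2 hw'.1) hNa hc.2.ne fw1 fw1' fw2 fw2'
          (mem_rest.2 ⟨hw.1.1, hww, fun h => hadj h.symm⟩)
    by_cases hd1 : (nbrs F W a₁).card ≤ 4
    · exact leaf a₁ a₂ a₃ h1.1 h1.2 c1 h2.2 c2 h3.2 c3 h2.1 h3.1 f12 f13 f23 hN hd1
    by_cases hd2 : (nbrs F W a₂).card ≤ 4
    · exact leaf a₂ a₁ a₃ h2.1 h2.2 c2 h1.2 c1 h3.2 c3 h1.1 h3.1 f21 f23 f13
        (fun w hw h => by have := hN w hw h; tauto) hd2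
    -- Two leaves of the star have degree at least five. Deleting the three leaves of the star makes
    -- `v` a leaf, so the centre need not be deleted.
    have s := C.seq_three h1.1 h2.1 h3.1 n12 n13 n23
    have t1 := C.cost_zero h1.1 (S := ∅) 5 (by omega)
    have t2 := C.cost_one h2.1 (S := {a₁}) 5 (by omega) (by simp) f12
    have t3 := C.cost_two h3.1 (S := {a₂, a₁}) 4 (hmin _ h3.1) n12 (by simp) (by simp) f13 f23
    have t4 := C.leaf_left (S := {a₃, a₂, a₁}) (v := v) (w := c) (by
        intro z; simp only [Finset.mem_insert, Finset.mem_singleton]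
        rintro (rfl | rfl | rfl)
        exacts [h3.1, h2.1, h1.1]) hv (by simp [h1.2.ne, h2.2.ne, h3.2.ne]) (by
        intro z hz hvz
        have := hN z hz hvz
        simp only [Finset.mem_insert, Finset.mem_singleton]
        tauto)
    have hcard : ({a₃, a₂, a₁} : Finset V).card = 3 := by
      rw [Finset.card_insert_of_notMem (by simp [n13.symm, n23.symm]), Finset.card_pair n12.symm]
    rw [hcard] at t4
    norm_num at t1 t2 t3 t4
    exact C.contra (c := y ^ 6 + y ^ 7 + y ^ 7 + y ^ 5)
      (by rw [Finset.sdiff_empty] at s; linarith) (by rw [p5, p6, p7]; linarith)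
  -- the centre has degree five
  have key : ∀ a₁ a₂ a₃ : V, a₁ ∈ W → a₂ ∈ W → a₃ ∈ W → F.Adj v a₁ → F.Adj v a₂ → F.Adj v a₃ →
      (∀ w ∈ W, F.Adj v w → w = c ∨ w = a₁ ∨ w = a₂ ∨ w = a₃) → F.Adj c a₁ → F.Adj c a₂ →
      F.Adj c a₃ → a₁ ∈ rest F W a₂ → a₁ ∈ rest F W a₃ → a₂ ∈ rest F W a₃ → ∀ T : ℝ,
      b (rest F W a₁ \ ∅) ≤ T * X → T ≤ 0.29 → False := by
    intro a₁ a₂ a₃ h1 h2 h3 v1 v2 v3 hN c1 c2 c3 f12 f13 f23 T hT hT'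
    have n12 : a₁ ≠ a₂ := (mem_rest.1 f12).2.1
    have n13 : a₁ ≠ a₃ := (mem_rest.1 f13).2.1
    have n23 : a₂ ≠ a₃ := (mem_rest.1 f23).2.1
    have s := C.seq_four h1 h2 h3 hc.1 n12 n13 n23 c1.ne' c2.ne' c3.ne'
    have s0 := C.branching.sdiff_nonpos (S := {c, a₃, a₂, a₁}) hv
      (by simp [v1.ne, v2.ne, v3.ne, hc.2.ne]) (by
        intro z hz
        rw [mem_nbrs] at hz
        have := hN z hz.1 hz.2
        simp only [Finset.mem_insert, Finset.mem_singleton]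
        tauto)
    have t2 := C.cost_one h2 (S := {a₁}) 4 (hmin _ h2) (by simp) f12
    have t3 := C.cost_two h3 (S := {a₂, a₁}) 4 (hmin _ h3) n12 (by simp) (by simp) f13 f23
    have t4 := C.cost_zero hc.1 (S := {a₃, a₂, a₁}) 5 (by omega)
    norm_num at t2 t3 t4
    exact C.contra (c := T + y ^ 6 + y ^ 7 + y ^ 6) (by linarith) (by rw [p6, p7]; linarith)
  have hN' : ∀ w ∈ W, F.Adj v w → w = c ∨ w = a₂ ∨ w = a₁ ∨ w = a₃ := fun w hw h => by
    have := hN w hw h; tauto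
  by_cases hd1 : (nbrs F W a₁).card ≤ 4
  swap
  · exact key a₁ a₂ a₃ h1.1 h2.1 h3.1 h1.2 h2.2 h3.2 hN c1 c2 c3 f12 f13 f23 _
      (C.cost_zero h1.1 (S := ∅) 5 (by omega)) (by norm_num [p6])
  by_cases hd2 : (nbrs F W a₂).card ≤ 4
  swap
  · exact key a₂ a₁ a₃ h2.1 h1.1 h3.1 h2.2 h1.2 h3.2 hN' c2 c1 c3 f21 f23 f13 _
      (C.cost_zero h2.1 (S := ∅) 5 (by omega)) (by norm_num [p6])
  have pr : ∀ u, F.Adj v u → F.Adj u c → u ∈ W → ({v, c} : Finset V) ⊆ nbrs F W u := by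
    intro u hu huc huW z
    simp only [Finset.mem_insert, Finset.mem_singleton, mem_nbrs]
    rintro (rfl | rfl)
    exacts [⟨hv, hu.symm⟩, ⟨hc.1, huc⟩]
  have r1 := card_rest (F := F) h1.1
  have r2 := card_rest (F := F) h2.1
  have m1 := hmin _ h1.1
  have m2 := hmin _ h2.1
  -- In the term of either leaf, the other has lost `v` and `c`. As for the short path, the
  -- alternative to a gain is a pair of isolated triangles.
  rcases C.cost_deg_two h1.1 (S := ∅) (k := 5) (by rw [Finset.sdiff_empty]; omega) f21 (by simp)
    {v, c} (pr a₂ h2.2 c2.symm h2.1) (by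
      intro z; simp only [Finset.mem_insert, Finset.mem_singleton]
      rintro (rfl | rfl)
      exacts [Or.inr (Or.inl h1.2.symm), Or.inr (Or.inl c1.symm)])
    (by rw [Finset.card_pair hc.2.ne]; omega) with t | ⟨p, q, tr1⟩
  · exact key a₁ a₂ a₃ h1.1 h2.1 h3.1 h1.2 h2.2 h3.2 hN c1 c2 c3 f12 f13 f23 _ t
      (by norm_num [p8, p9]; linarith)
  rcases C.cost_deg_two h2.1 (S := ∅) (k := 5) (by rw [Finset.sdiff_empty]; omega) f12 (by simp)
    {v, c} (pr a₁ h1.2 c1.symm h1.1) (by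
      intro z; simp only [Finset.mem_insert, Finset.mem_singleton]
      rintro (rfl | rfl)
      exacts [Or.inr (Or.inl h2.2.symm), Or.inr (Or.inl c2.symm)])
    (by rw [Finset.card_pair hc.2.ne]; omega) with t | ⟨w, w', tr2⟩
  · exact key a₂ a₁ a₃ h2.1 h1.1 h3.1 h2.2 h1.2 h3.2 hN' c2 c1 c3 f21 f23 f13 _ t
      (by norm_num [p8, p9]; linarith)
  have nbr4 : ∀ u u' p q : V, u ∈ W → F.Adj v u → F.Adj u c → F.Adj u' v → F.Adj u' c →
      (nbrs F W u).card ≤ 4 →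
      IsolatedTriangle F (rest F W u' \ ∅) u p q → ∀ r ∈ W, F.Adj u r →
      r = v ∨ r = c ∨ r ∈ (∅ : Finset V) ∨ r = p ∨ r = q := by
    intro u u' p q hu hvu huu2 hu'v hu'2 hd t r hr hur
    have lp := mem_rest.1 (Finset.mem_sdiff.1 t.left_mem).1
    have lq := mem_rest.1 (Finset.mem_sdiff.1 t.right_mem).1
    have ne : ∀ z, ¬ F.Adj u' z → z ∉ ({v, c} : Finset V) := by
      intro z hz
      simp only [Finset.mem_insert, Finset.mem_singleton]
      rintro (rfl | rfl)
      exacts [hz hu'v, hz hu'2]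
    by_cases hrA : r ∈ ({v, c} : Finset V)
    · simp only [Finset.mem_insert, Finset.mem_singleton] at hrA
      tauto
    · have := eq_of_two_outside (F := F) (A := {v, c}) (pr u hvu huu2 hu)
        (by rw [Finset.card_pair hc.2.ne]; omega) (mem_nbrs.2 ⟨lp.1, t.adj_left⟩)
        (mem_nbrs.2 ⟨lq.1, t.adj_right⟩) t.adj.ne (ne p lp.2.2) (ne q lq.2.2)
        (mem_nbrs.2 ⟨hr, hur⟩) hrA
      tauto
  refine C.not_two_triangles (E := ∅) (v := v) (c := c) h1.1 h2.1 (by simpa using hmin)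
    (nbr4 a₁ a₂ w w' h1.1 h1.2 c1.symm h2.2.symm c2.symm hd1 tr2)
    (nbr4 a₂ a₁ p q h2.1 h2.2 c2.symm h1.2.symm c1.symm hd2 tr1) tr1 tr2 ?_ ?_ ?_
  · intro r hr hr2 hvr
    rw [mem_rest] at hr
    rcases hN r hr.1 hvr with rfl | rfl | rfl | rfl
    exacts [hr.2.2 c1.symm, hr.2.1 rfl, F.loopless.irrefl _ hr2, (mem_rest.1 f32).2.2 hr2]
  · intro r hr hr1 hvr
    rw [mem_rest] at hr
    rcases hN r hr.1 hvr with rfl | rfl | rfl | rfl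
    exacts [hr.2.2 c2.symm, F.loopless.irrefl _ hr1, hr.2.1 rfl, (mem_rest.1 f31).2.2 hr1]
  · intro r hr s hs hr2 hs1 hrc hsc
    rw [mem_rest] at hr hs
    -- Neighbours `r` and `s` of `c` from the two triangles would raise the degree of `c` to six.
    have hsub : ({v, a₁, a₂, a₃, r, s} : Finset V) ⊆ nbrs F W c := by
      intro z
      simp only [Finset.mem_insert, Finset.mem_singleton, mem_nbrs]
      rintro (rfl | rfl | rfl | rfl | rfl | rfl)
      exacts [⟨hv, hc.2.symm⟩, ⟨h1.1, c1⟩, ⟨h2.1, c2⟩, ⟨h3.1, c3⟩, ⟨hr.1, hrc.symm⟩,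
        ⟨hs.1, hsc.symm⟩]
    have hrv : r ≠ v := by rintro rfl; exact hr.2.2 h1.2.symm
    have hsv : s ≠ v := by rintro rfl; exact hs.2.2 h2.2.symm
    have hrs : r ≠ s := by rintro rfl; exact hr.2.2 hs1
    have hr3 : r ≠ a₃ := by rintro rfl; exact (mem_rest.1 f32).2.2 hr2
    have hs3 : s ≠ a₃ := by rintro rfl; exact (mem_rest.1 f31).2.2 hs1
    have hcard : ({v, a₁, a₂, a₃, r, s} : Finset V).card = 6 := by
      rw [Finset.card_insert_of_notMem, Finset.card_insert_of_notMem,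
        Finset.card_insert_of_notMem, Finset.card_insert_of_notMem, Finset.card_pair hrs]
      · simp [hr3.symm, hs3.symm]
      · simp [n23, hr2.ne, hs.2.1.symm]
      · simp [n12, n13, hr.2.1.symm, hs1.ne]
      · simp [h1.2.ne, h2.2.ne, h3.2.ne, hrv.symm, hsv.symm]
    have := Finset.card_le_card hsub
    have := C.card_nbrs_le_five hc.1
    omega

end Critical

end Critical

/-! ### Exclusion of degree four, and neighbourhoods of size five -/

section Critical

variable {V : Type*} [DecidableEq V] {F : SimpleGraph V} [DecidableRel F.Adj]

theorem exists_eq_insert_of_card {S N : Finset V} (h : S ⊆ N) (hc : S.card + 1 = N.card) :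
    ∃ d ∉ S, N = insert d S := by
  have h1 : (N \ S).card = 1 := by rw [Finset.card_sdiff_of_subset h]; omega
  obtain ⟨d, hd⟩ := Finset.card_eq_one.1 h1
  have hdm : d ∈ N \ S := by rw [hd]; simp
  refine ⟨d, (Finset.mem_sdiff.1 hdm).2, ?_⟩
  rw [← Finset.sdiff_union_of_subset h, hd]
  rfl

theorem exists_eq_pair_of_card {S N : Finset V} (h : S ⊆ N) (hc : S.card + 2 = N.card) :
    ∃ d e, d ∉ S ∧ e ∉ S ∧ d ≠ e ∧ N = insert d (insert e S) := by
  have h1 : (N \ S).card = 2 := by rw [Finset.card_sdiff_of_subset h]; omega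
  obtain ⟨d, e, hde, hd⟩ := Finset.card_eq_two.1 h1
  have hdm : d ∈ N \ S := by rw [hd]; simp
  have hem : e ∈ N \ S := by rw [hd]; simp
  refine ⟨d, e, (Finset.mem_sdiff.1 hdm).2, (Finset.mem_sdiff.1 hem).2, hde, ?_⟩
  rw [← Finset.sdiff_union_of_subset h, hd]
  rw [Finset.insert_union, Finset.singleton_union]

/-- In a graph of maximum degree one there are two vertices not adjacent to any other vertex. -/
theorem exists_pair_no_other_adj {N : Finset V} (hN : 1 < N.card)
    (h : ∀ u ∈ N, (nbrs F N u).card ≤ 1) :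
    ∃ u ∈ N, ∃ a ∈ N, u ≠ a ∧ ∀ z ∈ N, z ≠ u → z ≠ a → ¬ F.Adj u z ∧ ¬ F.Adj a z := by
  by_cases hC : ∃ u ∈ N, (nbrs F N u).Nonempty
  · obtain ⟨u, hu, a, ha⟩ := hC
    obtain ⟨haN, hua⟩ := mem_nbrs.1 ha
    refine ⟨u, hu, a, haN, hua.ne, fun z hz hzu hza => ⟨fun h' => hza ?_, fun h' => hzu ?_⟩⟩
    · exact Finset.card_le_one.1 (h u hu) z (mem_nbrs.2 ⟨hz, h'⟩) a ha
    · exact Finset.card_le_one.1 (h a haN) z (mem_nbrs.2 ⟨hz, h'⟩) u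
        (mem_nbrs.2 ⟨hu, hua.symm⟩)
  · obtain ⟨u, hu, a, ha, hua⟩ := Finset.one_lt_card.1 hN
    have no : ∀ p ∈ N, ∀ q ∈ N, ¬ F.Adj p q := fun p hp q hq h =>
      hC ⟨p, hp, q, mem_nbrs.2 ⟨hq, h⟩⟩
    exact ⟨u, hu, a, ha, hua, fun z hz _ _ => ⟨no u hu z hz, no a ha z hz⟩⟩

namespace Critical

variable {b : Finset V → ℝ} {y X : ℝ} {W : Finset V}

theorem far_of_common (C : Critical F b y X W)
    {v u a c : V} (hv : v ∈ W) (hu : u ∈ W) (ha : a ∈ W) (hc : c ∈ W)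
    (hac : a ≠ c) (vu : F.Adj v u) (va : F.Adj v a) (vc : F.Adj v c) (ua : F.Adj u a)
    (uc : F.Adj u c) : a ∈ rest F W c :=
  mem_rest.2 ⟨ha, hac, fun h => C.no_four v hv u hu a ha c hc vu va vc ua uc h.symm⟩

/-- The neighbourhood is a triangle-free graph on four vertices, classified by its maximum degree.
Three gives a star; two gives a cycle, a path on four vertices, or a path on three vertices with an
isolated vertex; at most one gives two disjoint edges or a sparser graph. -/
theorem card_nbrs_ne_four (C : Critical F b y X W)
    (hmin : ∀ u ∈ W, 4 ≤ (nbrs F W u).card) {v : V} (hv : v ∈ W) :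
    (nbrs F W v).card ≠ 4 := by
  intro hd
  set N := nbrs F W v with hNdef
  have mW : ∀ z ∈ N, z ∈ W := fun z hz => (mem_nbrs.1 hz).1
  have mA : ∀ z ∈ N, F.Adj v z := fun z hz => (mem_nbrs.1 hz).2
  have far : ∀ p ∈ N, ∀ q, p ≠ q → ¬ F.Adj p q → p ∈ rest F W q := fun p hp q hpq h =>
    mem_rest.2 ⟨mW p hp, hpq, fun h' => h h'.symm⟩
  have ind : ∀ u ∈ N, ∀ p ∈ nbrs F N u, ∀ q ∈ nbrs F N u, p ≠ q → p ∈ rest F W q := by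
    intro u hu p hp q hq hpq
    obtain ⟨hp, hup⟩ := mem_nbrs.1 hp
    obtain ⟨hq, huq⟩ := mem_nbrs.1 hq
    exact C.far_of_common hv (mW u hu) (mW p hp) (mW q hq) hpq (mA u hu) (mA p hp) (mA q hq)
      hup huq
  have mem : ∀ {S : Finset V}, N = S → ∀ w ∈ W, F.Adj v w → w ∈ S := by
    rintro S rfl w hw h
    exact mem_nbrs.2 ⟨hw, h⟩
  by_cases hA : ∃ u ∈ N, 3 ≤ (nbrs F N u).card
  · obtain ⟨u, hu, hu3⟩ := hA
    have hsub : nbrs F N u ⊆ N.erase u := fun z hz =>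
      Finset.mem_erase.2 ⟨(mem_nbrs.1 hz).2.ne', (mem_nbrs.1 hz).1⟩
    have hcard := Finset.card_erase_of_mem hu
    have h3 : (nbrs F N u).card = 3 := by
      have := Finset.card_le_card hsub
      omega
    have heq := Finset.eq_of_subset_of_card_le hsub (by omega)
    obtain ⟨p, q, r, hpq, hpr, hqr, hL⟩ := Finset.card_eq_three.1 h3
    have hp : p ∈ nbrs F N u := by rw [hL]; simp
    have hq : q ∈ nbrs F N u := by rw [hL]; simp
    have hr : r ∈ nbrs F N u := by rw [hL]; simp
    refine C.four_star hmin hv hu (mem_nbrs.1 hp).1 (mem_nbrs.1 hq).1 (mem_nbrs.1 hr).1 ?_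
      (mem_nbrs.1 hp).2 (mem_nbrs.1 hq).2 (mem_nbrs.1 hr).2 (ind u hu p hp q hq hpq)
      (ind u hu p hp r hr hpr) (ind u hu q hq r hr hqr)
    intro w hw hvw
    have := mem (S := insert u {p, q, r}) (by rw [← hL, heq, Finset.insert_erase hu]) w hw hvw
    simpa using this
  push Not at hA
  by_cases hB : ∃ u ∈ N, 2 ≤ (nbrs F N u).card
  · obtain ⟨u, hu, hu2⟩ := hB
    obtain ⟨p, q, hpq, hL⟩ := Finset.card_eq_two.1
      (show (nbrs F N u).card = 2 by have := hA u hu; omega)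
    have hp : p ∈ nbrs F N u := by rw [hL]; simp
    have hq : q ∈ nbrs F N u := by rw [hL]; simp
    have fpq := ind u hu p hp q hq hpq
    obtain ⟨hpN, up⟩ := mem_nbrs.1 hp
    obtain ⟨hqN, uq⟩ := mem_nbrs.1 hq
    obtain ⟨d, hdS, hNS⟩ := exists_eq_insert_of_card (S := {u, p, q}) (N := N) (by
      intro z; simp only [Finset.mem_insert, Finset.mem_singleton]
      rintro (rfl | rfl | rfl) <;> assumption) (by
      rw [Finset.card_insert_of_notMem (by simp [up.ne, uq.ne]), Finset.card_pair hpq, hd])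
    have hdN : d ∈ N := by rw [hNS]; simp
    simp only [Finset.mem_insert, Finset.mem_singleton, not_or] at hdS
    obtain ⟨hdu, hdp, hdq⟩ := hdS
    have hud : ¬ F.Adj u d := fun h => by
      have : d ∈ nbrs F N u := mem_nbrs.2 ⟨hdN, h⟩
      rw [hL] at this
      simp only [Finset.mem_insert, Finset.mem_singleton] at this
      tauto
    have hmem : ∀ w ∈ W, F.Adj v w → w = d ∨ w = u ∨ w = p ∨ w = q := by
      intro w hw hvw
      simpa using mem hNS w hw hvw
    have fud := far u hu d (Ne.symm hdu) hud
    have fqp := mem_rest_comm (mW q hqN) fpq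
    by_cases h1 : F.Adj d p <;> by_cases h2 : F.Adj d q
    · exact C.four_cycle hmin hv hu hpN hdN hqN (fun w hw h => by have := hmem w hw h; tauto)
        up h1.symm h2 uq.symm fud fpq
    · exact C.four_path hmin hv hqN hu hpN hdN (fun w hw h => by have := hmem w hw h; tauto)
        uq.symm up h1.symm fqp (far q hqN d (Ne.symm hdq) fun h => h2 h.symm) fud
    · exact C.four_path hmin hv hpN hu hqN hdN (fun w hw h => by have := hmem w hw h; tauto)
        up.symm uq h2.symm fpq (far p hpN d (Ne.symm hdp) fun h => h1 h.symm) fud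
    · exact C.four_short_path hmin hv hpN hu hqN hdN
        (fun w hw h => by have := hmem w hw h; tauto) up.symm uq fpq
        (far p hpN d (Ne.symm hdp) fun h => h1 h.symm) fud
        (far q hqN d (Ne.symm hdq) fun h => h2 h.symm)
  push Not at hB
  obtain ⟨u, hu, a, ha, hua, hL⟩ := exists_pair_no_other_adj (F := F) (N := N) (by omega)
    fun u hu => by have := hB u hu; omega
  obtain ⟨c, d, hcS, hdS, hcd, hNS⟩ := exists_eq_pair_of_card (S := {u, a}) (N := N) (by
    intro z; simp only [Finset.mem_insert, Finset.mem_singleton]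
    rintro (rfl | rfl) <;> assumption) (by rw [Finset.card_pair hua, hd])
  have hcN : c ∈ N := by rw [hNS]; simp
  have hdN : d ∈ N := by rw [hNS]; simp
  simp only [Finset.mem_insert, Finset.mem_singleton, not_or] at hcS hdS
  have hmem : ∀ w ∈ W, F.Adj v w → w = u ∨ w = a ∨ w = c ∨ w = d := by
    intro w hw hvw
    have : w = c ∨ w = d ∨ w = u ∨ w = a := by simpa using mem hNS w hw hvw
    tauto
  have hc' := hL c hcN hcS.1 hcS.2
  have hd' := hL d hdN hdS.1 hdS.2
  have f1 := far u hu c (Ne.symm hcS.1) hc'.1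
  have f2 := far u hu d (Ne.symm hdS.1) hd'.1
  have f3 := far a ha c (Ne.symm hcS.2) hc'.2
  have f4 := far a ha d (Ne.symm hdS.2) hd'.2
  by_cases h : F.Adj c d
  · by_cases h' : F.Adj u a
    · exact C.four_two_edges hmin hv hu ha hcN hdN hmem h' h f1 f2 f3 f4
    · exact C.four_sparse hmin hv hcN hdN hu ha (fun w hw h => by have := hmem w hw h; tauto) hcd
        (mem_rest_comm (mW c hcN) f1) (mem_rest_comm (mW c hcN) f3) (mem_rest_comm (mW d hdN) f2)
        (mem_rest_comm (mW d hdN) f4) (far u hu a hua h')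
  · exact C.four_sparse hmin hv hu ha hcN hdN hmem hua f1 f2 f3 f4 (far c hcN d hcd h)

/-! ### Degree five -/

/-- A deletion of the five neighbours of `v` in the given order. -/
theorem five_contra (C : Critical F b y X W)
    {v u₁ u₂ u₃ u₄ u₅ : V} (hv : v ∈ W) (h1 : u₁ ∈ nbrs F W v)
    (h2 : u₂ ∈ nbrs F W v) (h3 : u₃ ∈ nbrs F W v) (h4 : u₄ ∈ nbrs F W v) (h5 : u₅ ∈ nbrs F W v)
    (hN : ∀ w ∈ W, F.Adj v w → w = u₁ ∨ w = u₂ ∨ w = u₃ ∨ w = u₄ ∨ w = u₅)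
    (h12 : u₁ ≠ u₂) (h13 : u₁ ≠ u₃) (h23 : u₂ ≠ u₃) (h14 : u₁ ≠ u₄)
    (h24 : u₂ ≠ u₄) (h34 : u₃ ≠ u₄) (h15 : u₁ ≠ u₅) (h25 : u₂ ≠ u₅) (h35 : u₃ ≠ u₅)
    (h45 : u₄ ≠ u₅) {c₁ c₂ c₃ c₄ c₅ : ℝ} (t1 : b (rest F W u₁ \ ∅) ≤ c₁ * X)
    (t2 : b (rest F W u₂ \ {u₁}) ≤ c₂ * X) (t3 : b (rest F W u₃ \ {u₂, u₁}) ≤ c₃ * X)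
    (t4 : b (rest F W u₄ \ {u₃, u₂, u₁}) ≤ c₄ * X)
    (t5 : b (rest F W u₅ \ {u₄, u₃, u₂, u₁}) ≤ c₅ * X) (hc : c₁ + c₂ + c₃ + c₄ + c₅ ≤ 1) :
    False := by
  rw [mem_nbrs] at h1 h2 h3 h4 h5
  have s := C.seq_five h1.1 h2.1 h3.1 h4.1 h5.1 h12 h13 h23 h14 h24 h34 h15 h25 h35 h45
  have s0 := C.branching.sdiff_nonpos (S := {u₅, u₄, u₃, u₂, u₁}) hv
    (by simp [h1.2.ne, h2.2.ne, h3.2.ne, h4.2.ne, h5.2.ne]) (by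
      intro z hz
      rw [mem_nbrs] at hz
      have := hN z hz.1 hz.2
      simp only [Finset.mem_insert, Finset.mem_singleton]
      tauto)
  exact C.contra (c := c₁ + c₂ + c₃ + c₄ + c₅) (by linarith) hc

/-- The nonadjacent leaves gain one vertex each from all earlier ones, so the costs are `y ^ 6, y ^
7, y ^ 8, y ^ 9`, followed by `y ^ 6` for the centre. -/
theorem five_star (C : Critical F b y X W)
    (hdeg : ∀ u ∈ W, (nbrs F W u).card = 5) {v c l₁ l₂ l₃ l₄ : V} (hv : v ∈ W)
    (hc : c ∈ nbrs F W v) (h1 : l₁ ∈ nbrs F W v) (h2 : l₂ ∈ nbrs F W v) (h3 : l₃ ∈ nbrs F W v)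
    (h4 : l₄ ∈ nbrs F W v)
    (hN : ∀ w ∈ W, F.Adj v w → w = l₁ ∨ w = l₂ ∨ w = l₃ ∨ w = l₄ ∨ w = c)
    (c1 : c ≠ l₁) (c2 : c ≠ l₂) (c3 : c ≠ l₃) (c4 : c ≠ l₄) (f12 : l₁ ∈ rest F W l₂)
    (f13 : l₁ ∈ rest F W l₃) (f14 : l₁ ∈ rest F W l₄) (f23 : l₂ ∈ rest F W l₃)
    (f24 : l₂ ∈ rest F W l₄) (f34 : l₃ ∈ rest F W l₄) : False := by
  obtain ⟨-, -, p6, p7, p8, p9, -⟩ := C.pows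
  obtain ⟨y1, y2, y3, y4⟩ := C.bounds
  have mW : ∀ z ∈ nbrs F W v, z ∈ W := fun z hz => (mem_nbrs.1 hz).1
  have dg : ∀ z ∈ nbrs F W v, 5 ≤ (nbrs F W z).card := fun z hz => (hdeg z (mW z hz)).ge
  have n12 : l₁ ≠ l₂ := (mem_rest.1 f12).2.1
  have n13 : l₁ ≠ l₃ := (mem_rest.1 f13).2.1
  have n14 : l₁ ≠ l₄ := (mem_rest.1 f14).2.1
  have n23 : l₂ ≠ l₃ := (mem_rest.1 f23).2.1
  have n24 : l₂ ≠ l₄ := (mem_rest.1 f24).2.1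
  have n34 : l₃ ≠ l₄ := (mem_rest.1 f34).2.1
  exact C.five_contra hv h1 h2 h3 h4 hc hN n12 n13 n23 n14 n24 n34 c1.symm c2.symm c3.symm c4.symm
    (C.cost_zero (mW _ h1) 5 (dg _ h1))
    (C.cost_one (mW _ h2) 5 (dg _ h2) (by simp) f12)
    (C.cost_two (mW _ h3) 5 (dg _ h3) n12 (by simp) (by simp) f13 f23)
    (C.cost_three (mW _ h4) 5 (dg _ h4) n12 n13 n23 (by simp) (by simp) (by simp) f14 f24 f34)
    (C.cost_zero (mW _ hc) 5 (dg _ hc)) (by norm_num [p6, p7, p8, p9]; linarith)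

/-- The neighbourhood is the complete bipartite graph with parts `{a, a'}` and `{c, d, e}`. -/
theorem five_bipartite (C : Critical F b y X W)
    (hdeg : ∀ u ∈ W, (nbrs F W u).card = 5) {v a a' c d e : V} (hv : v ∈ W)
    (ha : a ∈ nbrs F W v) (ha' : a' ∈ nbrs F W v) (hc : c ∈ nbrs F W v) (hd : d ∈ nbrs F W v)
    (he : e ∈ nbrs F W v)
    (hN : ∀ w ∈ W, F.Adj v w → w = a ∨ w = a' ∨ w = c ∨ w = d ∨ w = e)
    (faa : a ∈ rest F W a') (fcd : c ∈ rest F W d) (fce : c ∈ rest F W e) (fde : d ∈ rest F W e)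
    (ac : F.Adj a c) (ad : F.Adj a d) (ae : F.Adj a e) (ac' : F.Adj a' c) (ad' : F.Adj a' d)
    (ae' : F.Adj a' e) : False := by
  obtain ⟨-, -, p6, p7, p8, -⟩ := C.pows
  obtain ⟨y1, y2, y3, y4⟩ := C.bounds
  have mW : ∀ z ∈ nbrs F W v, z ∈ W := fun z hz => (mem_nbrs.1 hz).1
  have dg : ∀ z ∈ nbrs F W v, 5 ≤ (nbrs F W z).card := fun z hz => (hdeg z (mW z hz)).ge
  have naa : a ≠ a' := (mem_rest.1 faa).2.1
  have ncd : c ≠ d := (mem_rest.1 fcd).2.1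
  have nce : c ≠ e := (mem_rest.1 fce).2.1
  have nde : d ≠ e := (mem_rest.1 fde).2.1
  have c1 := card_rest (F := F) (mW a ha)
  have d1 := hdeg a (mW a ha)
  rw [mem_nbrs] at ha ha' hc hd he
  exact C.five_contra hv (mem_nbrs.2 ha) (mem_nbrs.2 ha') (mem_nbrs.2 hc) (mem_nbrs.2 hd)
    (mem_nbrs.2 he) hN naa ac.ne ac'.ne ad.ne ad'.ne ncd ae.ne ae'.ne nce nde
    -- In the term of `a` the vertex `a'` has lost `v, c, d, e` and is a leaf; this lowers the first
    -- cost from `y ^ 6` to `y ^ 8`.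
    (C.cost_leaf ha.1 (k := 6) (by rw [Finset.sdiff_empty]; omega) (mem_rest_comm ha'.1 faa)
      (by simp) {v, c, d, e} (by
        intro z; simp only [Finset.mem_insert, Finset.mem_singleton, mem_nbrs]
        rintro (rfl | rfl | rfl | rfl)
        exacts [⟨hv, ha'.2.symm⟩, ⟨hc.1, ac'⟩, ⟨hd.1, ad'⟩, ⟨he.1, ae'⟩]) (by
        intro z; simp only [Finset.mem_insert, Finset.mem_singleton]
        rintro (rfl | rfl | rfl | rfl)
        exacts [Or.inr (Or.inl ha.2.symm), Or.inr (Or.inl ac), Or.inr (Or.inl ad),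
          Or.inr (Or.inl ae)]) (by
        rw [Finset.card_insert_of_notMem (by simp [hc.2.ne, hd.2.ne, he.2.ne]),
          Finset.card_insert_of_notMem (by simp [ncd, nce]), Finset.card_pair nde]
        exact (hdeg a' ha'.1).le))
    (C.cost_one ha'.1 5 (dg _ (mem_nbrs.2 ha')) (by simp) faa)
    (C.cost_zero hc.1 5 (dg _ (mem_nbrs.2 hc)))
    (C.cost_one hd.1 5 (dg _ (mem_nbrs.2 hd)) (by simp) fcd)
    (C.cost_two he.1 5 (dg _ (mem_nbrs.2 he)) ncd (by simp) (by simp) fce fde)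
    (by norm_num [p6, p7, p8]; linarith)

/-- The neighbourhood is the complete bipartite graph with parts `{a, a'}` and `{c, d, e}` without
the edge between `a` and `e`. -/
theorem five_bipartite_minus (C : Critical F b y X W)
    (hdeg : ∀ u ∈ W, (nbrs F W u).card = 5) {v a a' c d e : V}
    (hv : v ∈ W)
    (ha : a ∈ nbrs F W v) (ha' : a' ∈ nbrs F W v) (hc : c ∈ nbrs F W v) (hd : d ∈ nbrs F W v)
    (he : e ∈ nbrs F W v)
    (hN : ∀ w ∈ W, F.Adj v w → w = a ∨ w = a' ∨ w = c ∨ w = d ∨ w = e)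
    (faa : a ∈ rest F W a') (fcd : c ∈ rest F W d) (fce : c ∈ rest F W e) (fde : d ∈ rest F W e)
    (fae : a ∈ rest F W e)
    (ac : F.Adj a c) (ad : F.Adj a d) (ac' : F.Adj a' c) (ad' : F.Adj a' d)
    (ae' : F.Adj a' e) : False := by
  obtain ⟨-, -, p6, p7, p8, p9, p10, -⟩ := C.pows
  obtain ⟨y1, y2, y3, y4⟩ := C.bounds
  have mW : ∀ z ∈ nbrs F W v, z ∈ W := fun z hz => (mem_nbrs.1 hz).1
  have dg : ∀ z ∈ nbrs F W v, 5 ≤ (nbrs F W z).card := fun z hz => (hdeg z (mW z hz)).ge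
  have naa : a ≠ a' := (mem_rest.1 faa).2.1
  have nae : a ≠ e := (mem_rest.1 fae).2.1
  have va := (mem_nbrs.1 ha).2
  have va' := (mem_nbrs.1 ha').2
  -- In the term of `c` the vertex `d` has lost `v, a, a'` and keeps at most two neighbours. The
  -- gain suffices, so `d` lies in an isolated triangle there; by symmetry the same holds for `c` in
  -- the term of `d`.
  have half : ∀ c d : V, c ∈ nbrs F W v → d ∈ nbrs F W v →
      (∀ w ∈ W, F.Adj v w → w = a ∨ w = a' ∨ w = c ∨ w = d ∨ w = e) →
      c ∈ rest F W d → c ∈ rest F W e → d ∈ rest F W e → F.Adj a c → F.Adj a d → F.Adj a' c →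
      F.Adj a' d → ∃ p q, IsolatedTriangle F (rest F W c \ ∅) d p q := by
    intro c d hc hd hN fcd fce fde ac ad ac' ad'
    have ncd : c ≠ d := (mem_rest.1 fcd).2.1
    have nce : c ≠ e := (mem_rest.1 fce).2.1
    have nde : d ≠ e := (mem_rest.1 fde).2.1
    have c1 := card_rest (F := F) (mW c hc)
    have d1 := hdeg c (mW c hc)
    have vc := (mem_nbrs.1 hc).2
    have vd := (mem_nbrs.1 hd).2
    refine (C.cost_deg_two (mW c hc) (S := ∅) (k := 6) (by rw [Finset.sdiff_empty]; omega)
      (mem_rest_comm (mW d hd) fcd) (by simp) {v, a, a'} (by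
        intro z; simp only [Finset.mem_insert, Finset.mem_singleton, mem_nbrs]
        rintro (rfl | rfl | rfl)
        exacts [⟨hv, vd.symm⟩, ⟨mW _ ha, ad.symm⟩, ⟨mW _ ha', ad'.symm⟩]) (by
        intro z; simp only [Finset.mem_insert, Finset.mem_singleton]
        rintro (rfl | rfl | rfl)
        exacts [Or.inr (Or.inl vc.symm), Or.inr (Or.inl ac.symm), Or.inr (Or.inl ac'.symm)]) (by
        rw [Finset.card_insert_of_notMem (by simp [va.ne, va'.ne]), Finset.card_pair naa]
        exact (hdeg d (mW d hd)).le)).resolve_left fun t => ?_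
    exact C.five_contra hv hc hd he ha ha' (fun w hw h => by have := hN w hw h; tauto) ncd nce nde
      ac.ne' ad.ne' nae.symm ac'.ne' ad'.ne' ae'.ne' naa t
      (C.cost_one (mW _ hd) 5 (dg _ hd) (by simp) fcd)
      (C.cost_two (mW _ he) 5 (dg _ he) ncd (by simp) (by simp) fce fde)
      (C.cost_one (mW _ ha) 5 (dg _ ha) (by simp) (mem_rest_comm (mW _ he) fae))
      (C.cost_one (mW _ ha') 5 (dg _ ha') (by simp) faa)
      (by norm_num [p7, p8, p9, p10]; linarith)
  have fdc := mem_rest_comm (mW d hd) fcd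
  obtain ⟨p, q, tr1⟩ := half c d hc hd hN fcd fce fde ac ad ac' ad'
  obtain ⟨w, w', tr2⟩ := half d c hd hc (fun w hw h => by have := hN w hw h; tauto) fdc fde fce
    ad ac ad' ac'
  have vc := (mem_nbrs.1 hc).2
  have vd := (mem_nbrs.1 hd).2
  have nbr5 : ∀ u u' p q : V, u ∈ W → F.Adj v u → F.Adj a u → F.Adj a' u → F.Adj v u' →
      F.Adj a u' → F.Adj a' u' → IsolatedTriangle F (rest F W u' \ ∅) u p q → ∀ r ∈ W, F.Adj u r →
      r = v ∨ r = a' ∨ r ∈ ({a} : Finset V) ∨ r = p ∨ r = q := by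
    intro u u' p q hu vu au au' vu' au'' au''' t r hr hur
    have lp := mem_rest.1 (Finset.mem_sdiff.1 t.left_mem).1
    have lq := mem_rest.1 (Finset.mem_sdiff.1 t.right_mem).1
    have ne : ∀ z, ¬ F.Adj u' z → z ∉ ({v, a, a'} : Finset V) := by
      intro z hz
      simp only [Finset.mem_insert, Finset.mem_singleton]
      rintro (rfl | rfl | rfl)
      exacts [hz vu'.symm, hz au''.symm, hz au'''.symm]
    by_cases hrA : r ∈ ({v, a, a'} : Finset V)
    · simp only [Finset.mem_insert, Finset.mem_singleton] at hrA ⊢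
      tauto
    · have := eq_of_two_outside (F := F) (A := {v, a, a'}) (u := u) (by
          intro z; simp only [Finset.mem_insert, Finset.mem_singleton, mem_nbrs]
          rintro (rfl | rfl | rfl)
          exacts [⟨hv, vu.symm⟩, ⟨mW _ ha, au.symm⟩, ⟨mW _ ha', au'.symm⟩])
        (by
          rw [Finset.card_insert_of_notMem (by simp [va.ne, va'.ne]), Finset.card_pair naa]
          exact (hdeg u hu).le) (mem_nbrs.2 ⟨lp.1, t.adj_left⟩)
        (mem_nbrs.2 ⟨lq.1, t.adj_right⟩) t.adj.ne (ne p lp.2.2) (ne q lq.2.2)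
        (mem_nbrs.2 ⟨hr, hur⟩) hrA
      tauto
  -- Here `a` plays the role of the extra common neighbour in `E`. Neighbours of `a'` in both
  -- triangles would give `a'` degree six.
  refine C.not_two_triangles (E := {a}) (v := v) (c := a') (mW c hc) (mW d hd)
    (fun u hu => (hdeg u hu).ge)
    (nbr5 c d w w' (mW c hc) vc ac ac' vd ad ad' tr2)
    (nbr5 d c p q (mW d hd) vd ad ad' vc ac ac' tr1) tr1 tr2 ?_ ?_ ?_
  · intro r hr hdr hvr
    rw [mem_rest] at hr
    rcases hN r hr.1 hvr with rfl | rfl | rfl | rfl | rfl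
    exacts [hr.2.2 ac.symm, hr.2.2 ac'.symm, hr.2.1 rfl, F.loopless.irrefl _ hdr,
      (mem_rest.1 fde).2.2 hdr.symm]
  · intro r hr hcr hvr
    rw [mem_rest] at hr
    rcases hN r hr.1 hvr with rfl | rfl | rfl | rfl | rfl
    exacts [hr.2.2 ad.symm, hr.2.2 ad'.symm, F.loopless.irrefl _ hcr, hr.2.1 rfl,
      (mem_rest.1 fce).2.2 hcr.symm]
  · intro r hr s hs hdr hcs hra hsa
    rw [mem_rest] at hr hs
    have ncd : c ≠ d := (mem_rest.1 fcd).2.1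
    have nce : c ≠ e := (mem_rest.1 fce).2.1
    have nde : d ≠ e := (mem_rest.1 fde).2.1
    have hsub : ({v, c, d, e, r, s} : Finset V) ⊆ nbrs F W a' := by
      intro z
      simp only [Finset.mem_insert, Finset.mem_singleton, mem_nbrs]
      rintro (rfl | rfl | rfl | rfl | rfl | rfl)
      exacts [⟨hv, va'.symm⟩, ⟨mW _ hc, ac'⟩, ⟨mW _ hd, ad'⟩, ⟨mW _ he, ae'⟩, ⟨hr.1, hra.symm⟩,
        ⟨hs.1, hsa.symm⟩]
    have hrv : r ≠ v := by rintro rfl; exact hr.2.2 vc.symm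
    have hsv : s ≠ v := by rintro rfl; exact hs.2.2 vd.symm
    have hrs : r ≠ s := by rintro rfl; exact hr.2.2 hcs
    have hre : r ≠ e := by rintro rfl; exact (mem_rest.1 fde).2.2 hdr.symm
    have hse : s ≠ e := by rintro rfl; exact (mem_rest.1 fce).2.2 hcs.symm
    have hcard : ({v, c, d, e, r, s} : Finset V).card = 6 := by
      rw [Finset.card_insert_of_notMem, Finset.card_insert_of_notMem,
        Finset.card_insert_of_notMem, Finset.card_insert_of_notMem, Finset.card_pair hrs]
      · simp [hre.symm, hse.symm]
      · simp [nde, hdr.ne, hs.2.1.symm]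
      · simp [ncd, nce, hr.2.1.symm, hcs.ne]
      · simp [vc.ne, vd.ne, (mem_nbrs.1 he).2.ne, hrv.symm, hsv.symm]
    have := Finset.card_le_card hsub
    have := hdeg a' (mW a' ha')
    omega

/-- One neighbour `e` of `v` is adjacent to at most one of the leaves of a star. -/
theorem five_near_star (C : Critical F b y X W)
    (hdeg : ∀ u ∈ W, (nbrs F W u).card = 5) {v c l₁ l₂ l₃ e : V} (hv : v ∈ W)
    (hc : c ∈ nbrs F W v) (h1 : l₁ ∈ nbrs F W v) (h2 : l₂ ∈ nbrs F W v) (h3 : l₃ ∈ nbrs F W v)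
    (he : e ∈ nbrs F W v)
    (hN : ∀ w ∈ W, F.Adj v w → w = c ∨ w = e ∨ w = l₁ ∨ w = l₂ ∨ w = l₃)
    (c1 : c ≠ l₁) (c2 : c ≠ l₂) (c3 : c ≠ l₃) (e3 : e ≠ l₃) (fce : c ∈ rest F W e)
    (f12 : l₁ ∈ rest F W l₂)
    (f13 : l₁ ∈ rest F W l₃) (f23 : l₂ ∈ rest F W l₃) (f1e : e ∈ rest F W l₁)
    (f2e : e ∈ rest F W l₂) : False := by
  obtain ⟨-, -, p6, p7, p8, -⟩ := C.pows
  obtain ⟨y1, y2, y3, y4⟩ := C.bounds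
  have mW : ∀ z ∈ nbrs F W v, z ∈ W := fun z hz => (mem_nbrs.1 hz).1
  have dg : ∀ z ∈ nbrs F W v, 5 ≤ (nbrs F W z).card := fun z hz => (hdeg z (mW z hz)).ge
  have n12 : l₁ ≠ l₂ := (mem_rest.1 f12).2.1
  have n13 : l₁ ≠ l₃ := (mem_rest.1 f13).2.1
  have n23 : l₂ ≠ l₃ := (mem_rest.1 f23).2.1
  have nce : c ≠ e := (mem_rest.1 fce).2.1
  have n1e : e ≠ l₁ := (mem_rest.1 f1e).2.1
  have n2e : e ≠ l₂ := (mem_rest.1 f2e).2.1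
  exact C.five_contra hv hc he h1 h2 h3 hN nce c1 n1e c2 n2e n12 c3 e3 n13 n23
    (C.cost_zero (mW _ hc) 5 (dg _ hc))
    (C.cost_one (mW _ he) 5 (dg _ he) (by simp) fce)
    (C.cost_one (mW _ h1) 5 (dg _ h1) (by simp) f1e)
    (C.cost_two (mW _ h2) 5 (dg _ h2) n1e.symm (by simp) (by simp) f12 f2e)
    (C.cost_two (mW _ h3) 5 (dg _ h3) n12 (by simp) (by simp) f13 f23)
    (by norm_num [p6, p7, p8]; linarith)

/-- Deleting in the order `c, e, f, l₁, l₂` costs `y ^ 6 + 2 * y ^ 7 + 2 * y ^ 8 < 1`. The last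
hypothesis decides whether the second gain before `l₂` occurs at `f` or at `l₁`. -/
theorem five_degree_two (C : Critical F b y X W)
    (hdeg : ∀ u ∈ W, (nbrs F W u).card = 5) {v c l₁ l₂ e f : V} (hv : v ∈ W)
    (hc : c ∈ nbrs F W v) (h1 : l₁ ∈ nbrs F W v) (h2 : l₂ ∈ nbrs F W v) (he : e ∈ nbrs F W v)
    (hf : f ∈ nbrs F W v)
    (hN : ∀ w ∈ W, F.Adj v w → w = c ∨ w = e ∨ w = f ∨ w = l₁ ∨ w = l₂)
    (c1 : c ≠ l₁) (c2 : c ≠ l₂) (nef : e ≠ f) (ne1 : e ≠ l₁) (nf1 : f ≠ l₁) (ne2 : e ≠ l₂)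
    (nf2 : f ≠ l₂) (fce : c ∈ rest F W e) (fcf : c ∈ rest F W f) (f12 : l₁ ∈ rest F W l₂)
    (hl1 : e ∈ rest F W l₁ ∨ f ∈ rest F W l₁) (hl2 : e ∈ rest F W l₂ ∨ f ∈ rest F W l₂)
    (h : e ∈ rest F W f ∨ (e ∈ rest F W l₁ ∧ f ∈ rest F W l₁)) : False := by
  obtain ⟨-, -, p6, p7, p8, -⟩ := C.pows
  obtain ⟨y1, y2, y3, y4⟩ := C.bounds
  have mW : ∀ z ∈ nbrs F W v, z ∈ W := fun z hz => (mem_nbrs.1 hz).1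
  have dg : ∀ z ∈ nbrs F W v, 5 ≤ (nbrs F W z).card := fun z hz => (hdeg z (mW z hz)).ge
  have n12 : l₁ ≠ l₂ := (mem_rest.1 f12).2.1
  have nce : c ≠ e := (mem_rest.1 fce).2.1
  have ncf : c ≠ f := (mem_rest.1 fcf).2.1
  have t1 : b (rest F W c \ ∅) ≤ y ^ 6 * X := C.cost_zero (mW _ hc) 5 (dg _ hc)
  have t2 : b (rest F W e \ {c}) ≤ y ^ 7 * X := C.cost_one (mW _ he) 5 (dg _ he) (by simp) fce
  have t5 : b (rest F W l₂ \ {l₁, f, e, c}) ≤ y ^ 8 * X := by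
    rcases hl2 with h' | h'
    · exact C.cost_two (mW _ h2) 5 (dg _ h2) (a := l₁) (c := e) ne1.symm (by simp) (by simp) f12 h'
    · exact C.cost_two (mW _ h2) 5 (dg _ h2) (a := l₁) (c := f) nf1.symm (by simp) (by simp) f12 h'
  rcases h with h | h
  · have t3 : b (rest F W f \ {e, c}) ≤ y ^ 8 * X :=
      C.cost_two (mW _ hf) 5 (dg _ hf) nce (by simp) (by simp) fcf h
    have t4 : b (rest F W l₁ \ {f, e, c}) ≤ y ^ 7 * X := by
      rcases hl1 with h' | h'
      · exact C.cost_one (mW _ h1) 5 (dg _ h1) (a := e) (by simp) h'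
      · exact C.cost_one (mW _ h1) 5 (dg _ h1) (a := f) (by simp) h'
    exact C.five_contra hv hc he hf h1 h2 hN nce ncf nef c1 ne1 nf1 c2 ne2 nf2 n12 t1 t2 t3 t4 t5
      (by norm_num [p6, p7, p8]; linarith)
  · have t3 : b (rest F W f \ {e, c}) ≤ y ^ 7 * X :=
      C.cost_one (mW _ hf) 5 (dg _ hf) (by simp) fcf
    have t4 : b (rest F W l₁ \ {f, e, c}) ≤ y ^ 8 * X :=
      C.cost_two (mW _ h1) 5 (dg _ h1) nef (by simp) (by simp) h.1 h.2
    exact C.five_contra hv hc he hf h1 h2 hN nce ncf nef c1 ne1 nf1 c2 ne2 nf2 n12 t1 t2 t3 t4 t5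
      (by norm_num [p6, p7, p8]; linarith)

/-- Deleting `c` first saves one vertex for each of `e, f, h`; these three then save three vertices
for `l`, which is deleted last. -/
theorem five_sparse (C : Critical F b y X W)
    (hdeg : ∀ u ∈ W, (nbrs F W u).card = 5) {v c l e f h : V} (hv : v ∈ W)
    (hc : c ∈ nbrs F W v) (hl : l ∈ nbrs F W v) (he : e ∈ nbrs F W v) (hf : f ∈ nbrs F W v)
    (hh : h ∈ nbrs F W v)
    (hN : ∀ w ∈ W, F.Adj v w → w = c ∨ w = e ∨ w = f ∨ w = h ∨ w = l) (ncl : c ≠ l)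
    (nef : e ≠ f) (neh : e ≠ h) (nfh : f ≠ h) (fce : c ∈ rest F W e) (fcf : c ∈ rest F W f)
    (fch : c ∈ rest F W h) (fle : e ∈ rest F W l) (flf : f ∈ rest F W l)
    (flh : h ∈ rest F W l) : False := by
  obtain ⟨-, -, p6, p7, -, p9, -⟩ := C.pows
  obtain ⟨y1, y2, y3, y4⟩ := C.bounds
  have mW : ∀ z ∈ nbrs F W v, z ∈ W := fun z hz => (mem_nbrs.1 hz).1
  have dg : ∀ z ∈ nbrs F W v, 5 ≤ (nbrs F W z).card := fun z hz => (hdeg z (mW z hz)).ge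
  exact C.five_contra hv hc he hf hh hl hN (mem_rest.1 fce).2.1 (mem_rest.1 fcf).2.1 nef
    (mem_rest.1 fch).2.1 neh nfh ncl (mem_rest.1 fle).2.1 (mem_rest.1 flf).2.1 (mem_rest.1 flh).2.1
    (C.cost_zero (mW _ hc) 5 (dg _ hc))
    (C.cost_one (mW _ he) 5 (dg _ he) (by simp) fce)
    (C.cost_one (mW _ hf) 5 (dg _ hf) (by simp) fcf)
    (C.cost_one (mW _ hh) 5 (dg _ hh) (by simp) fch)
    (C.cost_three (mW _ hl) 5 (dg _ hl) nef neh nfh (by simp) (by simp) (by simp) fle flf flh)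
    (by norm_num [p6, p7, p9]; linarith)

end Critical

end Critical

/-! ### Degree five: the neighbourhood is a five-cycle -/

section Critical

variable {V : Type*} [DecidableEq V] {F : SimpleGraph V} [DecidableRel F.Adj]

/-- The neighbours of `v` in `W` form a cycle of length five. -/
structure LinkCycle (F : SimpleGraph V) [DecidableRel F.Adj] (W : Finset V)
    (v u₁ u₂ u₃ u₄ u₅ : V) : Prop where
  mem₁ : u₁ ∈ nbrs F W v
  mem₂ : u₂ ∈ nbrs F W v
  mem₃ : u₃ ∈ nbrs F W v
  mem₄ : u₄ ∈ nbrs F W v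
  mem₅ : u₅ ∈ nbrs F W v
  eq_of_adj : ∀ w ∈ W, F.Adj v w → w = u₁ ∨ w = u₂ ∨ w = u₃ ∨ w = u₄ ∨ w = u₅
  adj₁₂ : F.Adj u₁ u₂
  adj₂₃ : F.Adj u₂ u₃
  adj₃₄ : F.Adj u₃ u₄
  adj₄₅ : F.Adj u₄ u₅
  adj₅₁ : F.Adj u₅ u₁
  far₁₃ : u₁ ∈ rest F W u₃
  far₂₄ : u₂ ∈ rest F W u₄
  far₃₅ : u₃ ∈ rest F W u₅
  far₄₁ : u₄ ∈ rest F W u₁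
  far₅₂ : u₅ ∈ rest F W u₂

namespace LinkCycle

variable {W : Finset V} {v u₁ u₂ u₃ u₄ u₅ : V}

theorem rotate (L : LinkCycle F W v u₁ u₂ u₃ u₄ u₅) : LinkCycle F W v u₂ u₃ u₄ u₅ u₁ where
  mem₁ := L.mem₂
  mem₂ := L.mem₃
  mem₃ := L.mem₄
  mem₄ := L.mem₅
  mem₅ := L.mem₁
  eq_of_adj w hw h := by have := L.eq_of_adj w hw h; tauto
  adj₁₂ := L.adj₂₃
  adj₂₃ := L.adj₃₄
  adj₃₄ := L.adj₄₅
  adj₄₅ := L.adj₅₁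
  adj₅₁ := L.adj₁₂
  far₁₃ := L.far₂₄
  far₂₄ := L.far₃₅
  far₃₅ := L.far₄₁
  far₄₁ := L.far₅₂
  far₅₂ := L.far₁₃

theorem mirror (L : LinkCycle F W v u₁ u₂ u₃ u₄ u₅) : LinkCycle F W v u₄ u₃ u₂ u₁ u₅ where
  mem₁ := L.mem₄
  mem₂ := L.mem₃
  mem₃ := L.mem₂
  mem₄ := L.mem₁
  mem₅ := L.mem₅
  eq_of_adj w hw h := by have := L.eq_of_adj w hw h; tauto
  adj₁₂ := L.adj₃₄.symm
  adj₂₃ := L.adj₂₃.symm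
  adj₃₄ := L.adj₁₂.symm
  adj₄₅ := L.adj₅₁.symm
  adj₅₁ := L.adj₄₅.symm
  far₁₃ := mem_rest_comm (mem_nbrs.1 L.mem₄).1 L.far₂₄
  far₂₄ := mem_rest_comm (mem_nbrs.1 L.mem₃).1 L.far₁₃
  far₃₅ := mem_rest_comm (mem_nbrs.1 L.mem₂).1 L.far₅₂
  far₄₁ := mem_rest_comm (mem_nbrs.1 L.mem₁).1 L.far₄₁
  far₅₂ := mem_rest_comm (mem_nbrs.1 L.mem₅).1 L.far₃₅

theorem card_three (L : LinkCycle F W v u₁ u₂ u₃ u₄ u₅) : ({v, u₁, u₄} : Finset V).card = 3 := by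
  have h1 := (mem_nbrs.1 L.mem₁).2.ne
  have h4 := (mem_nbrs.1 L.mem₄).2.ne
  rw [Finset.card_insert_of_notMem (by simp [h1, h4]),
    Finset.card_pair (mem_rest.1 L.far₄₁).2.1.symm]

theorem three_subset (L : LinkCycle F W v u₁ u₂ u₃ u₄ u₅)
    (hv : v ∈ W) : ({v, u₁, u₄} : Finset V) ⊆ nbrs F W u₅ := by
  intro z
  simp only [Finset.mem_insert, Finset.mem_singleton, mem_nbrs]
  rintro (rfl | rfl | rfl)
  exacts [⟨hv, (mem_nbrs.1 L.mem₅).2.symm⟩, ⟨(mem_nbrs.1 L.mem₁).1, L.adj₅₁⟩,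
    ⟨(mem_nbrs.1 L.mem₄).1, L.adj₄₅.symm⟩]

theorem not_adj (L : LinkCycle F W v u₁ u₂ u₃ u₄ u₅)
    {p : V} (hp : p ∈ W) (h5 : F.Adj u₅ p) (h1 : p ≠ u₁) (h4 : p ≠ u₄) :
    ¬ F.Adj v p := by
  intro h
  rcases L.eq_of_adj p hp h with rfl | rfl | rfl | rfl | rfl
  exacts [h1 rfl, (mem_rest.1 L.far₅₂).2.2 h5.symm, (mem_rest.1 L.far₃₅).2.2 h5, h4 rfl,
    F.loopless.irrefl _ h5]

end LinkCycle

namespace Critical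

variable {b : Finset V → ℝ} {y X : ℝ} {W : Finset V}

/-- After deleting `u₁`, the vertex `u₅` has lost `v, u₁, u₄` in the term of `u₃`. A gain there
would bring the total below `1`, so `u₅` and its two outer neighbours form an isolated triangle; `p`
is one of them, and all its further neighbours are `u₁` or adjacent to `u₃`. -/
theorem linkCycle_half (C : Critical F b y X W)
    (hdeg : ∀ u ∈ W, (nbrs F W u).card = 5) {v u₁ u₂ u₃ u₄ u₅ : V}
    (hv : v ∈ W) (L : LinkCycle F W v u₁ u₂ u₃ u₄ u₅) {p : V} (hp : p ∈ W) (h5p : F.Adj u₅ p)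
    (hpv : p ≠ v) (hp1 : p ≠ u₁) (hp4 : p ≠ u₄) :
    ¬ F.Adj u₃ p ∧ ∀ r ∈ W, F.Adj p r → r = u₅ ∨ (F.Adj u₅ r ∧ r ≠ v ∧ r ≠ u₁ ∧ r ≠ u₄) ∨
      r = u₁ ∨ F.Adj u₃ r := by
  obtain ⟨-, -, p6, p7, p8, -, p10, p11⟩ := C.pows
  obtain ⟨y1, y2, y3, y4⟩ := C.bounds
  have mW : ∀ z ∈ nbrs F W v, z ∈ W := fun z hz => (mem_nbrs.1 hz).1
  have mA : ∀ z ∈ nbrs F W v, F.Adj v z := fun z hz => (mem_nbrs.1 hz).2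
  have dg : ∀ z ∈ nbrs F W v, 5 ≤ (nbrs F W z).card := fun z hz => (hdeg z (mW z hz)).ge
  have n13 := (mem_rest.1 L.far₁₃).2.1
  have n24 := (mem_rest.1 L.far₂₄).2.1
  have n35 := (mem_rest.1 L.far₃₅).2.1
  have n41 := (mem_rest.1 L.far₄₁).2.1
  have n52 := (mem_rest.1 L.far₅₂).2.1
  have c3 := L.card_three
  have s3 := L.three_subset hv
  have f53 := mem_rest_comm (mW _ L.mem₅) L.far₃₅
  obtain ⟨s, t, T⟩ : ∃ s t, IsolatedTriangle F (rest F W u₃ \ {u₁}) u₅ s t := by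
    have hc := card_rest_sdiff_add_le (F := F) (R := {u₁}) (S := {u₁}) (mW _ L.mem₃) le_rfl
      (by simpa using mem_rest.1 L.far₁₃)
    rw [hdeg u₃ (mW _ L.mem₃), Finset.card_singleton] at hc
    refine (C.cost_deg_two (mW _ L.mem₃) (S := {u₁}) (k := 7) hc f53
      (by simpa using L.adj₅₁.ne) {v, u₁, u₄} s3 (by
        intro z; simp only [Finset.mem_insert, Finset.mem_singleton]
        rintro (rfl | rfl | rfl)
        exacts [Or.inr (Or.inl (mA _ L.mem₃).symm), Or.inr (Or.inr rfl),
          Or.inr (Or.inl L.adj₃₄)]) (by rw [hdeg u₅ (mW _ L.mem₅), c3])).resolve_left fun tt => ?_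
    exact C.five_contra hv L.mem₁ L.mem₃ L.mem₄ L.mem₅ L.mem₂
      (fun w hw h => by have := L.eq_of_adj w hw h; tauto) n13 n41.symm L.adj₃₄.ne L.adj₅₁.ne' n35
      L.adj₄₅.ne L.adj₁₂.ne L.adj₂₃.ne' n24.symm n52
      (C.cost_zero (mW _ L.mem₁) 5 (dg _ L.mem₁)) tt
      (C.cost_one (mW _ L.mem₄) 5 (dg _ L.mem₄) (by simp) (mem_rest_comm (mW _ L.mem₁) L.far₄₁))
      (C.cost_one (mW _ L.mem₅) 5 (dg _ L.mem₅) (by simp) L.far₃₅)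
      (C.cost_two (mW _ L.mem₂) 5 (dg _ L.mem₂) L.adj₄₅.ne (by simp) (by simp)
        (mem_rest_comm (mW _ L.mem₄) L.far₂₄) L.far₅₂)
      (by norm_num [p6, p7, p8, p10, p11]; linarith)
  have ne : ∀ z ∈ rest F W u₃ \ {u₁}, z ∉ ({v, u₁, u₄} : Finset V) := by
    intro z hz
    rw [Finset.mem_sdiff, mem_rest, Finset.mem_singleton] at hz
    simp only [Finset.mem_insert, Finset.mem_singleton]
    rintro (rfl | rfl | rfl)
    exacts [hz.1.2.2 (mA _ L.mem₃).symm, hz.2 rfl, hz.1.2.2 L.adj₃₄]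
  have hst : ∀ r ∈ W, F.Adj u₅ r → r ≠ v → r ≠ u₁ → r ≠ u₄ → r = s ∨ r = t := by
    intro r hr h5r hrv hr1 hr4
    exact eq_of_two_outside s3 (by rw [hdeg u₅ (mW _ L.mem₅), c3])
      (mem_nbrs.2 ⟨(mem_rest.1 (Finset.mem_sdiff.1 T.left_mem).1).1, T.adj_left⟩)
      (mem_nbrs.2 ⟨(mem_rest.1 (Finset.mem_sdiff.1 T.right_mem).1).1, T.adj_right⟩)
      T.adj.ne (ne _ T.left_mem) (ne _ T.right_mem) (mem_nbrs.2 ⟨hr, h5r⟩) (by simp [hrv, hr1, hr4])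
  have hpst := hst p hp h5p hpv hp1 hp4
  have hpT : p ∈ rest F W u₃ \ {u₁} := by
    rcases hpst with rfl | rfl
    exacts [T.left_mem, T.right_mem]
  have hp3 := (mem_rest.1 (Finset.mem_sdiff.1 hpT).1).2.2
  refine ⟨hp3, fun r hr hpr => ?_⟩
  by_cases hrT : r ∈ rest F W u₃ \ {u₁}
  · have hrn := ne r hrT
    simp only [Finset.mem_insert, Finset.mem_singleton, not_or] at hrn
    rcases hpst with rfl | rfl
    · rcases T.nbrs_left r hrT hpr with h | rfl
      exacts [Or.inl h, Or.inr (Or.inl ⟨T.adj_right, hrn⟩)]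
    · rcases T.nbrs_right r hrT hpr with h | rfl
      exacts [Or.inl h, Or.inr (Or.inl ⟨T.adj_left, hrn⟩)]
  · rw [Finset.mem_sdiff, mem_rest, Finset.mem_singleton] at hrT
    by_cases h3 : r = u₃
    · subst h3
      exact absurd hpr.symm hp3
    · tauto

/-- Combines `linkCycle_half` for the cycle and for its reflection fixing `u₅`, which exchanges `u₁`
with `u₄` and `u₂` with `u₃`. -/
theorem linkCycle_nbrs (C : Critical F b y X W)
    (hdeg : ∀ u ∈ W, (nbrs F W u).card = 5) {v u₁ u₂ u₃ u₄ u₅ : V}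
    (hv : v ∈ W) (L : LinkCycle F W v u₁ u₂ u₃ u₄ u₅) {p : V} (hp : p ∈ W) (h5p : F.Adj u₅ p)
    (hpv : p ≠ v) (hp1 : p ≠ u₁) (hp4 : p ≠ u₄) :
    ¬ F.Adj u₃ p ∧ ¬ F.Adj u₂ p ∧ ∀ r ∈ W, F.Adj p r →
      r = u₅ ∨ (F.Adj u₅ r ∧ r ≠ v ∧ r ≠ u₁ ∧ r ≠ u₄) ∨
      r = u₁ ∨ r = u₄ ∨ (F.Adj u₂ r ∧ F.Adj u₃ r ∧ r ≠ v) := by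
  obtain ⟨h3, h⟩ := C.linkCycle_half hdeg hv L hp h5p hpv hp1 hp4
  obtain ⟨h2, h'⟩ := C.linkCycle_half hdeg hv L.mirror hp h5p hpv hp4 hp1
  refine ⟨h3, h2, fun r hr hpr => ?_⟩
  have hrv : r ≠ v := by
    rintro rfl
    exact L.not_adj hp h5p hp1 hp4 hpr.symm
  have a := h r hr hpr
  have a' := h' r hr hpr
  tauto

/-- Otherwise an outer neighbour `p` of `u₅` could only be adjacent to `u₅`, to the other outer
neighbour of `u₅`, to `u₁` and to `u₄`, which is one neighbour too few. -/
theorem exists_linkCycle_common (C : Critical F b y X W)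
    (hdeg : ∀ u ∈ W, (nbrs F W u).card = 5) {v u₁ u₂ u₃ u₄ u₅ : V}
    (hv : v ∈ W) (L : LinkCycle F W v u₁ u₂ u₃ u₄ u₅) :
    ∃ z ∈ W, F.Adj u₂ z ∧ F.Adj u₃ z ∧ z ≠ v := by
  by_contra! hno
  have c3 := L.card_three
  have s3 := L.three_subset hv
  have h5 := (mem_nbrs.1 L.mem₅).1
  obtain ⟨p, q, hpS, hqS, hpq, hN⟩ := exists_eq_pair_of_card s3 (by rw [c3, hdeg u₅ h5])
  have hp : p ∈ nbrs F W u₅ := by rw [hN]; simp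
  obtain ⟨hpW, h5p⟩ := mem_nbrs.1 hp
  simp only [Finset.mem_insert, Finset.mem_singleton, not_or] at hpS
  obtain ⟨-, -, h⟩ := C.linkCycle_nbrs hdeg hv L hpW h5p hpS.1 hpS.2.1 hpS.2.2
  have hsub : nbrs F W p ⊆ {u₅, q, u₁, u₄} := by
    intro r hr
    obtain ⟨hr, hpr⟩ := mem_nbrs.1 hr
    simp only [Finset.mem_insert, Finset.mem_singleton]
    rcases h r hr hpr with h | ⟨h, hv, h1, h4⟩ | h | h | ⟨h, h', h''⟩
    · exact Or.inl h
    · have : r ∈ nbrs F W u₅ := mem_nbrs.2 ⟨hr, h⟩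
      rw [hN] at this
      simp only [Finset.mem_insert, Finset.mem_singleton] at this
      have := hpr.ne'
      tauto
    · tauto
    · tauto
    · exact absurd (hno r hr h h') h''
  have h1 := Finset.card_le_card hsub
  have h2 : ({u₅, q, u₁, u₄} : Finset V).card ≤ 4 := Finset.card_le_four
  rw [hdeg p hpW] at h1
  omega

/-- By rotation every edge of the cycle has a common neighbour besides `v`: let `z, a, p, c` belong
to `u₂u₃`, `u₄u₅`, `u₅u₁`, `u₁u₂`. The outer neighbours of `u₅` are `a, p` and those of `u₂` are `c,
z`; moreover `p` is not adjacent to `u₄`, and `c` is not adjacent to `u₃`. So the neighbours of `p`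
are among `u₅, a, u₁, z`, contradicting degree five. -/
theorem five_cycle (C : Critical F b y X W)
    (hdeg : ∀ u ∈ W, (nbrs F W u).card = 5) {v u₁ u₂ u₃ u₄ u₅ : V}
    (hv : v ∈ W) (L : LinkCycle F W v u₁ u₂ u₃ u₄ u₅) : False := by
  have mW : ∀ z ∈ nbrs F W v, z ∈ W := fun z hz => (mem_nbrs.1 hz).1
  obtain ⟨z, hz, h2z, h3z, hzv⟩ := C.exists_linkCycle_common hdeg hv L
  obtain ⟨a, ha, h4a, h5a, hav⟩ := C.exists_linkCycle_common hdeg hv L.rotate.rotate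
  obtain ⟨p, hp, h5p, h1p, hpv⟩ := C.exists_linkCycle_common hdeg hv L.rotate.rotate.rotate
  obtain ⟨c, hc, h1c, h2c, hcv⟩ := C.exists_linkCycle_common hdeg hv L.rotate.rotate.rotate.rotate
  have n14 : ∀ w, F.Adj u₁ w → w ≠ u₄ := by
    rintro w h rfl
    exact (mem_rest.1 L.far₄₁).2.2 h
  have n1 : ∀ w, F.Adj u₁ w → w ≠ v → w ≠ u₂ → w ≠ u₅ → w ∈ W → ¬ F.Adj u₃ w ∧ ¬ F.Adj u₄ w := by
    intro w h hv' h2 h5 hw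
    have := C.linkCycle_nbrs hdeg hv L.rotate hw h hv' h2 h5
    exact ⟨this.2.1, this.1⟩
  have hp4 : ¬ F.Adj u₄ p := (n1 p h1p hpv (by
    rintro rfl; exact (mem_rest.1 L.far₅₂).2.2 h5p.symm) h5p.ne' hp).2
  have hc3 : ¬ F.Adj u₃ c := (n1 c h1c hcv h2c.ne' (by
    rintro rfl; exact (mem_rest.1 L.far₅₂).2.2 h2c) hc).1
  have hap : a ≠ p := by rintro rfl; exact hp4 h4a
  have hcz : c ≠ z := by rintro rfl; exact hc3 h3z
  have ha1 : a ≠ u₁ := by rintro rfl; exact (mem_rest.1 L.far₄₁).2.2 h4a.symm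
  have hz1 : z ≠ u₁ := by rintro rfl; exact (mem_rest.1 L.far₁₃).2.2 h3z
  have hc3' : c ≠ u₃ := by rintro rfl; exact (mem_rest.1 L.far₁₃).2.2 h1c.symm
  have five := mW _ L.mem₅
  have two := mW _ L.mem₂
  have N5 : ∀ r ∈ W, F.Adj u₅ r → r ≠ v → r ≠ u₁ → r ≠ u₄ → r = a ∨ r = p := by
    intro r hr h5r hrv hr1 hr4
    exact eq_of_two_outside (L.three_subset hv) (by rw [hdeg u₅ five, L.card_three])
      (mem_nbrs.2 ⟨ha, h5a⟩) (mem_nbrs.2 ⟨hp, h5p⟩) hap (by simp [hav, ha1, h4a.ne'])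
      (by simp [hpv, h1p.ne', n14 p h1p]) (mem_nbrs.2 ⟨hr, h5r⟩) (by simp [hrv, hr1, hr4])
  have N2 : ∀ r ∈ W, F.Adj u₂ r → r ≠ v → r ≠ u₃ → r ≠ u₁ → r = c ∨ r = z := by
    intro r hr h2r hrv hr3 hr1
    have L' := L.rotate.rotate
    exact eq_of_two_outside (L'.three_subset hv) (by rw [hdeg u₂ two, L'.card_three])
      (mem_nbrs.2 ⟨hc, h2c⟩) (mem_nbrs.2 ⟨hz, h2z⟩) hcz (by simp [hcv, h1c.ne', hc3'])
      (by simp [hzv, h3z.ne', hz1]) (mem_nbrs.2 ⟨hr, h2r⟩) (by simp [hrv, hr3, hr1])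
  obtain ⟨-, -, h⟩ := C.linkCycle_nbrs hdeg hv L hp h5p hpv h1p.ne' (n14 p h1p)
  have hsub : nbrs F W p ⊆ {u₅, a, u₁, z} := by
    intro r hr
    obtain ⟨hr, hpr⟩ := mem_nbrs.1 hr
    simp only [Finset.mem_insert, Finset.mem_singleton]
    rcases h r hr hpr with h | ⟨h, hv, h1, h4⟩ | h | rfl | ⟨h, h', h''⟩
    · exact Or.inl h
    · rcases N5 r hr h hv h1 h4 with h | rfl
      exacts [Or.inr (Or.inl h), absurd hpr (F.loopless.irrefl _)]
    · exact Or.inr (Or.inr (Or.inl h))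
    · exact absurd hpr.symm hp4
    · rcases N2 r hr h h'' h'.ne' (by
        rintro rfl; exact (mem_rest.1 L.far₁₃).2.2 h') with rfl | rfl
      exacts [absurd h' hc3, by tauto]
  have h1 := Finset.card_le_card hsub
  have h2 : ({u₅, a, u₁, z} : Finset V).card ≤ 4 := Finset.card_le_four
  rw [hdeg p hp] at h1
  omega

end Critical

end Critical

/-! ### Exclusion of degree five -/

section Critical

variable {V : Type*} [DecidableEq V] {F : SimpleGraph V} [DecidableRel F.Adj]

namespace Critical

variable {b : Finset V → ℝ} {y X : ℝ} {W : Finset V}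

/-- The remaining vertex `e` can only be adjacent to `p, q, r`. Three such edges give `K_{2,3}`, two
give `K_{2,3}` without an edge, and at most one gives a near star. -/
theorem five_link_three (C : Critical F b y X W)
    (hdeg : ∀ u ∈ W, (nbrs F W u).card = 5) {v u p q r e : V} (hv : v ∈ W)
    (hu : u ∈ nbrs F W v) (hp : p ∈ nbrs F W v) (hq : q ∈ nbrs F W v) (hr : r ∈ nbrs F W v)
    (he : e ∈ nbrs F W v)
    (hN : ∀ w ∈ W, F.Adj v w → w = u ∨ w = p ∨ w = q ∨ w = r ∨ w = e)
    (up : F.Adj u p) (uq : F.Adj u q) (ur : F.Adj u r) (fpq : p ∈ rest F W q)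
    (fpr : p ∈ rest F W r) (fqr : q ∈ rest F W r) (fue : u ∈ rest F W e) (ep : e ≠ p)
    (eq : e ≠ q) (er : e ≠ r) : False := by
  have mW : ∀ z ∈ nbrs F W v, z ∈ W := fun z hz => (mem_nbrs.1 hz).1
  have feu := mem_rest_comm (mW e he) fue
  have far : ∀ z, e ≠ z → ¬ F.Adj e z → e ∈ rest F W z := fun z hz h =>
    mem_rest.2 ⟨mW e he, hz, fun h' => h h'.symm⟩
  have near : ∀ p q r, p ∈ nbrs F W v → q ∈ nbrs F W v → r ∈ nbrs F W v →
      (∀ w ∈ W, F.Adj v w → w = u ∨ w = p ∨ w = q ∨ w = r ∨ w = e) →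
      F.Adj u p → F.Adj u q → F.Adj u r → p ∈ rest F W q → p ∈ rest F W r → q ∈ rest F W r →
      e ≠ p → e ≠ q → e ≠ r → ¬ F.Adj e p → ¬ F.Adj e q → False := by
    intro p q r hp hq hr hN up uq ur fpq fpr fqr ep eq er h1 h2
    exact C.five_near_star hdeg hv hu hp hq hr he
      (fun w hw h => by rcases hN w hw h with h | h | h | h | h <;> simp [h]) up.ne uq.ne ur.ne er fue fpq fpr fqr (far p ep h1)
      (far q eq h2)
  have minus : ∀ p q r, p ∈ nbrs F W v → q ∈ nbrs F W v → r ∈ nbrs F W v →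
      (∀ w ∈ W, F.Adj v w → w = u ∨ w = p ∨ w = q ∨ w = r ∨ w = e) →
      F.Adj u p → F.Adj u q → F.Adj u r → p ∈ rest F W q → p ∈ rest F W r → q ∈ rest F W r →
      e ≠ r → F.Adj e p → F.Adj e q → ¬ F.Adj e r → False := by
    intro p q r hp hq hr hN up uq ur fpq fpr fqr er h1 h2 h3
    exact C.five_bipartite_minus hdeg hv he hu hp hq hr
      (fun w hw h => by rcases hN w hw h with h | h | h | h | h <;> simp [h]) feu fpq fpr fqr (far r er h3) h1 h2 up uq ur
  have frp := mem_rest_comm (mW r hr) fpr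
  have frq := mem_rest_comm (mW r hr) fqr
  have hN1 : ∀ w ∈ W, F.Adj v w → w = u ∨ w = p ∨ w = r ∨ w = q ∨ w = e :=
    fun w hw h => by rcases hN w hw h with h | h | h | h | h <;> simp [h]
  have hN2 : ∀ w ∈ W, F.Adj v w → w = u ∨ w = q ∨ w = r ∨ w = p ∨ w = e :=
    fun w hw h => by rcases hN w hw h with h | h | h | h | h <;> simp [h]
  have fqp := mem_rest_comm (mW q hq) fpq
  by_cases h1 : F.Adj e p <;> by_cases h2 : F.Adj e q <;> by_cases h3 : F.Adj e r
  · exact C.five_bipartite hdeg hv hu he hp hq hr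
      (fun w hw h => by rcases hN w hw h with h | h | h | h | h <;> simp [h]) fue fpq fpr fqr up uq ur h1 h2 h3
  · exact minus p q r hp hq hr hN up uq ur fpq fpr fqr er h1 h2 h3
  · exact minus p r q hp hr hq hN1 up ur uq fpr fpq frq eq h1 h3 h2
  · exact near q r p hq hr hp hN2 uq ur up fqr fqp frp eq er ep h2 h3
  · exact minus q r p hq hr hp hN2 uq ur up fqr fqp frp ep h2 h3 h1
  · exact near p r q hp hr hq hN1 up ur uq fpr fpq frq ep er eq h1 h3
  · exact near p q r hp hq hr hN up uq ur fpq fpr fqr ep eq er h1 h2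
  · exact near p q r hp hq hr hN up uq ur fpq fpr fqr ep eq er h1 h2

/-- With maximum degree two in the neighbourhood, the path `p u q` closes up to a five-cycle if `e
f` is an edge and both `p` and `q` are joined to it. In all other cases there are enough nonadjacent
pairs for `five_degree_two`. -/
theorem five_link_two (C : Critical F b y X W)
    (hdeg : ∀ u ∈ W, (nbrs F W u).card = 5) {v u p q e f : V} (hv : v ∈ W)
    (hu : u ∈ nbrs F W v) (hp : p ∈ nbrs F W v) (hq : q ∈ nbrs F W v) (he : e ∈ nbrs F W v)
    (hf : f ∈ nbrs F W v)
    (hN : ∀ w ∈ W, F.Adj v w → w = u ∨ w = e ∨ w = f ∨ w = p ∨ w = q)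
    (up : F.Adj u p) (uq : F.Adj u q) (fpq : p ∈ rest F W q)
    (fue : u ∈ rest F W e) (fuf : u ∈ rest F W f) (ep : e ≠ p)
    (eq : e ≠ q) (fp : f ≠ p) (fq : f ≠ q) (ef : e ≠ f)
    (two : ∀ z ∈ nbrs F W v, ∀ a ∈ nbrs F W v, ∀ c ∈ nbrs F W v, ∀ d ∈ nbrs F W v, a ≠ c → a ≠ d →
      c ≠ d → F.Adj z a → F.Adj z c → ¬ F.Adj z d) : False := by
  have mW : ∀ z ∈ nbrs F W v, z ∈ W := fun z hz => (mem_nbrs.1 hz).1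
  have far : ∀ w ∈ nbrs F W v, ∀ z, w ≠ z → ¬ F.Adj z w → w ∈ rest F W z := fun w hw z hz h =>
    mem_rest.2 ⟨mW w hw, hz, h⟩
  have fqp := mem_rest_comm (mW q hq) fpq
  have nue := (mem_rest.1 fue).2.1
  have nuf := (mem_rest.1 fuf).2.1
  have hl : ∀ z ∈ nbrs F W v, F.Adj u z → e ≠ z → f ≠ z → e ∈ rest F W z ∨ f ∈ rest F W z := by
    intro z hz huz ez fz
    by_cases h : F.Adj z e
    · exact Or.inr (far f hf z fz (two z hz u hu e he f hf nue nuf ef huz.symm h))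
    · exact Or.inl (far e he z ez h)
  have hp' := hl p hp up ep fp
  have hq' := hl q hq uq eq fq
  by_cases hef : F.Adj e f
  · by_cases h1 : F.Adj p e ∨ F.Adj p f
    · by_cases h2 : F.Adj q e ∨ F.Adj q f
      · have cyc : ∀ e f, e ∈ nbrs F W v → f ∈ nbrs F W v →
            (∀ w ∈ W, F.Adj v w → w = u ∨ w = e ∨ w = f ∨ w = p ∨ w = q) →
            u ∈ rest F W e → u ∈ rest F W f → e ≠ p → e ≠ q → f ≠ p → f ≠ q → F.Adj e f →
            F.Adj p e → F.Adj q f → False := by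
          intro e f he hf hN fue fuf ep eq fp fq ef h1 h2
          refine C.five_cycle hdeg hv (u₁ := u) (u₂ := p) (u₃ := e) (u₄ := f) (u₅ := q)
            ⟨hu, hp, he, hf, hq, fun w hw h => by rcases hN w hw h with h | h | h | h | h <;> simp [h], up, h1, ef, h2.symm,
              uq.symm, fue, far p hp f fp.symm fun h => ?_, far e he q eq fun h => ?_,
              mem_rest_comm (mW f hf) fuf, fqp⟩
          · exact two f hf e he q hq p hp eq ep (mem_rest.1 fqp).2.1 ef.symm h2.symm h
          · exact two e he f hf p hp q hq fp fq (mem_rest.1 fpq).2.1 ef h1.symm h.symm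
        have npq := (mem_rest.1 fpq).2.1
        rcases h1 with h1 | h1
        · rcases h2 with h2 | h2
          · exact two e he f hf p hp q hq fp fq npq hef h1.symm h2.symm
          · exact cyc e f he hf hN fue fuf ep eq fp fq hef h1 h2
        · rcases h2 with h2 | h2
          · exact cyc f e hf he (fun w hw h => by rcases hN w hw h with h | h | h | h | h <;> simp [h]) fuf fue fp fq ep eq
              hef.symm h1 h2
          · exact two f hf e he p hp q hq ep eq npq hef.symm h1.symm h2.symm
      · push Not at h2
        exact C.five_degree_two hdeg hv hu hq hp he hf
          (fun w hw h => by rcases hN w hw h with h | h | h | h | h <;> simp [h]) uq.ne up.ne ef eq fq ep fp fue fuf fqp hq' hp'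
          (Or.inr ⟨far e he q eq h2.1, far f hf q fq h2.2⟩)
    · push Not at h1
      exact C.five_degree_two hdeg hv hu hp hq he hf hN up.ne uq.ne ef ep fp eq fq fue fuf fpq hp'
        hq' (Or.inr ⟨far e he p ep h1.1, far f hf p fp h1.2⟩)
  · exact C.five_degree_two hdeg hv hu hp hq he hf hN up.ne uq.ne ef ep fp eq fq fue fuf fpq hp'
      hq' (Or.inl (far e he f ef fun h => hef h.symm))

/-- The neighbourhood is a triangle-free graph on five vertices, treated according to its maximum
degree: four gives a star, three and two are `five_link_three` and `five_link_two`, and at most one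
is `five_sparse`. -/
theorem card_nbrs_ne_five (C : Critical F b y X W)
    (hdeg : ∀ u ∈ W, (nbrs F W u).card = 5) {v : V} (hv : v ∈ W) :
    False := by
  set N := nbrs F W v with hNdef
  have hd : N.card = 5 := hdeg v hv
  have mW : ∀ z ∈ N, z ∈ W := fun z hz => (mem_nbrs.1 hz).1
  have mA : ∀ z ∈ N, F.Adj v z := fun z hz => (mem_nbrs.1 hz).2
  have far : ∀ p ∈ N, ∀ q, p ≠ q → ¬ F.Adj p q → p ∈ rest F W q := fun p hp q hpq h =>
    mem_rest.2 ⟨mW p hp, hpq, fun h' => h h'.symm⟩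
  have ind : ∀ u ∈ N, ∀ p ∈ nbrs F N u, ∀ q ∈ nbrs F N u, p ≠ q → p ∈ rest F W q := by
    intro u hu p hp q hq hpq
    obtain ⟨hp, hup⟩ := mem_nbrs.1 hp
    obtain ⟨hq, huq⟩ := mem_nbrs.1 hq
    exact C.far_of_common hv (mW u hu) (mW p hp) (mW q hq) hpq (mA u hu) (mA p hp) (mA q hq)
      hup huq
  have mem : ∀ {S : Finset V}, N = S → ∀ w ∈ W, F.Adj v w → w ∈ S := by
    rintro S rfl w hw h
    exact mem_nbrs.2 ⟨hw, h⟩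
  by_cases hA : ∃ u ∈ N, 4 ≤ (nbrs F N u).card
  · obtain ⟨u, hu, hu4⟩ := hA
    have hsub : nbrs F N u ⊆ N.erase u := fun z hz =>
      Finset.mem_erase.2 ⟨(mem_nbrs.1 hz).2.ne', (mem_nbrs.1 hz).1⟩
    have hcard := Finset.card_erase_of_mem hu
    have h4 : (nbrs F N u).card = 4 := by
      have := Finset.card_le_card hsub
      omega
    have heq := Finset.eq_of_subset_of_card_le hsub (by omega)
    obtain ⟨p, hp, q, hq, hpq⟩ := Finset.one_lt_card.1 (show 1 < (nbrs F N u).card by omega)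
    obtain ⟨r, s, hrS, hsS, hrs, hL⟩ := exists_eq_pair_of_card (S := {p, q}) (N := nbrs F N u) (by
      intro z; simp only [Finset.mem_insert, Finset.mem_singleton]
      rintro (rfl | rfl) <;> assumption) (by rw [Finset.card_pair hpq, h4])
    simp only [Finset.mem_insert, Finset.mem_singleton, not_or] at hrS hsS
    have hr : r ∈ nbrs F N u := by rw [hL]; simp
    have hs : s ∈ nbrs F N u := by rw [hL]; simp
    refine C.five_star hdeg hv hu (mem_nbrs.1 hp).1 (mem_nbrs.1 hq).1 (mem_nbrs.1 hr).1
      (mem_nbrs.1 hs).1 ?_ (mem_nbrs.1 hp).2.ne (mem_nbrs.1 hq).2.ne (mem_nbrs.1 hr).2.ne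
      (mem_nbrs.1 hs).2.ne (ind u hu p hp q hq hpq) (ind u hu p hp r hr (Ne.symm hrS.1))
      (ind u hu p hp s hs (Ne.symm hsS.1)) (ind u hu q hq r hr (Ne.symm hrS.2))
      (ind u hu q hq s hs (Ne.symm hsS.2)) (ind u hu r hr s hs hrs)
    intro w hw hvw
    have := mem (S := insert u {r, s, p, q}) (by rw [← hL, heq, Finset.insert_erase hu]) w hw hvw
    simp only [Finset.mem_insert, Finset.mem_singleton] at this
    tauto
  push Not at hA
  by_cases hA' : ∃ u ∈ N, 3 ≤ (nbrs F N u).card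
  · obtain ⟨u, hu, hu3⟩ := hA'
    obtain ⟨p, q, r, hpq, hpr, hqr, hL⟩ := Finset.card_eq_three.1
      (show (nbrs F N u).card = 3 by have := hA u hu; omega)
    have hp : p ∈ nbrs F N u := by rw [hL]; simp
    have hq : q ∈ nbrs F N u := by rw [hL]; simp
    have hr : r ∈ nbrs F N u := by rw [hL]; simp
    have fpq := ind u hu p hp q hq hpq
    have fpr := ind u hu p hp r hr hpr
    have fqr := ind u hu q hq r hr hqr
    obtain ⟨hpN, up⟩ := mem_nbrs.1 hp
    obtain ⟨hqN, uq⟩ := mem_nbrs.1 hq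
    obtain ⟨hrN, ur⟩ := mem_nbrs.1 hr
    obtain ⟨e, heS, hNS⟩ := exists_eq_insert_of_card (S := {u, p, q, r}) (N := N) (by
      intro z; simp only [Finset.mem_insert, Finset.mem_singleton]
      rintro (rfl | rfl | rfl | rfl) <;> assumption) (by
      rw [Finset.card_insert_of_notMem (by simp [up.ne, uq.ne, ur.ne]),
        Finset.card_insert_of_notMem (by simp [hpq, hpr]), Finset.card_pair hqr, hd])
    have heN : e ∈ N := by rw [hNS]; simp
    simp only [Finset.mem_insert, Finset.mem_singleton, not_or] at heS
    obtain ⟨heu, hep, heq, her⟩ := heS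
    have hue : ¬ F.Adj u e := fun h => by
      have : e ∈ nbrs F N u := mem_nbrs.2 ⟨heN, h⟩
      rw [hL] at this
      simp only [Finset.mem_insert, Finset.mem_singleton] at this
      tauto
    refine C.five_link_three hdeg hv hu hpN hqN hrN heN ?_ up uq ur fpq fpr fqr
      (far u hu e (Ne.symm heu) hue) hep heq her
    intro w hw hvw
    have : w = e ∨ w = u ∨ w = p ∨ w = q ∨ w = r := by simpa using mem hNS w hw hvw
    tauto
  push Not at hA'
  by_cases hB : ∃ u ∈ N, 2 ≤ (nbrs F N u).card
  · obtain ⟨u, hu, hu2⟩ := hB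
    obtain ⟨p, q, hpq, hL⟩ := Finset.card_eq_two.1
      (show (nbrs F N u).card = 2 by have := hA' u hu; omega)
    have hp : p ∈ nbrs F N u := by rw [hL]; simp
    have hq : q ∈ nbrs F N u := by rw [hL]; simp
    have fpq := ind u hu p hp q hq hpq
    obtain ⟨hpN, up⟩ := mem_nbrs.1 hp
    obtain ⟨hqN, uq⟩ := mem_nbrs.1 hq
    obtain ⟨e, f, heS, hfS, hef, hNS⟩ := exists_eq_pair_of_card (S := {u, p, q}) (N := N) (by
      intro z; simp only [Finset.mem_insert, Finset.mem_singleton]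
      rintro (rfl | rfl | rfl) <;> assumption) (by
      rw [Finset.card_insert_of_notMem (by simp [up.ne, uq.ne]), Finset.card_pair hpq, hd])
    have heN : e ∈ N := by rw [hNS]; simp
    have hfN : f ∈ N := by rw [hNS]; simp
    simp only [Finset.mem_insert, Finset.mem_singleton, not_or] at heS hfS
    have hno : ∀ z ∈ N, z ≠ p → z ≠ q → ¬ F.Adj u z := fun z hz h1 h2 h => by
      have : z ∈ nbrs F N u := mem_nbrs.2 ⟨hz, h⟩
      rw [hL] at this
      simp only [Finset.mem_insert, Finset.mem_singleton] at this
      tauto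
    refine C.five_link_two hdeg hv hu hpN hqN heN hfN ?_ up uq fpq
      (far u hu e (Ne.symm heS.1) (hno e heN heS.2.1 heS.2.2))
      (far u hu f (Ne.symm hfS.1) (hno f hfN hfS.2.1 hfS.2.2)) heS.2.1 heS.2.2 hfS.2.1 hfS.2.2 hef ?_
    · intro w hw hvw
      have : w = e ∨ w = f ∨ w = u ∨ w = p ∨ w = q := by simpa using mem hNS w hw hvw
      tauto
    · intro z hz a ha c hc d hd hac had hcd hza hzc hzd
      have hsub : ({a, c, d} : Finset V) ⊆ nbrs F N z := by
        intro w; simp only [Finset.mem_insert, Finset.mem_singleton, mem_nbrs]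
        rintro (rfl | rfl | rfl)
        exacts [⟨ha, hza⟩, ⟨hc, hzc⟩, ⟨hd, hzd⟩]
      have := Finset.card_le_card hsub
      rw [Finset.card_insert_of_notMem (by simp [hac, had]), Finset.card_pair hcd] at this
      have := hA' z hz
      omega
  push Not at hB
  obtain ⟨u, hu, a, ha, hua, hL⟩ : ∃ u ∈ N, ∃ a ∈ N, u ≠ a ∧
      ∀ z ∈ N, z ≠ u → z ≠ a → ¬ F.Adj u z ∧ ¬ F.Adj a z :=
    exists_pair_no_other_adj (by omega) fun u hu => by have := hB u hu; omega
  obtain ⟨e, f, g, hef, heg, hfg, hNS⟩ := Finset.card_eq_three.1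
    (show ((N.erase u).erase a).card = 3 by
      rw [Finset.card_erase_of_mem (Finset.mem_erase.2 ⟨hua.symm, ha⟩),
        Finset.card_erase_of_mem hu, hd])
  have sub : ∀ z ∈ ({e, f, g} : Finset V), z ∈ N ∧ u ∈ rest F W z ∧ z ∈ rest F W a := by
    intro z hz
    rw [← hNS, Finset.mem_erase, Finset.mem_erase] at hz
    have := hL z hz.2.2 hz.2.1 hz.1
    exact ⟨hz.2.2, far u hu z hz.2.1.symm this.1, mem_rest.2 ⟨mW z hz.2.2, hz.1, this.2⟩⟩
  obtain ⟨e1, e2, e3⟩ := sub e (by simp)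
  obtain ⟨f1, f2, f3⟩ := sub f (by simp)
  obtain ⟨g1, g2, g3⟩ := sub g (by simp)
  refine C.five_sparse hdeg hv hu ha e1 f1 g1 ?_ hua hef heg hfg e2 f2 g2 e3 f3 g3
  intro w hw hvw
  by_cases h1 : w = u
  · tauto
  by_cases h2 : w = a
  · tauto
  have : w ∈ (N.erase u).erase a :=
    Finset.mem_erase.2 ⟨h2, Finset.mem_erase.2 ⟨h1, mem_nbrs.2 ⟨hw, hvw⟩⟩⟩
  rw [hNS] at this
  simp only [Finset.mem_insert, Finset.mem_singleton] at this
  tauto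

end Critical

end Critical

/-! ### The bound for graphs without four-cliques -/

section Bound

variable {V : Type*} [DecidableEq V] {F : SimpleGraph V} [DecidableRel F.Adj]

/-- A smallest counterexample is `Critical`. Excluding minimum degrees three and four leaves all
degrees equal to five, because five is also the maximum. -/
theorem Branching.le_pow_of_pow_three {b : Finset V → ℝ} (hb : Branching F b) {x : ℝ}
    (hx : 1 ≤ x) (h3 : x ^ 3 = 2) (W : Finset V)
    (hW : ∀ p ∈ W, ∀ q ∈ W, ∀ r ∈ W, ∀ s ∈ W, F.Adj p q → F.Adj p r → F.Adj p s →
      F.Adj q r → F.Adj q s → F.Adj r s → False) : b W ≤ x ^ W.card := by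
  induction W using Finset.strongInduction with
  | H W ih =>
    by_contra! hlt
    have hx0 : 0 < x := by linarith
    have C : Critical F b x⁻¹ (x ^ W.card) W := by
      refine ⟨hb, by positivity, by rw [inv_pow, h3]; norm_num, by positivity, ?_, hW, hlt⟩
      intro T k hT hk hTk
      exact le_inv_pow_mul hx (ih T (ssubset_of_subset_of_card_lt hT (by omega))
        fun p hp q hq r hr s hs => hW p (hT hp) q (hT hq) r (hT hr) s (hT hs)) hTk
    rcases W.eq_empty_or_nonempty with rfl | hne
    · have := hb.empty_le
      simp at hlt
      linarith
    obtain ⟨v, hv, hmin⟩ := exists_min_nbrs (F := F) hne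
    have h3 := C.three_le_card_nbrs hv hmin
    have h5 := C.card_nbrs_le_five hv
    have n3 := C.card_nbrs_ne_three (fun u hu => h3.trans (hmin u hu)) hv
    have h4 : 4 ≤ (nbrs F W v).card := by omega
    have n4 := C.card_nbrs_ne_four (fun u hu => h4.trans (hmin u hu)) hv
    exact C.card_nbrs_ne_five (fun u hu => le_antisymm (C.card_nbrs_le_five hu)
      ((show 5 ≤ (nbrs F W v).card by omega).trans (hmin u hu))) hv

end Bound

/-! ### From forbidden packings of cliques to forbidden cliques -/

section Packing

variable {V : Type*} [DecidableEq V] (F : SimpleGraph V) [DecidableRel F.Adj]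

/-- The graph `F[W]` contains `m` pairwise disjoint and nonadjacent cliques of size `i`. -/
def Packs (i : ℕ) : ℕ → Finset V → Prop
  | 0, _ => True
  | m + 1, W => ∃ s ⊆ W, F.IsNClique i s ∧
      Packs i m (W.filter fun w => w ∉ s ∧ ∀ x ∈ s, ¬ F.Adj x w)

variable {F}

theorem Packs.mono {i m : ℕ} {W T : Finset V} (h : Packs F i m T) (hTW : T ⊆ W) :
    Packs F i m W := by
  induction m generalizing W T with
  | zero => trivial
  | succ m ih =>
    obtain ⟨s, hs, hcl, hp⟩ := h
    exact ⟨s, hs.trans hTW, hcl, ih hp (Finset.filter_subset_filter _ hTW)⟩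

theorem Packs.exists_fun {i m : ℕ} {W : Finset V} (h : Packs F i m W) :
    ∃ f : Fin m → Fin i → V, (∀ a x, f a x ∈ W) ∧ (∀ a x y, x ≠ y → F.Adj (f a x) (f a y)) ∧
      ∀ a b, a ≠ b → ∀ x y, f a x ≠ f b y ∧ ¬ F.Adj (f a x) (f b y) := by
  induction m generalizing W with
  | zero => exact ⟨fun a => a.elim0, fun a => a.elim0, fun a => a.elim0, fun a => a.elim0⟩
  | succ m ih =>
    obtain ⟨s, hs, hcl, hp⟩ := h
    obtain ⟨f, h1, h2, h3⟩ := ih hp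
    let e := s.equivFinOfCardEq hcl.card_eq
    have hf : ∀ a x, f a x ∈ W ∧ f a x ∉ s ∧ ∀ z ∈ s, ¬ F.Adj z (f a x) := fun a x =>
      Finset.mem_filter.1 (h1 a x)
    refine ⟨Fin.cons (fun x => (e.symm x : V)) f, ?_, ?_, ?_⟩
    · intro a x
      refine Fin.cases ?_ (fun a => ?_) a
      · exact hs (e.symm x).2
      · exact (hf a x).1
    · intro a x y hxy
      refine Fin.cases ?_ (fun a => ?_) a
      · exact hcl.isClique (e.symm x).2 (e.symm y).2 fun h =>
          hxy (e.symm.injective (Subtype.ext h))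
      · exact h2 a x y hxy
    · intro a b
      refine Fin.cases ?_ (fun a => ?_) a <;> refine Fin.cases ?_ (fun b => ?_) b
      · exact fun h => absurd rfl h
      · intro _ x y
        refine ⟨fun h => (hf b y).2.1 ?_, (hf b y).2.2 _ (e.symm x).2⟩
        have h' : (e.symm x : V) = f b y := h
        rw [← h']
        exact (e.symm x).2
      · intro _ x y
        refine ⟨fun h => (hf a x).2.1 ?_, fun h => (hf a x).2.2 _ (e.symm y).2 h.symm⟩
        have h' : f a x = (e.symm y : V) := h
        rw [h']
        exact (e.symm y).2
      · intro hab
        exact h3 a b fun h => hab (by rw [h])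

theorem Packs.isIndContained {i m : ℕ} {W : Finset V} (h : Packs F i m W) :
    (SimpleGraph.completeMultipartiteGraph fun _ : Fin m => Fin i).IsIndContained Fᶜ := by
  obtain ⟨f, -, h2, h3⟩ := h.exists_fun
  refine ⟨⟨⟨fun p => f p.1 p.2, ?_⟩, ?_⟩⟩
  · rintro ⟨a, x⟩ ⟨b, y⟩ hxy
    by_cases hab : a = b
    · subst hab
      by_cases hxy' : x = y
      · rw [hxy']
      · exact absurd hxy (h2 a x y hxy').ne
    · exact absurd hxy (h3 a b hab x y).1
  · rintro ⟨a, x⟩ ⟨b, y⟩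
    simp only [SimpleGraph.compl_adj, SimpleGraph.comap_adj,
      SimpleGraph.completeMultipartiteGraph, SimpleGraph.top_adj]
    by_cases hab : a = b
    · subst hab
      simp only [ne_eq, not_true_eq_false, iff_false, not_and, not_not]
      intro hne
      exact h2 a x y fun h => hne (by rw [h])
    · simp only [ne_eq, hab, not_false_eq_true, iff_true]
      exact h3 a b hab x y

/-- A graph of bounded degree without a large packing of cliques becomes clique-free after deleting
boundedly many vertices. -/
theorem exists_deletion_of_not_packs {i m L : ℕ} {W : Finset V} (h : ¬ Packs F i m W)
    (hL : ∀ v ∈ W, (nbrs F W v).card ≤ L) :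
    ∃ S : Finset V, S.card ≤ m * (i * (L + 1)) ∧ ∀ s ⊆ W \ S, ¬ F.IsNClique i s := by
  induction m generalizing W with
  | zero => exact absurd trivial h
  | succ m ih =>
    by_cases hs : ∃ s ⊆ W, F.IsNClique i s
    · obtain ⟨s, hsW, hcl⟩ := hs
      set T := W.filter fun w => w ∉ s ∧ ∀ x ∈ s, ¬ F.Adj x w with hT
      have hTW : T ⊆ W := Finset.filter_subset _ _
      obtain ⟨S, hS, hfree⟩ := ih (W := T) (fun hp => h ⟨s, hsW, hcl, hp⟩) fun v hv =>
        (Finset.card_le_card (Finset.filter_subset_filter _ hTW)).trans (hL v (hTW hv))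
      -- The closed neighbourhoods of the clique `s` have at most `i * (L + 1)` vertices in total;
      -- what lies outside them is covered by the induction on `m`.
      refine ⟨S ∪ s.biUnion fun x => insert x (nbrs F W x), ?_, fun t ht => hfree t ?_⟩
      · refine (Finset.card_union_le _ _).trans ?_
        have h1 : (s.biUnion fun x => insert x (nbrs F W x)).card ≤ s.card * (L + 1) :=
          Finset.card_biUnion_le_card_mul _ _ _ fun x hx =>
            (Finset.card_insert_le _ _).trans (by have := hL x (hsW hx); omega)
        rw [hcl.card_eq] at h1
        rw [add_mul, one_mul]
        omega
      · refine ht.trans fun z hz => ?_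
        simp only [Finset.mem_sdiff, Finset.mem_union, Finset.mem_biUnion, Finset.mem_insert,
          mem_nbrs, not_or, not_exists, not_and] at hz
        refine Finset.mem_sdiff.2 ⟨Finset.mem_filter.2 ⟨hz.1, fun h => ?_, fun x hx => ?_⟩, hz.2.1⟩
        · exact (hz.2.2 z h).1 rfl
        · exact (hz.2.2 x hx).2 hz.1
    · push Not at hs
      exact ⟨∅, by simp, by simpa using hs⟩

namespace Branching

variable {b : Finset V → ℝ}

/-- Branching at a vertex of `S` produces two subsets that avoid it, so eliminating `S` costs at
most a factor of two per vertex. -/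
theorem le_two_pow_mul (hb : Branching F b) (S : Finset V) {W : Finset V} {M : ℝ} (hM : 0 ≤ M)
    (h : ∀ T ⊆ W, Disjoint T S → b T ≤ M) : b W ≤ 2 ^ S.card * M := by
  induction S using Finset.induction_on generalizing W with
  | empty => simpa using h W le_rfl (by simp)
  | insert v S hv ih =>
    rw [Finset.card_insert_of_notMem hv, pow_succ]
    have key : ∀ U ⊆ W, v ∉ U → b U ≤ 2 ^ S.card * M := fun U hU hvU =>
      ih fun T hT hTS => h T (hT.trans hU)
        (Finset.disjoint_insert_right.2 ⟨fun hvT => hvU (hT hvT), hTS⟩)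
    have hp : 0 ≤ 2 ^ S.card * M := by positivity
    by_cases hvW : v ∈ W
    · have h0 := hb.branch W v hvW
      have h1 := key (W.erase v) (Finset.erase_subset _ _) (by simp)
      have h2 := key (rest F W v) (rest_subset _ _) (by simp)
      linarith
    · have h1 := key W le_rfl hvW
      linarith

/-- At a vertex of degree above `L` the two branches add up to at most `ρ ^ L + 1 ≤ ρ ^ (L + 1)` in
relative size, with no loss in the constant. When no such vertex is left, boundedly many deletions
destroy all `i`-cliques, and this loss, incurred only once, is the constant. -/
theorem le_of_not_packs (hb : Branching F b)
    {ρ C : ℝ} {i m L : ℕ} (hρ : 1 ≤ ρ) (hL : ρ ^ L + 1 ≤ ρ ^ (L + 1))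
    (hC : 0 ≤ C) {W : Finset V} (hW : ¬ Packs F i m W)
    (h : ∀ T ⊆ W, (∀ s ⊆ T, ¬ F.IsNClique i s) → b T ≤ C * ρ ^ T.card) :
    b W ≤ 2 ^ (m * (i * (L + 1))) * C * ρ ^ W.card := by
  have hρ0 : 0 < ρ := by linarith
  induction W using Finset.strongInduction with
  | H W ih =>
    have sub : ∀ T ⊂ W, b T ≤ 2 ^ (m * (i * (L + 1))) * C * ρ ^ T.card := fun T hT =>
      ih T hT (fun hp => hW (hp.mono hT.1)) fun U hU => h U (hU.trans hT.1)
    by_cases hdeg : ∃ v ∈ W, L < (nbrs F W v).card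
    · obtain ⟨v, hv, hvL⟩ := hdeg
      have h0 := hb.branch W v hv
      have h1 := sub _ (Finset.erase_ssubset hv)
      have hc := card_rest (F := F) hv
      have h2 := sub _ (ssubset_of_subset_of_card_lt (rest_subset (F := F) W v) (by omega))
      obtain ⟨k, hk⟩ : ∃ k, W.card = k + (L + 1) := ⟨W.card - (L + 1), by omega⟩
      have e1 : ρ ^ (W.erase v).card = ρ ^ k * ρ ^ L := by
        rw [Finset.card_erase_of_mem hv, ← pow_add]; congr 1; omega
      have e2 : ρ ^ (rest F W v).card ≤ ρ ^ k := pow_le_pow_right₀ hρ (by omega)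
      have hA : (0 : ℝ) ≤ 2 ^ (m * (i * (L + 1))) * C := by positivity
      generalize (2 : ℝ) ^ (m * (i * (L + 1))) * C = A at *
      calc b W ≤ A * (ρ ^ k * ρ ^ L) + A * ρ ^ k := by
            rw [e1] at h1
            have := mul_le_mul_of_nonneg_left e2 hA
            linarith
        _ = A * (ρ ^ k * (ρ ^ L + 1)) := by ring
        _ ≤ A * (ρ ^ k * ρ ^ (L + 1)) := by gcongr
        _ = A * ρ ^ W.card := by rw [hk, pow_add ρ k]
    · push Not at hdeg
      obtain ⟨S, hS, hfree⟩ := exists_deletion_of_not_packs hW hdeg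
      have h1 := hb.le_two_pow_mul S (W := W) (M := C * ρ ^ W.card) (by positivity) fun T hT hTS => by
        refine (h T hT fun s hs => hfree s fun z hz => Finset.mem_sdiff.2 ⟨hT (hs hz), fun hzS =>
          Finset.disjoint_left.1 hTS (hs hz) hzS⟩).trans ?_
        gcongr
      refine h1.trans ?_
      rw [mul_assoc]
      gcongr
      · norm_num

end Branching

theorem exists_pow_add_one_le {ρ : ℝ} (hρ : 1 < ρ) : ∃ L : ℕ, ρ ^ L + 1 ≤ ρ ^ (L + 1) := by
  obtain ⟨L, hL⟩ := pow_unbounded_of_one_lt (1 / (ρ - 1)) hρ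
  refine ⟨L, ?_⟩
  have h : 0 < ρ - 1 := by linarith
  rw [div_lt_iff₀ h] at hL
  rw [pow_succ]
  linarith

end Packing

/-! ### Relabelling of induced subgraphs -/

section Transfer

open Matrix

variable {V₁ V : Type*} [LinearOrder V₁] [LinearOrder V] (K : Type*) [Field K]

theorem incidence_map (f : V₁ ↪o V) (s t : Finset V₁) :
    incidence K (s.map f.toEmbedding) (t.map f.toEmbedding) = incidence K s t := by
  rw [incidence, Finset.sum_map, incidence]
  refine Finset.sum_congr rfl fun u _ => ?_
  have h1 : (t.map f.toEmbedding).erase (f.toEmbedding u) = (t.erase u).map f.toEmbedding :=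
    (Finset.map_erase _ _ _).symm
  have h2 : ((t.map f.toEmbedding).filter (· < f.toEmbedding u)).card =
      (t.filter (· < u)).card := by
    rw [Finset.filter_map, Finset.card_map]
    congr 1
    ext
    simp
  rw [h1, h2]
  simp only [Finset.map_inj]

variable [Fintype V₁] (G : SimpleGraph V) (f : V₁ ↪o V)

/-- The cliques of a pulled back graph are the cliques inside the range. -/
def cliqueSetsComapEquiv :
    cliqueSets (G.comap f) Finset.univ ≃ cliqueSets G (Finset.univ.map f.toEmbedding) :=
  Equiv.ofBijective (fun s => ⟨s.1.map f.toEmbedding, mem_cliqueSets.2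
    ⟨Finset.map_subset_map.2 (Finset.subset_univ _), by
      have := (mem_cliqueSets.1 s.2).2
      intro x hx y hy hxy
      simp only [Finset.coe_map, Set.mem_image, Finset.mem_coe] at hx hy
      obtain ⟨x, hx, rfl⟩ := hx
      obtain ⟨y, hy, rfl⟩ := hy
      exact this hx hy fun h => hxy (by rw [h])⟩⟩) (by
    constructor
    · intro s t h
      exact Subtype.ext (Finset.map_injective _ (congrArg Subtype.val h))
    · rintro ⟨t, ht⟩
      obtain ⟨ht1, ht2⟩ := mem_cliqueSets.1 ht
      obtain ⟨s, -, rfl⟩ := Finset.subset_map_iff.1 ht1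
      refine ⟨⟨s, mem_cliqueSets.2 ⟨Finset.subset_univ _, ?_⟩⟩, rfl⟩
      intro x hx y hy hxy
      exact ht2 (by simpa using hx) (by simpa using hy) fun h => hxy (f.injective h))

/-- The embedding preserves the order, so the incidence signs agree. This carries bounds for graphs
on `Fin k` over to induced subgraphs. -/
theorem bettiSum_map :
    bettiSum K G (Finset.univ.map f.toEmbedding) = totalBetti K (G.comap f) := by
  have hM : (boundaryMatrix K G (Finset.univ.map f.toEmbedding)).submatrix
      (cliqueSetsComapEquiv G f) (cliqueSetsComapEquiv G f) =
      boundaryMatrix K (G.comap f) Finset.univ := by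
    ext s t
    exact incidence_map K f s.1 t.1
  have hc : (cliqueSets (G.comap f) Finset.univ).card =
      (cliqueSets G (Finset.univ.map f.toEmbedding)).card := by
    rw [← Fintype.card_coe, ← Fintype.card_coe]
    exact Fintype.card_congr (cliqueSetsComapEquiv G f)
  rw [totalBetti_eq_bettiSum, bettiSum, bettiSum, hc, ← hM, Matrix.rank_submatrix]

end Transfer

/-! ### Upper bounds for total Betti numbers -/

section Bounds

variable {V : Type*} [LinearOrder V] (K : Type*) [Field K] (G : SimpleGraph V)

/-- In terms of the complement, the link of `v` lives on the vertices outside the closed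
neighbourhood, and a vertex isolated in the complement is a cone apex. -/
theorem branching_bettiSum [DecidableRel Gᶜ.Adj] :
    Branching Gᶜ fun W => (bettiSum K G W : ℝ) where
  empty_le := by exact_mod_cast bettiSum_empty_le K (G := G)
  branch W v hv := by
    classical
    have h : rest Gᶜ W v = W.filter (G.Adj v) := by
      ext w
      simp only [mem_rest, Finset.mem_filter, SimpleGraph.compl_adj, ne_eq, not_and, not_not]
      exact and_congr_right fun _ => ⟨fun h => h.2 (Ne.symm h.1), fun h => ⟨h.ne', fun _ => h⟩⟩
    rw [h]
    exact_mod_cast bettiSum_le_add K G hv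
  isolated W v hv h := by
    exact_mod_cast bettiSum_nonpos_of_cone K G hv fun w hw hwv => by
      by_contra h'
      exact h w hw ((SimpleGraph.compl_adj _ _ _).2 ⟨hwv.symm, h'⟩)

variable [Fintype V]

theorem totalBetti_le_of_branching {M : ℝ}
    (h : ∀ [DecidableRel Gᶜ.Adj] (b : Finset V → ℝ), Branching Gᶜ b → b Finset.univ ≤ M) :
    (totalBetti K G : ℝ) ≤ M := by
  classical
  have := h _ (branching_bettiSum K G)
  rw [← totalBetti_eq_bettiSum] at this
  exact_mod_cast this

theorem totalBetti_le_of_pow_five {x : ℝ} (hx : 1 ≤ x) (h : x ^ 5 = 4) :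
    (totalBetti K G : ℝ) ≤ x ^ Fintype.card V :=
  totalBetti_le_of_branching K G fun _ hb => hb.le_pow_of_pow_five hx h _

theorem isIndContained_edgeless_iff {V : Type*} (G : SimpleGraph V) (i : ℕ) :
    (⊥ : SimpleGraph (Fin i)).IsIndContained G ↔ ¬ Gᶜ.CliqueFree i := by
  rw [← SimpleGraph.compl_isIndContained_compl, compl_bot,
    SimpleGraph.not_cliqueFree_iff_top_isContained, SimpleGraph.top_isIndContained_iff_top_isContained]

variable {G}

theorem totalBetti_le_of_cliqueFree_five (hG : Gᶜ.CliqueFree 5) {x : ℝ} (hx : 1 ≤ x)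
    (h : x ^ 4 = 3) : (totalBetti K G : ℝ) ≤ x ^ Fintype.card V :=
  totalBetti_le_of_branching K G fun _ hb => hb.le_pow_of_pow_four hx h _ fun s _ => hG s

theorem totalBetti_le_of_cliqueFree_four (hG : Gᶜ.CliqueFree 4) {x : ℝ} (hx : 1 ≤ x)
    (h : x ^ 3 = 2) : (totalBetti K G : ℝ) ≤ x ^ Fintype.card V := by
  refine totalBetti_le_of_branching K G fun _ hb => hb.le_pow_of_pow_three hx h _ ?_
  intro p _ q _ r _ s _ pq pr ps qr qs rs
  have h3 : Gᶜ.IsNClique 3 {q, r, s} := SimpleGraph.is3Clique_triple_iff.2 ⟨qr, qs, rs⟩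
  exact hG {p, q, r, s} (h3.insert (by simpa using ⟨pq, pr, ps⟩))

theorem totalBetti_le_of_cliqueFree_three (hG : Gᶜ.CliqueFree 3) :
    (totalBetti K G : ℝ) ≤ gamma 4 ^ Fintype.card V := by
  refine totalBetti_le_of_branching K G fun _ hb => hb.le_gamma_four_pow _ ?_
  intro p _ q _ r _ pq qr pr
  exact hG {p, q, r} (SimpleGraph.is3Clique_triple_iff.2 ⟨pq, pr, qr⟩)

theorem totalBetti_le_of_cliqueFree_two (hG : Gᶜ.CliqueFree 2) : totalBetti K G ≤ 1 := by
  suffices h : (totalBetti K G : ℝ) ≤ 1 by exact_mod_cast h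
  refine totalBetti_le_of_branching K G fun b hb => ?_
  rcases (Finset.univ : Finset V).eq_empty_or_nonempty with h | ⟨v, hv⟩
  · rw [h]
    exact hb.empty_le
  · refine (hb.isolated _ v hv fun w _ hvw => ?_).trans zero_le_one
    rw [SimpleGraph.cliqueFree_two] at hG
    rw [hG] at hvw
    exact hvw

end Bounds

/-! ### The maximum over `H`-free graphs -/

section MaxBetti

variable (K : Type*) [Field K] {V : Type*} (H : SimpleGraph V)

theorem exists_pow_five : ∃ x : ℝ, 1 ≤ x ∧ x ^ 5 = 4 :=
  ⟨4 ^ (1 / 5 : ℝ), Real.one_le_rpow (by norm_num) (by norm_num), by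
    rw [← Real.rpow_natCast, ← Real.rpow_mul (by norm_num)]; norm_num⟩

/-- The supremum in `maxBetti` would default to `0` on an unbounded set; the universal bound for all
graphs excludes this. -/
theorem bddAbove_totalBetti (n : ℕ) :
    BddAbove {b | ∃ k ≤ n, ∃ G : SimpleGraph (Fin k), ¬ H.IsIndContained G ∧
      b = totalBetti K G} := by
  obtain ⟨x, hx, h5⟩ := exists_pow_five
  refine ⟨⌊x ^ n⌋₊, ?_⟩
  rintro _ ⟨k, hk, G, -, rfl⟩
  refine Nat.le_floor ((totalBetti_le_of_pow_five K G hx h5).trans ?_)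
  rw [Fintype.card_fin]
  exact pow_le_pow_right₀ hx hk

variable {H}

theorem totalBetti_le_maxBetti {k n : ℕ} (hk : k ≤ n) {G : SimpleGraph (Fin k)}
    (hG : ¬ H.IsIndContained G) : totalBetti K G ≤ maxBetti K H n :=
  le_csSup (bddAbove_totalBetti K H n) ⟨k, hk, G, hG, rfl⟩

theorem not_isIndContained_of_fin_zero [Nonempty V] (G : SimpleGraph (Fin 0)) :
    ¬ H.IsIndContained G := fun ⟨f⟩ => (f (Classical.arbitrary V)).elim0

theorem exists_maxBetti_eq [Nonempty V] (n : ℕ) :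
    ∃ k ≤ n, ∃ G : SimpleGraph (Fin k), ¬ H.IsIndContained G ∧ maxBetti K H n = totalBetti K G :=
  Nat.sSup_mem (s := {b | ∃ k ≤ n, ∃ G : SimpleGraph (Fin k), ¬ H.IsIndContained G ∧
      b = totalBetti K G})
    ⟨_, 0, Nat.zero_le _, ⊥, not_isIndContained_of_fin_zero ⊥, rfl⟩ (bddAbove_totalBetti K H n)

/-- The graph without vertices has only the empty face, hence Euler characteristic `1`; this makes
logarithms and roots harmless. -/
theorem one_le_maxBetti [Nonempty V] (n : ℕ) : 1 ≤ maxBetti K H n := by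
  refine le_trans ?_ (totalBetti_le_maxBetti K (Nat.zero_le n)
    (not_isIndContained_of_fin_zero (H := H) ⊥))
  have h := abs_euler_le_totalBetti K (⊥ : SimpleGraph (Fin 0))
  have h2 : cliqueSets (⊥ : SimpleGraph (Fin 0)) Finset.univ = {∅} := by
    ext s
    rw [mem_cliqueSets, Finset.mem_singleton, Finset.eq_empty_of_isEmpty s]
    simp
  rw [h2, Finset.sum_singleton] at h
  simpa using h

theorem maxBetti_le_maxBetti_of_isIndContained {V' : Type*} [Nonempty V'] {H' : SimpleGraph V'}
    (h : H'.IsIndContained H) (n : ℕ) : maxBetti K H' n ≤ maxBetti K H n := by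
  obtain ⟨k, hk, G, hG, he⟩ := exists_maxBetti_eq K (H := H') n
  rw [he]
  exact totalBetti_le_maxBetti K hk fun hH => hG (h.trans hH)

theorem maxBetti_le_pow [Nonempty V] {x : ℝ} (hx : 1 ≤ x) {C : ℝ} (hC : 0 ≤ C)
    (h : ∀ (k : ℕ) (G : SimpleGraph (Fin k)), ¬ H.IsIndContained G →
      (totalBetti K G : ℝ) ≤ C * x ^ k) (n : ℕ) : (maxBetti K H n : ℝ) ≤ C * x ^ n := by
  obtain ⟨k, hk, G, hG, he⟩ := exists_maxBetti_eq K (H := H) n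
  rw [he]
  refine (h k G hG).trans ?_
  gcongr

end MaxBetti

/-! ### Joins of graphs without large independent sets -/

section Join

/-- The join of two graphs: the disjoint union with all edges between the two graphs. -/
def joinFin {a b : ℕ} (G₁ : SimpleGraph (Fin a)) (G₂ : SimpleGraph (Fin b)) :
    SimpleGraph (Fin (a + b)) :=
  ((G₁ᶜ.sum G₂ᶜ)ᶜ).comap finSumFinEquiv.symm

variable {a b : ℕ} (G₁ : SimpleGraph (Fin a)) (G₂ : SimpleGraph (Fin b))

theorem joinFin_comap_left : (joinFin G₁ G₂).comap (Fin.castAddOrderEmb b) = G₁ := by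
  ext x y
  simp only [joinFin, SimpleGraph.comap_adj, SimpleGraph.compl_adj, Fin.castAddOrderEmb_apply,
    finSumFinEquiv_symm_apply_castAdd, SimpleGraph.sum_adj, ne_eq, Sum.inl.injEq]
  have := fun h : G₁.Adj x y => h.ne
  tauto

theorem joinFin_comap_right : (joinFin G₁ G₂).comap (Fin.natAddOrderEmb a) = G₂ := by
  ext x y
  simp only [joinFin, SimpleGraph.comap_adj, SimpleGraph.compl_adj, Fin.natAddOrderEmb_apply,
    finSumFinEquiv_symm_apply_natAdd, SimpleGraph.sum_adj, ne_eq, Sum.inr.injEq]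
  have := fun h : G₂.Adj x y => h.ne
  tauto

theorem joinFin_adj (x : Fin a) (y : Fin b) :
    (joinFin G₁ G₂).Adj (Fin.castAdd b x) (Fin.natAdd a y) := by
  simp [joinFin]

theorem castAdd_or_natAdd (z : Fin (a + b)) :
    (∃ x, Fin.castAddOrderEmb b x = z) ∨ ∃ y, Fin.natAddOrderEmb a y = z := by
  refine Fin.addCases (fun x => Or.inl ⟨x, rfl⟩) (fun y => Or.inr ⟨y, rfl⟩) z

theorem totalBetti_mul_le_of_adj (K : Type*) [Field K] (G : SimpleGraph (Fin (a + b)))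
    (h : ∀ x y, G.Adj (Fin.castAdd b x) (Fin.natAdd a y)) :
    totalBetti K (G.comap (Fin.castAddOrderEmb b)) * totalBetti K (G.comap (Fin.natAddOrderEmb a)) ≤
      totalBetti K G :=
  totalBetti_mul_le K (f := Fin.castAddOrderEmb b) (g := Fin.natAddOrderEmb a)
    (fun x y => Fin.lt_def.2 (by simp; omega)) castAdd_or_natAdd h

theorem totalBetti_mul_le_joinFin (K : Type*) [Field K] :
    totalBetti K G₁ * totalBetti K G₂ ≤ totalBetti K (joinFin G₁ G₂) := by
  have := totalBetti_mul_le_of_adj K (joinFin G₁ G₂) (joinFin_adj G₁ G₂)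
  rwa [joinFin_comap_left, joinFin_comap_right] at this

theorem isIndContained_comap {V V' W : Type*} {H : SimpleGraph V} {G : SimpleGraph W} (e : H ↪g G)
    (f : V' ↪ W) (h : ∀ x, ∃ y, f y = e x) : H.IsIndContained (G.comap f) := by
  choose g hg using h
  refine ⟨⟨⟨g, fun x y hxy => e.injective ?_⟩, ?_⟩⟩
  · rw [← hg x, ← hg y, hxy]
  · intro x y
    change G.Adj (f (g x)) (f (g y)) ↔ H.Adj x y
    rw [hg, hg]
    exact e.map_rel_iff'

variable {G₁ G₂}

/-- Vertices on different sides of a join are adjacent, so an independent set lies on one side. The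
index `i + 1` provides a vertex `0` that determines the side. -/
theorem not_isIndContained_joinFin {i : ℕ}
    (h₁ : ¬ (⊥ : SimpleGraph (Fin (i + 1))).IsIndContained G₁)
    (h₂ : ¬ (⊥ : SimpleGraph (Fin (i + 1))).IsIndContained G₂) :
    ¬ (⊥ : SimpleGraph (Fin (i + 1))).IsIndContained (joinFin G₁ G₂) := by
  rintro ⟨e⟩
  have hno : ∀ x y, ¬ (joinFin G₁ G₂).Adj (e x) (e y) := fun x y h => by
    have := e.map_rel_iff'.1 h
    exact this
  rcases castAdd_or_natAdd (e 0) with ⟨x₀, h0⟩ | ⟨y₀, h0⟩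
  · refine h₁ ?_
    rw [← joinFin_comap_left G₁ G₂]
    refine isIndContained_comap e (Fin.castAddOrderEmb b).toEmbedding fun z =>
      (castAdd_or_natAdd (e z)).resolve_right ?_
    rintro ⟨y, hy⟩
    refine hno 0 z ?_
    rw [← h0, ← hy]
    exact joinFin_adj G₁ G₂ x₀ y
  · refine h₂ ?_
    rw [← joinFin_comap_right G₁ G₂]
    refine isIndContained_comap e (Fin.natAddOrderEmb a).toEmbedding fun z =>
      (castAdd_or_natAdd (e z)).resolve_left ?_
    rintro ⟨x, hx⟩
    refine hno z 0 ?_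
    rw [← h0, ← hx]
    exact joinFin_adj G₁ G₂ x y₀

theorem maxBetti_mul_le (K : Type*) [Field K] (i m n : ℕ) :
    maxBetti K (⊥ : SimpleGraph (Fin (i + 1))) m * maxBetti K (⊥ : SimpleGraph (Fin (i + 1))) n ≤
      maxBetti K (⊥ : SimpleGraph (Fin (i + 1))) (m + n) := by
  obtain ⟨k, hk, G, hG, he⟩ := exists_maxBetti_eq K (H := (⊥ : SimpleGraph (Fin (i + 1)))) m
  obtain ⟨l, hl, G', hG', he'⟩ := exists_maxBetti_eq K (H := (⊥ : SimpleGraph (Fin (i + 1)))) n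
  rw [he, he']
  exact (totalBetti_mul_le_joinFin G G' K).trans
    (totalBetti_le_maxBetti K (by omega) (not_isIndContained_joinFin hG hG'))

end Join

/-! ### Existence and transfer of growth rates -/

section Growth

theorem tendsto_mul_pow_rpow {A x : ℝ} (hA : 0 < A) (hx : 0 < x) :
    Tendsto (fun n : ℕ => (A * x ^ n) ^ (1 / (n : ℝ))) atTop (𝓝 x) := by
  have h1 : Tendsto (fun n : ℕ => A ^ (1 / (n : ℝ)) * x) atTop (𝓝 (A ^ (0 : ℝ) * x)) :=
    (((Real.continuousAt_const_rpow hA.ne').tendsto).comp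
      tendsto_one_div_atTop_nhds_zero_nat).mul_const x
  rw [Real.rpow_zero, one_mul] at h1
  refine h1.congr' ?_
  filter_upwards [eventually_gt_atTop 0] with n hn
  have hn' : (n : ℝ) ≠ 0 := by exact_mod_cast hn.ne'
  rw [Real.mul_rpow hA.le (by positivity), ← Real.rpow_natCast x, ← Real.rpow_mul hx.le,
    mul_one_div_cancel hn', Real.rpow_one]

/-- A squeeze in which the upper bound is needed only for every `ρ > c` and up to a constant
depending on `ρ`. -/
theorem tendsto_rpow_one_div {l w : ℕ → ℝ} {c : ℝ}
    (hl : Tendsto (fun n : ℕ => l n ^ (1 / (n : ℝ))) atTop (𝓝 c)) (h0 : ∀ n, 0 ≤ l n)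
    (hlw : ∀ n, l n ≤ w n) (hw : ∀ ρ, c < ρ → ∃ C, 0 < C ∧ ∀ n, w n ≤ C * ρ ^ n) (hc : 0 ≤ c) :
    Tendsto (fun n : ℕ => w n ^ (1 / (n : ℝ))) atTop (𝓝 c) := by
  refine tendsto_order.2 ⟨fun a ha => ?_, fun a ha => ?_⟩
  · filter_upwards [(tendsto_order.1 hl).1 a ha] with n hn
    exact hn.trans_le (Real.rpow_le_rpow (h0 n) (hlw n) (by positivity))
  · obtain ⟨ρ, hcρ, hρa⟩ := exists_between ha
    obtain ⟨C, hC, hwC⟩ := hw ρ hcρ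
    have hρ : 0 < ρ := by linarith
    filter_upwards [(tendsto_order.1 (tendsto_mul_pow_rpow hC hρ)).2 a hρa] with n hn
    exact (Real.rpow_le_rpow ((h0 n).trans (hlw n)) (hwC n) (by positivity)).trans_lt hn

/-- The growth rate `c` of the maximal total Betti number of graphs without `i` pairwise
nonadjacent vertices. -/
structure IsEdgelessRate (K : Type*) [Field K] (i : ℕ) (c : ℝ) : Prop where
  one_le : 1 ≤ c
  hasGrowthRate : HasGrowthRate K (⊥ : SimpleGraph (Fin i)) c
  maxBetti_le : ∀ n, (maxBetti K (⊥ : SimpleGraph (Fin i)) n : ℝ) ≤ c ^ n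

variable (K : Type*) [Field K]

/-- Fekete's lemma for `-log` of the supermultiplicative sequence `maxBetti`, bounded by the
universal exponential estimate. The limit is also an infimum, which yields the bound `c ^ n` for
every `n` without a constant. -/
theorem exists_isEdgelessRate {i : ℕ} (hi : 1 ≤ i) : ∃ c, IsEdgelessRate K i c := by
  obtain ⟨i, rfl⟩ : ∃ j, i = j + 1 := ⟨i - 1, by omega⟩
  set B : ℕ → ℕ := maxBetti K (⊥ : SimpleGraph (Fin (i + 1))) with hB
  have hB1 : ∀ n, (1 : ℝ) ≤ B n := fun n => by exact_mod_cast one_le_maxBetti K n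
  have hB0 : ∀ n, (0 : ℝ) < B n := fun n => by linarith [hB1 n]
  obtain ⟨x, hx, h5⟩ := exists_pow_five
  have hBx : ∀ n, (B n : ℝ) ≤ x ^ n := fun n => by
    have := maxBetti_le_pow K (H := (⊥ : SimpleGraph (Fin (i + 1)))) hx zero_le_one
      (fun k G _ => by simpa using totalBetti_le_of_pow_five K G hx h5) n
    simpa using this
  have hsub : Subadditive fun n => -Real.log (B n) := by
    intro m n
    have h1 : ((B m * B n : ℕ) : ℝ) ≤ B (m + n) := by exact_mod_cast maxBetti_mul_le K i m n
    push_cast at h1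
    have h2 := Real.log_le_log (mul_pos (hB0 m) (hB0 n)) h1
    rw [Real.log_mul (hB0 m).ne' (hB0 n).ne'] at h2
    linarith
  have hlx : 0 ≤ Real.log x := Real.log_nonneg hx
  have hbdd : BddBelow (Set.range fun n : ℕ => -Real.log (B n) / n) := by
    refine ⟨-Real.log x, ?_⟩
    rintro _ ⟨n, rfl⟩
    rcases Nat.eq_zero_or_pos n with rfl | hn
    · simpa using hlx
    · have hn' : (0 : ℝ) < n := by exact_mod_cast hn
      have h := Real.log_le_log (hB0 n) (hBx n)
      rw [Real.log_pow] at h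
      rw [le_div_iff₀ hn']
      linarith
  have hle : ∀ n, (B n : ℝ) ≤ Real.exp (-hsub.lim) ^ n := by
    intro n
    rcases Nat.eq_zero_or_pos n with rfl | hn
    · simpa using hBx 0
    · have hn' : (0 : ℝ) < n := by exact_mod_cast hn
      have h := hsub.lim_le_div hbdd hn.ne'
      rw [le_div_iff₀ hn'] at h
      rw [← Real.exp_nat_mul, ← Real.log_le_iff_le_exp (hB0 n)]
      linarith
  refine ⟨Real.exp (-hsub.lim), by simpa using (hB1 1).trans (hle 1), ?_, hle⟩
  have := (Real.continuous_exp.tendsto _).comp (hsub.tendsto_lim hbdd).neg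
  refine this.congr fun n => ?_
  rw [Function.comp_apply, Real.rpow_def_of_pos (hB0 n)]
  congr 1
  ring

variable {K}

namespace IsEdgelessRate

variable {i : ℕ} {c : ℝ}

theorem totalBetti_le (h : IsEdgelessRate K i c)
    {k : ℕ} {G : SimpleGraph (Fin k)} (hG : Gᶜ.CliqueFree i) :
    (totalBetti K G : ℝ) ≤ c ^ k := by
  refine le_trans ?_ (h.maxBetti_le k)
  exact_mod_cast totalBetti_le_maxBetti K le_rfl fun h => (isIndContained_edgeless_iff G i).1 h hG

theorem le_of_totalBetti_le (h : IsEdgelessRate K i c) (hi : 1 ≤ i) {x : ℝ} (hx : 1 ≤ x)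
    (hle : ∀ (k : ℕ) (G : SimpleGraph (Fin k)), Gᶜ.CliqueFree i → (totalBetti K G : ℝ) ≤ x ^ k) :
    c ≤ x := by
  have : Nonempty (Fin i) := ⟨⟨0, hi⟩⟩
  refine le_of_tendsto h.hasGrowthRate ?_
  filter_upwards [eventually_gt_atTop 0] with n hn
  have h1 := maxBetti_le_pow K (H := (⊥ : SimpleGraph (Fin i))) hx zero_le_one (fun k G hG => by
    rw [isIndContained_edgeless_iff, not_not] at hG
    simpa using hle k G hG) n
  rw [one_mul] at h1
  have hn' : (n : ℝ) ≠ 0 := by exact_mod_cast hn.ne'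
  refine (Real.rpow_le_rpow (by positivity) h1 (by positivity)).trans ?_
  rw [← Real.rpow_natCast, ← Real.rpow_mul (by linarith), mul_one_div_cancel hn', Real.rpow_one]

theorem bettiSum_le (h : IsEdgelessRate K i c)
    {k : ℕ} (G : SimpleGraph (Fin k)) (T : Finset (Fin k))
    (hT : ∀ s ⊆ T, ¬ Gᶜ.IsNClique i s) : (bettiSum K G T : ℝ) ≤ c ^ T.card := by
  have hmap := bettiSum_map K G (T.orderEmbOfFin rfl)
  rw [Finset.map_orderEmbOfFin_univ] at hmap
  rw [hmap]
  refine (le_of_eq (by push_cast; rfl)).trans (h.totalBetti_le (G := G.comap _) ?_)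
  intro s hs
  refine hT (s.map (T.orderEmbOfFin rfl).toEmbedding) ?_ ?_
  · intro z hz
    obtain ⟨x, -, rfl⟩ := Finset.mem_map.1 hz
    exact Finset.orderEmbOfFin_mem T rfl x
  · refine ⟨?_, by rw [Finset.card_map, hs.card_eq]⟩
    intro z hz w hw hzw
    simp only [Finset.coe_map, Set.mem_image, Finset.mem_coe] at hz hw
    obtain ⟨x, hx, rfl⟩ := hz
    obtain ⟨y, hy, rfl⟩ := hw
    have := hs.isClique hx hy fun h => hzw (by rw [h])
    rw [SimpleGraph.compl_adj] at this ⊢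
    exact ⟨hzw, this.2⟩

/-- The growth rate of a graph between the edgeless graph on `i` vertices and a complete
multipartite graph with parts of size `i`. -/
theorem hasGrowthRate_of_isIndContained (h : IsEdgelessRate K i c)
    (hi : 1 ≤ i) {V : Type*} [Nonempty V] {H : SimpleGraph V}
    {m : ℕ} (h₁ : (⊥ : SimpleGraph (Fin i)).IsIndContained H)
    (h₂ : H.IsIndContained (SimpleGraph.completeMultipartiteGraph fun _ : Fin m => Fin i)) :
    HasGrowthRate K H c := by
  classical
  have : Nonempty (Fin i) := ⟨⟨0, hi⟩⟩
  refine tendsto_rpow_one_div h.hasGrowthRate (fun n => by positivity)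
    (fun n => by exact_mod_cast maxBetti_le_maxBetti_of_isIndContained K h₁ n) ?_
    (zero_le_one.trans h.one_le)
  intro ρ hρ
  have hρ1 : 1 < ρ := h.one_le.trans_lt hρ
  obtain ⟨L, hL⟩ := exists_pow_add_one_le hρ1
  refine ⟨2 ^ (m * (i * (L + 1))) * 1, by positivity,
    maxBetti_le_pow K hρ1.le (by positivity) fun k G hG => ?_⟩
  -- A packing of cliques in the complement of `G` is an induced complete multipartite subgraph of
  -- `G`, and this contains `H`.
  have hp : ¬ Packs Gᶜ i m Finset.univ := fun hp => hG (h₂.trans (by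
    have := hp.isIndContained
    rwa [compl_compl] at this))
  have := (branching_bettiSum K G).le_of_not_packs hρ1.le hL zero_le_one hp fun T _ hT => by
    refine (h.bettiSum_le G T hT).trans ?_
    rw [one_mul]
    exact pow_le_pow_left₀ (zero_le_one.trans h.one_le) hρ.le _
  rw [← totalBetti_eq_bettiSum, Finset.card_univ, Fintype.card_fin] at this
  exact_mod_cast this

end IsEdgelessRate

end Growth

/-! ### Induced subgraphs of `K_{5,5,…}` -/

section Fibers

/-- A finite induced subgraph of the infinite complete multipartite graph lies between the edgeless
graph on its largest part and a complete multipartite graph with parts of that size. -/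
theorem exists_between_of_isIndContained {V : Type*} [Finite V] [Nonempty V] {H : SimpleGraph V}
    (h : H.IsIndContained infiniteMultipartiteFive) :
    ∃ i m, 1 ≤ i ∧ i ≤ 5 ∧ (⊥ : SimpleGraph (Fin i)).IsIndContained H ∧
      H.IsIndContained (SimpleGraph.completeMultipartiteGraph fun _ : Fin m => Fin i) := by
  classical
  have := Fintype.ofFinite V
  obtain ⟨φ⟩ := h
  have hadj : ∀ a b, H.Adj a b ↔ (φ a).1 ≠ (φ b).1 := fun a b => by
    rw [← φ.map_adj_iff]
    simp
  set P : ℕ → Finset V := fun j => Finset.univ.filter fun a => (φ a).1 = j with hP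
  have mP : ∀ a j, a ∈ P j ↔ (φ a).1 = j := fun a j => by simp [hP]
  obtain ⟨a₀, -, ha₀⟩ := Finset.exists_max_image (Finset.univ : Finset V)
    (fun a => (P (φ a).1).card) Finset.univ_nonempty
  have hcard : ∀ j, (P j).card ≤ (P (φ a₀).1).card := by
    intro j
    rcases (P j).eq_empty_or_nonempty with h | ⟨a, ha⟩
    · simp [h]
    · rw [← (mP a j).1 ha]
      exact ha₀ a (Finset.mem_univ a)
  have hpos : 1 ≤ (P (φ a₀).1).card := Finset.card_pos.2 ⟨a₀, by rw [mP]⟩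
  obtain ⟨m, hm⟩ : ∃ m, ∀ a, (φ a).1 < m :=
    ⟨Finset.univ.sup (fun a => (φ a).1) + 1, fun a =>
      Nat.lt_succ_of_le (Finset.le_sup (f := fun a => (φ a).1) (Finset.mem_univ a))⟩
  refine ⟨(P (φ a₀).1).card, m, hpos, ?_, ?_, ?_⟩
  · refine (Finset.card_le_card_of_injOn (t := (Finset.univ : Finset (Fin 5)))
      (fun a => (φ a).2) (by simp) ?_).trans (by simp)
    intro a ha b hb hab
    rw [Finset.mem_coe, mP] at ha hb
    exact φ.injective (Sigma.ext (ha.trans hb.symm) (by simpa using hab))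
  · let e := (P (φ a₀).1).equivFin
    refine ⟨⟨⟨fun x => (e.symm x : V), fun x y hxy => e.symm.injective (Subtype.ext hxy)⟩, ?_⟩⟩
    intro x y
    refine iff_of_false (fun h => ?_) (by simp)
    have hx := (mP _ _).1 (e.symm x).2
    have hy := (mP _ _).1 (e.symm y).2
    exact (hadj _ _).1 h (hx.trans hy.symm)
  · have hg : ∀ j, ∃ g : V → Fin (P (φ a₀).1).card, Set.InjOn g (P j) := by
      intro j
      obtain ⟨g⟩ := Function.Embedding.nonempty_of_card_le (α := P j)
        (β := Fin (P (φ a₀).1).card) (by simpa using hcard j)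
      refine ⟨fun a => if ha : a ∈ P j then g ⟨a, ha⟩ else ⟨0, hpos⟩, fun a ha b hb hab => ?_⟩
      rw [Finset.mem_coe] at ha hb
      simp only [ha, hb, dif_pos] at hab
      exact Subtype.ext_iff.1 (g.injective hab)
    choose g hg using hg
    refine ⟨⟨⟨fun a => ⟨⟨(φ a).1, hm a⟩, g (φ a).1 a⟩, fun a b hab => ?_⟩, ?_⟩⟩
    · simp only [Sigma.mk.injEq, Fin.mk.injEq, heq_eq_eq] at hab
      refine hg (φ a).1 (by simp [mP]) (by simp [mP, hab.1]) ?_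
      rw [hab.2, hab.1]
    · intro a b
      rw [hadj]
      change (⟨(φ a).1, hm a⟩ : Fin m) ≠ ⟨(φ b).1, hm b⟩ ↔ _
      rw [Ne, Fin.mk.injEq]

end Fibers

/-! ### Euler characteristics of explicit graphs -/

section Euler

/-- The reduced Euler characteristic (up to sign) of the clique complex of the relation `r` on a
list, computed by splitting off the first element. The first argument bounds the length. -/
def eulerSum {V : Type*} (r : V → V → Bool) : ℕ → List V → ℤ
  | _, [] => 1
  | 0, _ :: _ => 0
  | n + 1, v :: l => eulerSum r n l - eulerSum r n (l.filter (r v))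

variable {V : Type*} [LinearOrder V] (G : SimpleGraph V) [DecidableRel G.Adj]

/-- Cliques through `v` are cliques of its neighbourhood with one vertex added, hence the change of
sign. -/
theorem sum_cliqueSets_eq_sub {W : Finset V} {v : V} (hv : v ∈ W) :
    ∑ s ∈ cliqueSets G W, (-1 : ℤ) ^ s.card =
      ∑ s ∈ cliqueSets G (W.erase v), (-1 : ℤ) ^ s.card -
        ∑ s ∈ cliqueSets G (W.filter (G.Adj v)), (-1 : ℤ) ^ s.card := by
  rw [← Finset.sum_coe_sort, ← Finset.sum_coe_sort (cliqueSets G (W.erase v)),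
    ← Finset.sum_coe_sort (cliqueSets G (W.filter (G.Adj v))),
    ← Equiv.sum_comp (cliqueSetsEquiv G hv), Fintype.sum_sum_type, sub_eq_add_neg,
    ← Finset.sum_neg_distrib]
  congr 1
  refine Finset.sum_congr rfl fun s _ => ?_
  change (-1 : ℤ) ^ (insert v s.1).card = _
  rw [Finset.card_insert_of_notMem (notMem_of_mem_cliqueSets_adj G s.2), pow_succ]
  ring

theorem sum_cliqueSets_toFinset {n : ℕ} {l : List V} (hl : l.Nodup) (hn : l.length ≤ n) :
    ∑ s ∈ cliqueSets G l.toFinset, (-1 : ℤ) ^ s.card =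
      eulerSum (fun v w => decide (G.Adj v w)) n l := by
  induction n generalizing l with
  | zero =>
    obtain rfl := List.length_eq_zero_iff.1 (Nat.le_zero.1 hn)
    have : cliqueSets G ∅ = {∅} := by
      ext s
      rw [mem_cliqueSets, Finset.subset_empty, Finset.mem_singleton]
      constructor
      · exact fun h => h.1
      · rintro rfl
        simp
    simp [eulerSum, this]
  | succ n ih =>
    cases l with
    | nil =>
      rw [ih (l := []) (by simp) (by simp)]
      cases n <;> rfl
    | cons v l =>
      obtain ⟨hv, hl⟩ := List.nodup_cons.1 hl
      rw [List.length_cons, Nat.succ_le_succ_iff] at hn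
      rw [eulerSum, sum_cliqueSets_eq_sub G (v := v) (by simp), ← ih hl hn,
        ← ih (hl.filter _) ((List.length_filter_le _ _).trans hn)]
      congr 3
      · rw [List.toFinset_cons, Finset.erase_insert (by simpa using hv)]
      · ext w
        simp only [List.toFinset_cons, Finset.mem_filter, Finset.mem_insert, List.mem_toFinset,
          List.mem_filter, decide_eq_true_eq]
        constructor
        · rintro ⟨rfl | h, h'⟩
          · exact absurd h' (G.loopless.irrefl _)
          · exact ⟨h, h'⟩
        · exact fun h => ⟨Or.inr h.1, h.2⟩

/-- Turns a lower bound over an arbitrary field into an integer computation that can be decided. -/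
theorem le_totalBetti_of_eulerSum (K : Type*) [Field K] {n m : ℕ} (G : SimpleGraph (Fin n))
    [DecidableRel G.Adj]
    (h : |eulerSum (fun v w => decide (G.Adj v w)) n (List.finRange n)| = m) :
    m ≤ totalBetti K G := by
  have h' := abs_euler_le_totalBetti K G
  rw [← List.toFinset_finRange, sum_cliqueSets_toFinset G (n := n)
    (List.nodup_finRange n) (by simp), h] at h'
  exact_mod_cast h'

theorem two_le_totalBetti_edgeless (K : Type*) [Field K] :
    2 ≤ totalBetti K (⊥ : SimpleGraph (Fin 3)) :=
  le_totalBetti_of_eulerSum K _ (by decide)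

theorem three_le_totalBetti_edgeless (K : Type*) [Field K] :
    3 ≤ totalBetti K (⊥ : SimpleGraph (Fin 4)) :=
  le_totalBetti_of_eulerSum K _ (by decide)

theorem four_le_totalBetti_edgeless (K : Type*) [Field K] :
    4 ≤ totalBetti K (⊥ : SimpleGraph (Fin 5)) :=
  le_totalBetti_of_eulerSum K _ (by decide)

/-- The adjacency of a triangle-free graph on `14` vertices, given by the rows of its adjacency
matrix in binary. -/
def fourteenAdj (x y : Fin 14) : Bool :=
  ([706, 10497, 3360, 8496, 4680, 204, 2097,
    9249, 526, 1297, 4740, 4166, 11280, 4234].getD x 0).testBit y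

/-- The complement of a triangle-free graph on `14` vertices. The reduced Euler characteristic of
its clique complex is `8` up to sign. -/
def fourteenGraph : SimpleGraph (Fin 14) where
  Adj x y := x ≠ y ∧ fourteenAdj x y = false
  symm := ⟨by decide +kernel⟩
  loopless := ⟨fun x h => h.1 rfl⟩

instance : DecidableRel fourteenGraph.Adj := fun x y =>
  inferInstanceAs (Decidable (x ≠ y ∧ fourteenAdj x y = false))

theorem fourteenGraph_compl_cliqueFree : fourteenGraphᶜ.CliqueFree 3 := by
  intro s hs
  obtain ⟨a, b, c, hab, hac, hbc, -⟩ := SimpleGraph.is3Clique_iff.1 hs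
  revert a b c
  decide +kernel

theorem eight_le_totalBetti_fourteenGraph (K : Type*) [Field K] :
    8 ≤ totalBetti K fourteenGraph :=
  le_totalBetti_of_eulerSum K _ (by decide +kernel)

end Euler

/-! ### Complete multipartite graphs with parts of size five -/

section Blocks

/-- The complete multipartite graph on `n` vertices whose parts are intervals of length five. -/
def blockGraph (n : ℕ) : SimpleGraph (Fin n) where
  Adj x y := (x : ℕ) / 5 ≠ (y : ℕ) / 5
  symm := ⟨fun _ _ h => h.symm⟩
  loopless := ⟨fun _ h => h rfl⟩

theorem blockGraph_isIndContained (n : ℕ) :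
    (blockGraph n).IsIndContained infiniteMultipartiteFive := by
  refine ⟨⟨⟨fun x => ⟨(x : ℕ) / 5, ⟨(x : ℕ) % 5, Nat.mod_lt _ (by norm_num)⟩⟩, fun x y h => ?_⟩,
    ?_⟩⟩
  · simp only [Sigma.mk.injEq, heq_eq_eq, Fin.mk.injEq] at h
    exact Fin.ext (by omega)
  · intro x y
    rfl

/-- The last block is joined completely to the others, and an edgeless graph on five vertices
contributes a factor of at least four. -/
theorem four_pow_le_totalBetti_blockGraph (K : Type*) [Field K] (k : ℕ) :
    4 ^ k ≤ totalBetti K (blockGraph (5 * k)) := by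
  induction k with
  | zero =>
    have h := abs_euler_le_totalBetti K (blockGraph 0)
    have h2 : cliqueSets (blockGraph 0) Finset.univ = {∅} := by
      ext s
      rw [mem_cliqueSets, Finset.mem_singleton, Finset.eq_empty_of_isEmpty s]
      simp
    rw [h2, Finset.sum_singleton] at h
    simpa using h
  | succ k ih =>
    have h := totalBetti_mul_le_of_adj K (blockGraph (5 * k + 5)) fun x y => by
      change (x : ℕ) / 5 ≠ (5 * k + y) / 5
      omega
    have h1 : (blockGraph (5 * k + 5)).comap (Fin.castAddOrderEmb 5) = blockGraph (5 * k) := by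
      ext x y
      rfl
    have h2 : (blockGraph (5 * k + 5)).comap (Fin.natAddOrderEmb (5 * k)) = ⊥ := by
      ext x y
      refine iff_of_false (fun h => h ?_) (by simp)
      change (5 * k + (x : ℕ)) / 5 = (5 * k + (y : ℕ)) / 5
      omega
    rw [h1, h2] at h
    rw [pow_succ]
    exact (Nat.mul_le_mul ih (four_le_totalBetti_edgeless K)).trans h

end Blocks

/-! ### Values of the rates -/

section Rates

variable {K : Type*} [Field K]

theorem rpow_one_div_pow {a : ℝ} (ha : 0 ≤ a) {n : ℕ} (hn : n ≠ 0) :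
    (a ^ (1 / n : ℝ)) ^ n = a := by
  rw [one_div, Real.rpow_inv_natCast_pow ha hn]

theorem hasGrowthRate_of_not_isIndContained {V : Type*} [Nonempty V] {H : SimpleGraph V}
    (hH : ¬ H.IsIndContained infiniteMultipartiteFive) :
    HasGrowthRate K H ((4 : ℝ) ^ (1 / 5 : ℝ)) := by
  set x : ℝ := (4 : ℝ) ^ (1 / 5 : ℝ) with hxdef
  have hx : 1 ≤ x := Real.one_le_rpow (by norm_num) (by norm_num)
  have h5 : x ^ 5 = 4 := by
    have := rpow_one_div_pow (a := 4) (by norm_num) (n := 5) (by norm_num)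
    exact_mod_cast this
  have hx0 : 0 < x := by linarith
  -- Block graphs use `5 * (n / 5)` vertices. The up to four unused vertices lose a factor `x ^ (n %
  -- 5) ≤ x ^ 5 = 4`, hence the constant `1 / 4`.
  refine tendsto_rpow_one_div (l := fun n => 1 / 4 * x ^ n)
    (tendsto_mul_pow_rpow (by norm_num) hx0) (fun n => by positivity) (fun n => ?_)
    (fun ρ hρ => ⟨1, one_pos, maxBetti_le_pow K (hx.trans hρ.le) zero_le_one fun k G _ => ?_⟩) hx0.le
  · have h1 : 4 ^ (n / 5) ≤ maxBetti K H n :=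
      (four_pow_le_totalBetti_blockGraph K (n / 5)).trans (totalBetti_le_maxBetti K
        (Nat.mul_div_le n 5) fun h => hH (h.trans (blockGraph_isIndContained _)))
    have h2 : ((4 ^ (n / 5) : ℕ) : ℝ) ≤ maxBetti K H n := by exact_mod_cast h1
    refine le_trans ?_ h2
    push_cast
    have h3 : x ^ n = 4 ^ (n / 5) * x ^ (n % 5) := by
      conv_lhs => rw [← Nat.div_add_mod n 5]
      rw [pow_add, pow_mul, h5]
    have h4 : x ^ (n % 5) ≤ 4 := by
      rw [← h5]
      exact pow_le_pow_right₀ hx (Nat.mod_lt _ (by norm_num)).le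
    rw [h3]
    nlinarith [pow_pos (show (0 : ℝ) < 4 by norm_num) (n / 5)]
  · have := totalBetti_le_of_pow_five K G hx h5
    rw [Fintype.card_fin] at this
    rw [one_mul]
    exact this.trans (pow_le_pow_left₀ hx0.le hρ.le _)

theorem bot_compl_cliqueFree (n : ℕ) : ((⊥ : SimpleGraph (Fin n))ᶜ).CliqueFree (n + 1) :=
  SimpleGraph.cliqueFree_of_card_lt (by simp)

namespace IsEdgelessRate

variable {c : ℝ}

/-- Since `maxBetti ≤ c ^ n` holds without a constant, a single graph gives a lower bound for `c`:
four isolated vertices show `3 ≤ c ^ 4`. The other rates use three isolated vertices and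
`fourteenGraph` in the same way. -/
theorem eq_of_five (h : IsEdgelessRate K 5 c) : c = (3 : ℝ) ^ (1 / 4 : ℝ) := by
  have hx : (1 : ℝ) ≤ 3 ^ (1 / 4 : ℝ) := Real.one_le_rpow (by norm_num) (by norm_num)
  have h4 : ((3 : ℝ) ^ (1 / 4 : ℝ)) ^ 4 = 3 := by
    have := rpow_one_div_pow (a := 3) (by norm_num) (n := 4) (by norm_num)
    exact_mod_cast this
  refine le_antisymm (h.le_of_totalBetti_le (by norm_num) hx fun k G hG => ?_) ?_
  · simpa using totalBetti_le_of_cliqueFree_five K hG hx h4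
  · refine le_of_pow_le_pow_left₀ (n := 4) (by norm_num) (by linarith [h.one_le]) ?_
    rw [h4]
    exact le_trans (by exact_mod_cast three_le_totalBetti_edgeless K)
      (h.totalBetti_le (bot_compl_cliqueFree 4))

theorem eq_of_four (h : IsEdgelessRate K 4 c) : c = (2 : ℝ) ^ (1 / 3 : ℝ) := by
  have hx : (1 : ℝ) ≤ 2 ^ (1 / 3 : ℝ) := Real.one_le_rpow (by norm_num) (by norm_num)
  have h3 : ((2 : ℝ) ^ (1 / 3 : ℝ)) ^ 3 = 2 := by
    have := rpow_one_div_pow (a := 2) (by norm_num) (n := 3) (by norm_num)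
    exact_mod_cast this
  refine le_antisymm (h.le_of_totalBetti_le (by norm_num) hx fun k G hG => ?_) ?_
  · simpa using totalBetti_le_of_cliqueFree_four K hG hx h3
  · refine le_of_pow_le_pow_left₀ (n := 3) (by norm_num) (by linarith [h.one_le]) ?_
    rw [h3]
    exact le_trans (by exact_mod_cast two_le_totalBetti_edgeless K)
      (h.totalBetti_le (bot_compl_cliqueFree 3))

theorem mem_Icc_of_three (h : IsEdgelessRate K 3 c) :
    c ∈ Set.Icc ((8 : ℝ) ^ (1 / 14 : ℝ)) (gamma 4) := by
  have h14 : ((8 : ℝ) ^ (1 / 14 : ℝ)) ^ 14 = 8 := by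
    have := rpow_one_div_pow (a := 8) (by norm_num) (n := 14) (by norm_num)
    exact_mod_cast this
  refine ⟨?_, h.le_of_totalBetti_le (by norm_num) (by linarith [gamma_four_bounds.1])
    fun k G hG => ?_⟩
  · refine le_of_pow_le_pow_left₀ (n := 14) (by norm_num) (by linarith [h.one_le]) ?_
    rw [h14]
    exact le_trans (by exact_mod_cast eight_le_totalBetti_fourteenGraph K)
      (h.totalBetti_le fourteenGraph_compl_cliqueFree)
  · simpa using totalBetti_le_of_cliqueFree_three K hG

theorem eq_one_of_le_two {i : ℕ} (h : IsEdgelessRate K i c) (h1 : 1 ≤ i) (h2 : i ≤ 2) : c = 1 :=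
  le_antisymm (h.le_of_totalBetti_le h1 le_rfl fun k G hG => by
    rw [one_pow]
    exact_mod_cast totalBetti_le_of_cliqueFree_two K (hG.mono h2)) h.one_le

end IsEdgelessRate

/-- The first rate is compared with `2 ^ (1/3)` through `1.244 ^ 3 < 2`; the others reduce to `2 ^ 4
< 3 ^ 3` and `3 ^ 5 < 4 ^ 4` by taking powers `12` and `20`. -/
theorem rate_chain {c : ℝ} (hc : c ∈ Set.Icc ((8 : ℝ) ^ (1 / 14 : ℝ)) (gamma 4)) :
    1 < c ∧ c < (2 : ℝ) ^ (1 / 3 : ℝ) ∧ (2 : ℝ) ^ (1 / 3 : ℝ) < (3 : ℝ) ^ (1 / 4 : ℝ) ∧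
      (3 : ℝ) ^ (1 / 4 : ℝ) < (4 : ℝ) ^ (1 / 5 : ℝ) := by
  have h3 : ((2 : ℝ) ^ (1 / 3 : ℝ)) ^ 3 = 2 := by
    have := rpow_one_div_pow (a := 2) (by norm_num) (n := 3) (by norm_num)
    exact_mod_cast this
  have h4 : ((3 : ℝ) ^ (1 / 4 : ℝ)) ^ 4 = 3 := by
    have := rpow_one_div_pow (a := 3) (by norm_num) (n := 4) (by norm_num)
    exact_mod_cast this
  have h5 : ((4 : ℝ) ^ (1 / 5 : ℝ)) ^ 5 = 4 := by
    have := rpow_one_div_pow (a := 4) (by norm_num) (n := 5) (by norm_num)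
    exact_mod_cast this
  refine ⟨(Real.one_lt_rpow (by norm_num) (by norm_num)).trans_le hc.1,
    (hc.2.trans gamma_four_bounds.2.le).trans_lt ?_, ?_, ?_⟩
  · refine lt_of_pow_lt_pow_left₀ 3 (by positivity) ?_
    rw [h3]
    norm_num
  · refine lt_of_pow_lt_pow_left₀ 12 (by positivity) ?_
    rw [show (12 : ℕ) = 3 * 4 from rfl, pow_mul, h3, show (3 * 4 : ℕ) = 4 * 3 from rfl, pow_mul, h4]
    norm_num
  · refine lt_of_pow_lt_pow_left₀ 20 (by positivity) ?_
    rw [show (20 : ℕ) = 4 * 5 from rfl, pow_mul, h4, show (4 * 5 : ℕ) = 5 * 4 from rfl, pow_mul, h5]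
    norm_num

theorem not_isIndContained_edgeless_six :
    ¬ (⊥ : SimpleGraph (ULift.{v} (Fin 6))).IsIndContained infiniteMultipartiteFive := by
  rintro ⟨φ⟩
  have h : ∀ a b, (φ a).1 = (φ b).1 := by
    intro a b
    by_contra hab
    exact φ.map_adj_iff.1 (show infiniteMultipartiteFive.Adj (φ a) (φ b) from hab)
  have hinj : Function.Injective fun a => (φ a).2 := fun a b hab =>
    φ.injective (Sigma.ext (h a b) (by simpa using hab))
  have := Fintype.card_le_of_injective _ hinj
  simp at this

theorem hasGrowthRate_of_iso {V : Type*} [Nonempty V] {H : SimpleGraph V} {m : ℕ}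
    {i : Fin (m + 1) → ℕ} (hi : Antitone i) (hpos : 1 ≤ i 0)
    (e : H ≃g SimpleGraph.completeMultipartiteGraph fun j => Fin (i j)) {c : ℝ}
    (hc : IsEdgelessRate K (i 0) c) : HasGrowthRate K H c := by
  refine hc.hasGrowthRate_of_isIndContained hpos (m := m + 1) ?_ ?_
  · refine SimpleGraph.IsIndContained.trans ?_ ⟨e.symm.toEmbedding⟩
    refine ⟨⟨⟨fun x => ⟨0, x⟩, fun x y h => by simpa using h⟩, ?_⟩⟩
    intro x y
    exact iff_of_false (fun h => h rfl) (by simp)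
  · refine SimpleGraph.IsIndContained.trans ⟨e.toEmbedding⟩ ?_
    refine ⟨⟨⟨fun p => ⟨p.1, Fin.castLE (hi (Fin.zero_le p.1)) p.2⟩, ?_⟩, ?_⟩⟩
    · rintro ⟨a, x⟩ ⟨b, y⟩ h
      simp only [Sigma.mk.injEq] at h
      obtain ⟨rfl, h⟩ := h
      simpa using h
    · intro x y
      rfl

/-- Realises the rate by a graph in an arbitrary universe, as needed for counting the rates. -/
theorem IsEdgelessRate.hasGrowthRate_ulift {i : ℕ} {c : ℝ} (hi : 1 ≤ i)
    (h : IsEdgelessRate K i c) : HasGrowthRate K (⊥ : SimpleGraph (ULift.{v} (Fin i))) c := by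
  have : Nonempty (ULift.{v} (Fin i)) := ⟨⟨⟨0, hi⟩⟩⟩
  refine h.hasGrowthRate_of_isIndContained hi (m := 1) ?_ ?_
  · exact ⟨⟨Equiv.ulift.symm.toEmbedding, by simp⟩⟩
  · refine ⟨⟨⟨fun x => ⟨0, x.down⟩, fun x y h => by simpa using h⟩, ?_⟩⟩
    intro x y
    exact iff_of_false (fun h => h rfl) (by simp)

end Rates

end CliqueBetti

end

/-! ### The main theorem -/

theorem theorem1 (K : Type u) [Field K] :
    -- the limit exists for every finite graph with at least one vertex
    (∀ {V : Type v} [Finite V] [Nonempty V] (H : SimpleGraph V),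
      ∃ c : ℝ, CliqueBetti.HasGrowthRate K H c) ∧
    -- graphs that are not induced subgraphs of `K_{5,5,…}`
    (∀ {V : Type v} [Finite V] [Nonempty V] (H : SimpleGraph V),
      ¬ H.IsIndContained CliqueBetti.infiniteMultipartiteFive →
        CliqueBetti.HasGrowthRate K H ((4 : ℝ) ^ (1 / 5 : ℝ))) ∧
    -- the graphs `K_{i₁,…,i_m}` with `5 ≥ i₁ ≥ ⋯ ≥ i_m ≥ 1` and `m ≥ 1`
    (∃ c' : ℕ → ℝ,
      (∀ {V : Type v} [Finite V] [Nonempty V] (H : SimpleGraph V) (m : ℕ) (i : Fin (m + 1) → ℕ),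
        Antitone i → (∀ j, 1 ≤ i j ∧ i j ≤ 5) →
        Nonempty (H ≃g SimpleGraph.completeMultipartiteGraph fun j => Fin (i j)) →
          CliqueBetti.HasGrowthRate K H (c' (i 0))) ∧
      c' 5 = (3 : ℝ) ^ (1 / 4 : ℝ) ∧
      c' 4 = (2 : ℝ) ^ (1 / 3 : ℝ) ∧
      c' 3 ∈ Set.Icc ((8 : ℝ) ^ (1 / 14 : ℝ)) (CliqueBetti.gamma 4) ∧
      c' 2 = 1 ∧
      c' 1 = 1) ∧
    -- exactly five limits occur
    {c : ℝ | ∃ (V : Type v) (_ : Finite V) (_ : Nonempty V) (H : SimpleGraph V),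
      CliqueBetti.HasGrowthRate K H c}.ncard = 5 := by
  have hex : ∀ i : ℕ, ∃ c, 1 ≤ i → CliqueBetti.IsEdgelessRate K i c := fun i => by
    by_cases hi : 1 ≤ i
    · obtain ⟨c, hc⟩ := CliqueBetti.exists_isEdgelessRate K hi
      exact ⟨c, fun _ => hc⟩
    · exact ⟨0, fun h => absurd h hi⟩
  choose c' hc' using hex
  have e5 := (hc' 5 (by norm_num)).eq_of_five
  have e4 := (hc' 4 (by norm_num)).eq_of_four
  have e3 := (hc' 3 (by norm_num)).mem_Icc_of_three
  have e2 := (hc' 2 (by norm_num)).eq_one_of_le_two (by norm_num) le_rfl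
  have e1 := (hc' 1 le_rfl).eq_one_of_le_two le_rfl (by norm_num)
  -- Every `H` has the universal rate or one of the five edgeless rates. As the rates for `i = 1`
  -- and `i = 2` coincide, five values remain.
  have hdich : ∀ {V : Type v} [Finite V] [Nonempty V] (H : SimpleGraph V),
      CliqueBetti.HasGrowthRate K H ((4 : ℝ) ^ (1 / 5 : ℝ)) ∨
        ∃ i, 1 ≤ i ∧ i ≤ 5 ∧ CliqueBetti.HasGrowthRate K H (c' i) := by
    intro V _ _ H
    by_cases hH : H.IsIndContained CliqueBetti.infiniteMultipartiteFive
    · obtain ⟨i, m, h1, h5, hl, hu⟩ := CliqueBetti.exists_between_of_isIndContained hH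
      exact Or.inr ⟨i, h1, h5, (hc' i h1).hasGrowthRate_of_isIndContained h1 hl hu⟩
    · exact Or.inl (CliqueBetti.hasGrowthRate_of_not_isIndContained hH)
  refine ⟨fun H => ?_, fun H hH => CliqueBetti.hasGrowthRate_of_not_isIndContained hH,
    ⟨c', ?_, e5, e4, e3, e2, e1⟩, ?_⟩
  · rcases hdich H with h | ⟨i, -, -, h⟩
    exacts [⟨_, h⟩, ⟨_, h⟩]
  · rintro V _ _ H m i hi hi5 ⟨e⟩
    exact CliqueBetti.hasGrowthRate_of_iso hi (hi5 0).1 e (hc' _ (hi5 0).1)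
  · obtain ⟨n1, n2, n3, n4⟩ := CliqueBetti.rate_chain e3
    have hset : {c : ℝ | ∃ (V : Type v) (_ : Finite V) (_ : Nonempty V) (H : SimpleGraph V),
        CliqueBetti.HasGrowthRate K H c} = (({1, c' 3, (2 : ℝ) ^ (1 / 3 : ℝ),
          (3 : ℝ) ^ (1 / 4 : ℝ), (4 : ℝ) ^ (1 / 5 : ℝ)} : Finset ℝ) : Set ℝ) := by
      have hedge : ∀ i, 1 ≤ i → c' i ∈ {c : ℝ | ∃ (V : Type v) (_ : Finite V) (_ : Nonempty V)
          (H : SimpleGraph V), CliqueBetti.HasGrowthRate K H c} := fun i hi =>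
        ⟨ULift.{v} (Fin i), inferInstance, ⟨⟨⟨0, hi⟩⟩⟩, ⊥, (hc' i hi).hasGrowthRate_ulift hi⟩
      ext c
      simp only [Finset.coe_insert, Finset.coe_singleton, Set.mem_insert_iff,
        Set.mem_singleton_iff]
      constructor
      · rintro ⟨V, _, _, H, hH⟩
        rcases hdich H with h | ⟨i, h1, h5, h⟩
        · exact Or.inr (Or.inr (Or.inr (Or.inr (tendsto_nhds_unique hH h))))
        · have hci := tendsto_nhds_unique hH h
          interval_cases i
          exacts [Or.inl (hci.trans e1), Or.inl (hci.trans e2), Or.inr (Or.inl hci),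
            Or.inr (Or.inr (Or.inl (hci.trans e4))),
            Or.inr (Or.inr (Or.inr (Or.inl (hci.trans e5))))]
      · rintro (rfl | rfl | rfl | rfl | rfl)
        · exact e1 ▸ hedge 1 le_rfl
        · exact hedge 3 (by norm_num)
        · exact e4 ▸ hedge 4 (by norm_num)
        · exact e5 ▸ hedge 5 (by norm_num)
        · exact ⟨ULift.{v} (Fin 6), inferInstance, inferInstance, ⊥,
            CliqueBetti.hasGrowthRate_of_not_isIndContained
              CliqueBetti.not_isIndContained_edgeless_six⟩
    rw [hset, Set.ncard_coe_finset]
    rw [Finset.card_insert_of_notMem, Finset.card_insert_of_notMem, Finset.card_insert_of_notMem,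
      Finset.card_insert_of_notMem, Finset.card_singleton]
    · simpa using n4.ne
    · simp only [Finset.mem_insert, Finset.mem_singleton, not_or]
      exact ⟨n3.ne, (n3.trans n4).ne⟩
    · simp only [Finset.mem_insert, Finset.mem_singleton, not_or]
      exact ⟨n2.ne, (n2.trans n3).ne, (n2.trans (n3.trans n4)).ne⟩
    · simp only [Finset.mem_insert, Finset.mem_singleton, not_or]
      exact ⟨n1.ne, (n1.trans n2).ne, (n1.trans (n2.trans n3)).ne,
        (n1.trans (n2.trans (n3.trans n4))).ne⟩
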